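/- Fix $k>0$, $\alpha\in S^2$ and a bounded domain (nonempty connected open set) $D\subset\mathbb R^3$. All function spaces are complex; a potential $q\in L^2(D)$ is extended by $0$ to $\mathbb R^3$. Let $u_0(x)=e^{ik\alpha\cdot x}$ and $g(x,y)=\frac{e^{ik|x-y|}}{4\pi|x-y|}$. A scattering solution for $q$ with scattering amplitude $A:S^2\to\mathbb C$ is a continuous $u$ with $[\nabla^2+k^2-q]u=0$ in $\mathbb R^3$ in the sense of distributions and $$u(x)=u_0(x)+A(\beta)\frac{e^{ikr}}{r}+o\Big(\frac1r\Big),\qquad r=|x|\to\infty,\ \beta=x/r,$$ uniformly in $\beta$. If $q$ has exactly one scattering solution, it is denoted $u_q$, its amplitude is denoted $A_q(\beta)=A_q(\beta,\alpha,k)$, and we say that $u_q$ exists uniquely. For $h\in L^2(D)$ put $\psi_h(x)=u_0(x)-\int_D g(x,y)h(y)\,dy$. We say that $q=h/\psi_h$ if $\psi_h\ne0$ at almost every point of $\{x\in D: h(x)\neq0\}$ and $q=h/\psi_h$ a.e. in $D$, where $q:=0$ wherever $h=0$. Then the following hold. 1. (Solution of the inverse scattering problem.) For every $f\in L^2(S^2)$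 and $\varepsilon>0$ there are infinitely many $q\in L^2(D)$ such that $u_q$ exists uniquely and $\|f-A_q\|_{L^2(S^2)}<\varepsilon$. Moreover, infinitely many such $q$ belong to $L^\infty(D)$ and have the form $q=h/\psi_h$ with $h\in L^2(D)$ and $|\psi_h|\ge c$ a.e. on $\{h\ne0\}$ for some constant $c>0$. 2. (Explicit formula.) If $h,q\in L^2(D)$ and $q=h/\psi_h$, then $q\psi_h=h$ a.e. in $D$, and $\psi_h$ is a scattering solution for $q$ with amplitude $-\frac1{4\pi}\int_D e^{-ik\beta\cdot x}h(x)\,dx$. 3. (Perturbation.) For every $h\in L^2(D)$ and $\delta>0$ there is $h_\delta\in L^2(D)$ with $\|h_\delta-h\|_{L^2(D)}<\delta$ and a constant $c>0$ such that $|\psi_{h_\delta}|\ge c$ a.e. on $\{h_\delta\neq0\}$, $q_\delta=h_\delta/\psi_{h_\delta}\in L^\infty(D)$, $u_{q_\delta}$ exists uniquely and $u_{q_\delta}=\psi_{h_\delta}$, with $A_{q_\delta}(\beta)=-\frac1{4\pi}\int_D e^{-ik\beta\cdot x}h_\delta(x)\,dx$. 4. The set of functions $\beta\mapsto\int_D e^{-ik\beta\cdot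 x}h(x)\,dx$, $h\in L^2(D)$, is dense (hence total) in $L^2(S^2)$. 5. The set of products $q\,u_q$, over all $q\in L^2(D)$ for which $u_q$ exists uniquely, is dense (hence total) in $L^2(D)$. -/

import Mathlib

open MeasureTheory Metric Set
open scoped ENNReal InnerProductSpace ContDiff

noncomputable section

namespace Scattering

/-- Euclidean three-space. -/
abbrev E3 : Type := EuclideanSpace ℝ (Fin 3)

/-- The unit sphere of `ℝ³`. -/
abbrev S2 : Type := sphere (0 : E3) 1

/-- The surface measure on the unit sphere (of total mass `4π`). -/
abbrev surf : Measure S2 := (volume : Measure E3).toSphere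

/-- The complex space `L²(S²)`. -/
abbrev L2S : Type := Lp ℂ 2 surf

/-- The complex space `L²(D)`, with respect to Lebesgue measure. -/
abbrev L2D (D : Set E3) : Type := Lp ℂ 2 ((volume : Measure E3).restrict D)

/-- The incident plane wave `u₀(x) = exp(i k α·x)`. -/
def planeWave (k : ℝ) (α : S2) (x : E3) : ℂ :=
  Complex.exp (Complex.I * ((k * ⟪(α : E3), x⟫_ℝ : ℝ) : ℂ))

/-- The outgoing fundamental solution `g(x,y) = exp(i k |x-y|) / (4π|x-y|)`. -/
def green (k : ℝ) (x y : E3) : ℂ :=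
  Complex.exp (Complex.I * ((k * ‖x - y‖ : ℝ) : ℂ)) / ((4 * Real.pi * ‖x - y‖ : ℝ) : ℂ)

/-- The far-field integral `∫_D exp(-i k β·x) h(x) dx`. -/
def farField (k : ℝ) (D : Set E3) (h : E3 → ℂ) (β : S2) : ℂ :=
  ∫ x in D, Complex.exp (-(Complex.I * ((k * ⟪(β : E3), x⟫_ℝ : ℝ) : ℂ))) * h x

/-- The function `ψ(x) = u₀(x) - ∫_D g(x,y) h(y) dy`. -/
def denom (k : ℝ) (α : S2) (D : Set E3) (h : E3 → ℂ) (x : E3) : ℂ :=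
  planeWave k α x - ∫ y in D, green k x y * h y

/-- `(∇² + k² - q) u = 0` in `ℝ³`, in the sense of distributions. -/
def SolvesSchrodinger (k : ℝ) (q u : E3 → ℂ) : Prop :=
  ∀ φ : E3 → ℂ, ContDiff ℝ ∞ φ → HasCompactSupport φ →
    ∫ x, (u x * (Laplacian.laplacian φ x + (k : ℂ) ^ 2 * φ x) - q x * u x * φ x) = 0

/-- `u = u₀ + A(β) exp(i k r)/r + o(1/r)` as `r = |x| → ∞`, uniformly in `β = x/r`. -/
def HasFarField (k : ℝ) (α : S2) (u : E3 → ℂ) (A : S2 → ℂ) : Prop :=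
  ∀ η : ℝ, 0 < η → ∃ R : ℝ, 0 < R ∧ ∀ r : ℝ, R ≤ r → ∀ β : S2,
    ‖u (r • (β : E3)) - planeWave k α (r • (β : E3))
      - A β * (Complex.exp (Complex.I * ((k * r : ℝ) : ℂ)) / (r : ℂ))‖ ≤ η / r

/-- `u` is a scattering solution for the potential `q` at wave number `k` and incident
direction `α`, and `A` is its scattering amplitude. -/
structure IsScatteringSolution (k : ℝ) (α : S2) (q u : E3 → ℂ) (A : S2 → ℂ) : Prop where
  continuous : Continuous u
  solves : SolvesSchrodinger k q u
  farField : HasFarField k α u A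

/-- The scattering problem for `q` has exactly one solution, `u` is that solution `u_q`, and
`A` is the scattering amplitude `A_q(·,α,k)`. -/
def IsUniqueScatteringSolution (k : ℝ) (α : S2) (q u : E3 → ℂ) (A : S2 → ℂ) : Prop :=
  IsScatteringSolution k α q u A ∧
    ∀ (u' : E3 → ℂ) (A' : S2 → ℂ), IsScatteringSolution k α q u' A' → u' = u

/-- `q = h / ψ` a.e. in `D`, with `ψ = u₀ - ∫_D g h`; here `ψ ≠ 0` at almost every point of `D`
where `h ≠ 0`, and `q = 0` wherever `h = 0`. -/
def IsQuotientPotential (k : ℝ) (α : S2) (D : Set E3) (h q : E3 → ℂ) : Prop :=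
  (∀ᵐ x ∂((volume : Measure E3).restrict D), h x ≠ 0 → denom k α D h x ≠ 0) ∧
    ∀ᵐ x ∂((volume : Measure E3).restrict D), q x = h x / denom k α D h x

/-- `|ψ| ≥ c > 0` at almost every point of `D` where `h ≠ 0`. -/
def DenomBoundedBelow (k : ℝ) (α : S2) (D : Set E3) (h : E3 → ℂ) : Prop :=
  ∃ c : ℝ, 0 < c ∧
    ∀ᵐ x ∂((volume : Measure E3).restrict D), h x ≠ 0 → c ≤ ‖denom k α D h x‖

end Scattering

end

namespace Scattering

open Filter Topology

/-! Write `G h` for the volume potential of `h` and `ψ = u₀ - G h`. Choosing `h` instead of `q`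
makes the inverse problem linear. Since `(∇² + k²) G h = -h`, the function `ψ` satisfies `(∇² + k²)
ψ = h`, which is the Schrödinger equation as soon as `q ψ = h`. The far field of `ψ - u₀` is
`-1/(4π)` times the far-field integral of `h`. It remains to show that these integrals are dense in
`L²(S²)`, and that an arbitrarily small change of `h` makes `h/ψ` a bounded potential with exactly
one scattering solution.

Density (`dense_farField`): a function `F` orthogonal to all far-field integrals has a plane-wave
superposition vanishing on `D`, hence everywhere by analyticity along lines; by Stone–Weierstrass
plane waves span a dense subspace of `C(S²)`, so `F = 0`.

Lower bound on `ψ` (`exists_isAdmissible_indicator`): since `|u₀| = 1`, the sets where `u₀ - l G h`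
is small are disjoint for well separated complex multipliers `l`. Among many `l` near `1`, one has a
set so small that removing `h` from it hardly changes the potential.

Uniqueness: for complex `q` the homogeneous equation `w = -G(q w)` may have nonzero solutions.
First, the difference `w` of two scattering solutions satisfies this equation
(`eq_neg_potential_of_isOutgoing`). It is tested against a cut-off, regularized outgoing wave; the
error made by the cutoff carries the phase `exp(2ikr)`, because two outgoing phases add, and the
Riemann–Lebesgue lemma removes it. No asymptotics of derivatives of `w` are needed.

Second, small perturbations of `h` make the solution space `N` of the homogeneous equation trivial
(`exists_homSol_eq_bot`). Suppose `N` is nonzero for all nearby densities and take one where `dim N`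
is minimal. First-order perturbation theory then gives `∫ q̇ v w = 0` for all `v, w ∈ N` and all
variations of `h`, where `q̇ = (η + q G η)/ψ`. By symmetry of `G` this says that `v w / ψ` is again,
on the carrier of `h`, an element of `N`. So the quotients `v/ψ` form a finite-dimensional algebra
of functions, which contains a nonzero idempotent: some nonzero `F ∈ N` takes only the values `0`
and `ψ` on the carrier. The same applies to infinitely many multiples `l h`. The Lipschitz bound for
potentials leaves only finitely many possible zero patterns, so two multiples share one; comparing
the two equations at a point where `F ≠ 0` forces `u₀ = 0` there, which is impossible. -/

/-- The volume potential `∫_D g(x,y) f(y) dy`. -/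
noncomputable def potential (k : ℝ) (D : Set E3) (f : E3 → ℂ) (x : E3) : ℂ :=
  ∫ y in D, green k x y * f y

lemma denom_eq (k : ℝ) (α : S2) (D : Set E3) (h : E3 → ℂ) (x : E3) :
    denom k α D h x = planeWave k α x - potential k D h x := rfl

/-! ### Radial integrals of `|z|⁻²` over balls. -/

lemma finrank_E3 : Module.finrank ℝ E3 = 3 := by simp

lemma volume_real_unit_ball : (volume : Measure E3).real (ball 0 1) = 4 * Real.pi / 3 := by
  rw [measureReal_def, EuclideanSpace.volume_ball_fin_three]
  rw [ENNReal.toReal_mul, ENNReal.toReal_ofReal (by positivity)]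
  simp; ring

lemma inv_sq_eq_indicator (r : ℝ) (z : E3) :
    (ball (0 : E3) r).indicator (fun z => (‖z‖ ^ 2)⁻¹) z =
      (fun t : ℝ => (Iio r).indicator (fun t => (t ^ 2)⁻¹) t) ‖z‖ := by
  simp [indicator]

lemma integrableOn_inv_sq (r : ℝ) :
    IntegrableOn (fun z : E3 => (‖z‖ ^ 2)⁻¹) (ball 0 r) := by
  rw [integrableOn_fun_norm_addHaar volume (f := fun t => (t ^ 2)⁻¹)]
  have : IntegrableOn (fun _ : ℝ => (1 : ℝ)) (Ioo 0 r) := by simp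
  refine this.congr_fun (fun t ht => ?_) measurableSet_Ioo
  have : t ≠ 0 := ht.1.ne'
  simp [this]

lemma integral_inv_sq {r : ℝ} (hr : 0 ≤ r) :
    ∫ z in ball (0 : E3) r, (‖z‖ ^ 2)⁻¹ = 4 * Real.pi * r := by
  rw [← integral_indicator measurableSet_ball]
  simp_rw [inv_sq_eq_indicator]
  rw [integral_fun_norm_addHaar (volume : Measure E3)
    (fun t : ℝ => (Iio r).indicator (fun t => (t ^ 2)⁻¹) t)]
  have : ∫ y in Ioi (0 : ℝ), y ^ (Module.finrank ℝ E3 - 1) •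
      (Iio r).indicator (fun t => (t ^ 2)⁻¹) y = r := by
    have h1 : ∀ y ∈ Ioi (0 : ℝ), y ^ (Module.finrank ℝ E3 - 1) •
      (Iio r).indicator (fun t => (t ^ 2)⁻¹) y = (Iio r).indicator (fun _ => (1 : ℝ)) y := by
      intro y hy
      have : y ≠ 0 := ne_of_gt hy
      simp only [finrank_E3, indicator]
      split_ifs <;> simp [this]
    rw [setIntegral_congr_fun measurableSet_Ioi h1, setIntegral_indicator measurableSet_Iio]
    simp [Ioi_inter_Iio, hr]
  rw [this, volume_real_unit_ball, finrank_E3]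
  simp; ring

/-! ### Bounds and continuity for volume potentials. -/

section Kernel

variable {D : Set E3}

lemma integrableOn_inv_sq_sub (x : E3) (r : ℝ) :
    IntegrableOn (fun y : E3 => (‖x - y‖ ^ 2)⁻¹) (ball x r) := by
  have h := (integrableOn_inv_sq r)
  rw [← integrable_indicator_iff measurableSet_ball] at h ⊢
  have := h.comp_sub_left x
  refine this.congr (Eventually.of_forall fun y => ?_)
  simp [indicator, dist_eq_norm, norm_sub_rev]

lemma integral_inv_sq_sub (x : E3) {r : ℝ} (hr : 0 ≤ r) :
    ∫ y in ball x r, (‖x - y‖ ^ 2)⁻¹ = 4 * Real.pi * r := by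
  rw [← integral_inv_sq hr, ← integral_indicator measurableSet_ball,
    ← integral_indicator measurableSet_ball, ← integral_sub_left_eq_self _ _ x]
  congr 1; ext y
  simp [indicator, dist_eq_norm]

lemma inv_sq_le (x y : E3) :
    (‖x - y‖ ^ 2)⁻¹ ≤ (ball x 1).indicator (fun y => (‖x - y‖ ^ 2)⁻¹) y + 1 := by
  by_cases h : y ∈ ball x 1
  · simp [indicator, h]
  · simp only [indicator, h, if_false, zero_add]
    simp only [mem_ball, dist_eq_norm, not_lt, norm_sub_rev y x] at h
    exact inv_le_one_of_one_le₀ (one_le_pow₀ h)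

/-- Split at distance `r`: inside the ball `|x-y|⁻¹ ≤ r |x-y|⁻²`, outside the value is at most
`r⁻¹`. -/
lemma inv_le (x y : E3) {r : ℝ} (hr : 0 < r) :
    ‖x - y‖⁻¹ ≤ r * (ball x r).indicator (fun y => (‖x - y‖ ^ 2)⁻¹) y + r⁻¹ := by
  by_cases h : y ∈ ball x r
  · simp only [indicator, h, if_true]
    simp only [mem_ball, dist_eq_norm, norm_sub_rev y x] at h
    rcases (norm_nonneg (x - y)).eq_or_lt with h0 | h0
    · rw [← h0]; simp; positivity
    · have : ‖x - y‖⁻¹ ≤ r * (‖x - y‖ ^ 2)⁻¹ := by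
        rw [← div_eq_mul_inv, le_div_iff₀ (by positivity), pow_two, ← mul_assoc,
          inv_mul_cancel₀ h0.ne']
        linarith
      have := inv_pos.2 hr
      linarith
  · simp only [indicator, h, if_false, mul_zero, zero_add]
    simp only [mem_ball, dist_eq_norm, not_lt, norm_sub_rev y x] at h
    exact inv_anti₀ hr h

lemma measurable_inv_sq (x : E3) : Measurable (fun y : E3 => (‖x - y‖ ^ 2)⁻¹) := by fun_prop

lemma integrableOn_inv_sq_of_finite (hD : volume D ≠ ⊤) (x : E3) :
    IntegrableOn (fun y : E3 => (‖x - y‖ ^ 2)⁻¹) D := by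
  have : IsFiniteMeasure (volume.restrict D) := ⟨by simpa using hD.lt_top⟩
  refine Integrable.mono' (((integrableOn_inv_sq_sub x 1).integrable_indicator
    measurableSet_ball).restrict.add (integrable_const (1 : ℝ)))
    (measurable_inv_sq x).aestronglyMeasurable (Eventually.of_forall fun y => ?_)
  rw [Real.norm_of_nonneg (by positivity)]
  exact inv_sq_le x y

lemma integral_inv_sq_le (hD : volume D ≠ ⊤) (x : E3) :
    ∫ y in D, (‖x - y‖ ^ 2)⁻¹ ≤ 4 * Real.pi + volume.real D := by
  have : IsFiniteMeasure (volume.restrict D) := ⟨by simpa using hD.lt_top⟩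
  have hi := ((integrableOn_inv_sq_sub x 1).integrable_indicator measurableSet_ball)
  calc ∫ y in D, (‖x - y‖ ^ 2)⁻¹
      ≤ ∫ y in D, ((ball x 1).indicator (fun y => (‖x - y‖ ^ 2)⁻¹) y + 1) :=
        integral_mono (integrableOn_inv_sq_of_finite hD x)
          (hi.restrict.add (integrable_const (1 : ℝ))) (inv_sq_le x)
    _ = (∫ y in D, (ball x 1).indicator (fun y => (‖x - y‖ ^ 2)⁻¹) y) + volume.real D := by
        rw [integral_add hi.restrict (integrable_const (1 : ℝ))]; simp
    _ ≤ (∫ y, (ball x 1).indicator (fun y => (‖x - y‖ ^ 2)⁻¹) y) + volume.real D := by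
        have := setIntegral_le_integral (s := D) hi (Eventually.of_forall fun y =>
          indicator_nonneg (fun _ _ => by positivity) _)
        gcongr ?_ + _
    _ = _ := by
        rw [integral_indicator measurableSet_ball, integral_inv_sq_sub x zero_le_one]; simp

lemma integrableOn_inv_of_finite (hD : volume D ≠ ⊤) (x : E3) :
    IntegrableOn (fun y : E3 => ‖x - y‖⁻¹) D := by
  have : IsFiniteMeasure (volume.restrict D) := ⟨by simpa using hD.lt_top⟩
  refine Integrable.mono' (((integrableOn_inv_sq_sub x 1).integrable_indicator
    measurableSet_ball).restrict.const_mul 1 |>.add (integrable_const (1 : ℝ)⁻¹))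
    (Measurable.aestronglyMeasurable (by fun_prop)) (Eventually.of_forall fun y => ?_)
  rw [Real.norm_of_nonneg (by positivity)]
  exact inv_le x y zero_lt_one

/-- The radius is left free because `r` of order `|D|^(1/3)` gives `O(|D|^(2/3))`. This gain for
sets of small measure is what `exists_isAdmissible_indicator` lives on. -/
lemma integral_inv_le (hD : volume D ≠ ⊤) (x : E3) {r : ℝ} (hr : 0 < r) :
    ∫ y in D, ‖x - y‖⁻¹ ≤ 4 * Real.pi * r ^ 2 + volume.real D / r := by
  have : IsFiniteMeasure (volume.restrict D) := ⟨by simpa using hD.lt_top⟩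
  have hi := ((integrableOn_inv_sq_sub x r).integrable_indicator measurableSet_ball)
  calc ∫ y in D, ‖x - y‖⁻¹
      ≤ ∫ y in D, (r * (ball x r).indicator (fun y => (‖x - y‖ ^ 2)⁻¹) y + r⁻¹) :=
        integral_mono (integrableOn_inv_of_finite hD x)
          ((hi.restrict.const_mul r).add (integrable_const _)) (fun y => inv_le x y hr)
    _ = r * (∫ y in D, (ball x r).indicator (fun y => (‖x - y‖ ^ 2)⁻¹) y)
          + volume.real D / r := by
        rw [integral_add (hi.restrict.const_mul r) (integrable_const _), integral_const_mul]
        simp [div_eq_mul_inv]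
    _ ≤ r * (∫ y, (ball x r).indicator (fun y => (‖x - y‖ ^ 2)⁻¹) y) + volume.real D / r := by
        have := setIntegral_le_integral (s := D) hi (Eventually.of_forall fun y =>
          indicator_nonneg (fun _ _ => by positivity) _)
        gcongr r * ?_ + _
    _ = _ := by
        rw [integral_indicator measurableSet_ball, integral_inv_sq_sub x hr.le]; ring

lemma norm_green (k : ℝ) (x y : E3) : ‖green k x y‖ = (4 * Real.pi)⁻¹ * ‖x - y‖⁻¹ := by
  unfold green
  rw [norm_div, mul_comm Complex.I, Complex.norm_exp_ofReal_mul_I, Complex.norm_real,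
    Real.norm_of_nonneg (by positivity), one_div, mul_inv]

lemma four_pi_inv_le_one : (4 * Real.pi)⁻¹ ≤ 1 :=
  inv_le_one_of_one_le₀ (by nlinarith [Real.pi_gt_three])

lemma norm_green_le (k : ℝ) (x y : E3) : ‖green k x y‖ ≤ ‖x - y‖⁻¹ := by
  rw [norm_green]
  exact mul_le_of_le_one_left (by positivity) four_pi_inv_le_one

lemma green_comm (k : ℝ) (x y : E3) : green k x y = green k y x := by
  unfold green; rw [norm_sub_rev]

lemma measurable_green (k : ℝ) : Measurable (fun p : E3 × E3 => green k p.1 p.2) := by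
  have h : Measurable (fun p : E3 × E3 => ‖p.1 - p.2‖) :=
    (measurable_fst.sub measurable_snd).norm
  have h1 : Measurable (fun t : ℝ => Complex.exp (Complex.I * ((k * t : ℝ) : ℂ)) /
      ((4 * Real.pi * t : ℝ) : ℂ)) := by
    refine Measurable.div (Continuous.measurable (by fun_prop))
      (Continuous.measurable (by fun_prop))
  exact h1.comp h

lemma measurable_green_right (k : ℝ) (x : E3) : Measurable (green k x) := by
  have h : Measurable fun y : E3 => (x, y) := measurable_prodMk_left
  have := (measurable_green k).comp h
  simpa only [Function.comp_def] using this

lemma integrable_green_mul (k : ℝ) (hD : volume D ≠ ⊤) {f : E3 → ℂ} {M : ℝ}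
    (hf : AEStronglyMeasurable f (volume.restrict D))
    (hM : ∀ᵐ y ∂volume.restrict D, ‖f y‖ ≤ M) (x : E3) :
    IntegrableOn (fun y => green k x y * f y) D := by
  refine Integrable.mono' ((integrableOn_inv_of_finite hD x).mul_const M)
    ((measurable_green_right k x).aestronglyMeasurable.mul hf) ?_
  filter_upwards [hM] with y hy
  rw [norm_mul]
  exact mul_le_mul (norm_green_le k x y) hy (norm_nonneg _) (by positivity)

lemma norm_potential_le (k : ℝ) (hD : volume D ≠ ⊤) {f : E3 → ℂ} {M : ℝ}
    (hM : ∀ᵐ y ∂volume.restrict D, ‖f y‖ ≤ M) (x : E3) {r : ℝ} (hr : 0 < r) (hM0 : 0 ≤ M) :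
    ‖potential k D f x‖ ≤ (4 * Real.pi * r ^ 2 + volume.real D / r) * M := by
  calc ‖potential k D f x‖ ≤ ∫ y in D, ‖x - y‖⁻¹ * M := by
        refine norm_integral_le_of_norm_le ((integrableOn_inv_of_finite hD x).mul_const M) ?_
        filter_upwards [hM] with y hy
        rw [norm_mul]
        exact mul_le_mul (norm_green_le k x y) hy (norm_nonneg _) (by positivity)
    _ = (∫ y in D, ‖x - y‖⁻¹) * M := integral_mul_const _ _
    _ ≤ _ := by gcongr; exact integral_inv_le hD x hr

/-- The difference of the moduli and the difference of the phases each contribute a factor `|x -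
x'|`, times a product of inverse distances that is at most a sum of inverse squares. Inverse squares
are locally integrable in dimension three, so potentials of bounded densities are Lipschitz. -/
lemma norm_green_sub_le {k : ℝ} (hk : 0 ≤ k) (x x' y : E3) :
    ‖green k x y - green k x' y‖ ≤
      ‖x - x'‖ * ((1 + k) * ((‖x - y‖ ^ 2)⁻¹ + (‖x' - y‖ ^ 2)⁻¹ + 1)) := by
  set a := ‖x - y‖ with ha
  set b := ‖x' - y‖ with hb
  have hab : |a - b| ≤ ‖x - x'‖ := by
    have := abs_norm_sub_norm_le (x - y) (x' - y)
    simpa using this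
  have key : ∀ {x x' y : E3}, 0 < ‖x - y‖ → 0 < ‖x' - y‖ →
      ‖green k x y - green k x' y‖ ≤ (4 * Real.pi)⁻¹ * (|‖x - y‖ - ‖x' - y‖| *
        (‖x - y‖⁻¹ * ‖x' - y‖⁻¹ + k * ‖x' - y‖⁻¹)) := by
    intro x x' y h1 h2
    have hpi := Real.pi_pos
    set a := ‖x - y‖
    set b := ‖x' - y‖
    have e : green k x y - green k x' y = ((4 * Real.pi)⁻¹ : ℝ) *
        (Complex.exp ((k * a : ℝ) * Complex.I) * ((a⁻¹ - b⁻¹ : ℝ) : ℂ) +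
        (Complex.exp ((k * b : ℝ) * Complex.I) *
          (Complex.exp (Complex.I * ((k * (a - b) : ℝ) : ℂ)) - 1)) * ((b⁻¹ : ℝ) : ℂ)) := by
      have ee : Complex.exp ((k * b : ℝ) * Complex.I) *
          Complex.exp (Complex.I * ((k * (a - b) : ℝ) : ℂ)) =
            Complex.exp ((k * a : ℝ) * Complex.I) := by
        rw [← Complex.exp_add]; congr 1; push_cast; ring
      rw [mul_sub, ee]
      unfold green
      have ha : (a : ℂ) ≠ 0 := by exact_mod_cast h1.ne'
      have hb : (b : ℂ) ≠ 0 := by exact_mod_cast h2.ne'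
      have hp : (Real.pi : ℂ) ≠ 0 := by exact_mod_cast hpi.ne'
      change Complex.exp (Complex.I * ((k * a : ℝ) : ℂ)) / ((4 * Real.pi * a : ℝ) : ℂ) -
        Complex.exp (Complex.I * ((k * b : ℝ) : ℂ)) / ((4 * Real.pi * b : ℝ) : ℂ) = _
      rw [mul_comm Complex.I, mul_comm Complex.I]
      push_cast
      field_simp
      ring
    rw [e, norm_mul, Complex.norm_real, Real.norm_of_nonneg (by positivity)]
    gcongr
    refine (norm_add_le _ _).trans ?_
    rw [norm_mul, norm_mul, norm_mul, Complex.norm_exp_ofReal_mul_I,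
      Complex.norm_exp_ofReal_mul_I, Complex.norm_real, Complex.norm_real, one_mul, one_mul]
    have h3 := Real.norm_exp_I_mul_ofReal_sub_one_le (x := k * (a - b))
    rw [Real.norm_eq_abs, abs_mul, abs_of_nonneg hk] at h3
    have h4 : ‖a⁻¹ - b⁻¹‖ = |a - b| * (a⁻¹ * b⁻¹) := by
      rw [inv_sub_inv h1.ne' h2.ne', norm_div, Real.norm_eq_abs, abs_sub_comm,
        Real.norm_of_nonneg (by positivity), div_eq_mul_inv, mul_inv]
    have h5 : ‖b⁻¹‖ = b⁻¹ := Real.norm_of_nonneg (by positivity)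
    rw [h4, h5]
    have : 0 < b⁻¹ := by positivity
    nlinarith
  have quad : ∀ {a b : ℝ}, a⁻¹ * b⁻¹ ≤ (a ^ 2)⁻¹ + (b ^ 2)⁻¹ + 1 := by
    intro a b
    have : (a ^ 2)⁻¹ = a⁻¹ ^ 2 := by rw [inv_pow]
    have : (b ^ 2)⁻¹ = b⁻¹ ^ 2 := by rw [inv_pow]
    nlinarith [sq_nonneg (a⁻¹ - b⁻¹), sq_nonneg a⁻¹, sq_nonneg b⁻¹]
  have lin : ∀ {b : ℝ}, b⁻¹ ≤ (b ^ 2)⁻¹ + 1 := by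
    intro b
    have : (b ^ 2)⁻¹ = b⁻¹ ^ 2 := by rw [inv_pow]
    nlinarith [sq_nonneg (b⁻¹ - 1)]
  have lin2 : ∀ {a b : ℝ}, b⁻¹ ≤ (a ^ 2)⁻¹ + (b ^ 2)⁻¹ + 1 := fun {a b} => by
    have := lin (b := b); have : 0 ≤ (a ^ 2)⁻¹ := by positivity
    linarith
  -- if one of the distances vanishes, the other equals `‖x - x'‖`
  have deg : ∀ {b : ℝ}, 0 ≤ b → b⁻¹ ≤ b * ((1 + k) * ((b ^ 2)⁻¹ + 1)) := by
    intro b hb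
    rcases hb.eq_or_lt with h | h
    · simp [← h]
    · have e : b * ((1 + k) * ((b ^ 2)⁻¹ + 1)) = (1 + k) * (b⁻¹ + b) := by
        field_simp
      rw [e]
      have : 0 < b⁻¹ := by positivity
      nlinarith
  rcases (norm_nonneg (x - y)).eq_or_lt with h1 | h1
  · have hxy : x = y := by rw [← sub_eq_zero, ← norm_eq_zero, ← h1]
    -- Division by zero gives the kernel the value `0` on the diagonal, so this case is not covered
    -- by `key`.
    have : green k x y = 0 := by simp [green, hxy]
    rw [this, zero_sub, norm_neg]
    refine (norm_green_le k x' y).trans ?_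
    have e1 : a = 0 := h1.symm
    have e2 : ‖x - x'‖ = b := by rw [hxy, norm_sub_rev]
    rw [e1, e2]
    simpa using deg (norm_nonneg (x' - y))
  rcases (norm_nonneg (x' - y)).eq_or_lt with h2 | h2
  · have hxy : x' = y := by rw [← sub_eq_zero, ← norm_eq_zero, ← h2]
    have : green k x' y = 0 := by simp [green, hxy]
    rw [this, sub_zero]
    refine (norm_green_le k x y).trans ?_
    have e1 : b = 0 := h2.symm
    have e2 : ‖x - x'‖ = a := by rw [hxy]
    rw [e1, e2]
    simpa using deg (norm_nonneg (x - y))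
  refine (key h1 h2).trans ?_
  change (4 * Real.pi)⁻¹ * (|a - b| * (a⁻¹ * b⁻¹ + k * b⁻¹)) ≤ _
  have h6 : a⁻¹ * b⁻¹ + k * b⁻¹ ≤ (1 + k) * ((a ^ 2)⁻¹ + (b ^ 2)⁻¹ + 1) := by
    have := quad (a := a) (b := b)
    have := mul_le_mul_of_nonneg_left (lin2 (a := a) (b := b)) hk
    linarith
  have h7 : 0 ≤ a⁻¹ * b⁻¹ + k * b⁻¹ := by positivity
  calc (4 * Real.pi)⁻¹ * (|a - b| * (a⁻¹ * b⁻¹ + k * b⁻¹))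
      ≤ 1 * (|a - b| * (a⁻¹ * b⁻¹ + k * b⁻¹)) := by
        gcongr; exact four_pi_inv_le_one
    _ ≤ ‖x - x'‖ * ((1 + k) * ((a ^ 2)⁻¹ + (b ^ 2)⁻¹ + 1)) := by
        rw [one_mul]; gcongr

/-- A constant controlling the volume potential in terms of its density. -/
noncomputable def potConst (k : ℝ) (D : Set E3) : ℝ :=
  (1 + k) * (8 * Real.pi + 3 * volume.real D)

lemma potConst_nonneg {k : ℝ} (hk : 0 ≤ k) : 0 ≤ potConst k D := by
  unfold potConst; positivity

lemma norm_potential_sub_le {k : ℝ} (hk : 0 ≤ k) (hD : volume D ≠ ⊤) {f : E3 → ℂ} {M : ℝ}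
    (hf : AEStronglyMeasurable f (volume.restrict D))
    (hM : ∀ᵐ y ∂volume.restrict D, ‖f y‖ ≤ M) (hM0 : 0 ≤ M) (x x' : E3) :
    ‖potential k D f x - potential k D f x'‖ ≤ potConst k D * M * ‖x - x'‖ := by
  have : IsFiniteMeasure (volume.restrict D) := ⟨by simpa using hD.lt_top⟩
  unfold potential
  rw [← integral_sub (integrable_green_mul k hD hf hM x) (integrable_green_mul k hD hf hM x')]
  have hi := (((integrableOn_inv_sq_of_finite hD x).add (integrableOn_inv_sq_of_finite hD x')).add
    (integrable_const (1 : ℝ)))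
  calc _ ≤ ∫ y in D, ‖x - x'‖ * ((1 + k) * ((‖x - y‖ ^ 2)⁻¹ + (‖x' - y‖ ^ 2)⁻¹ + 1)) * M := by
        refine norm_integral_le_of_norm_le (((hi.const_mul (1 + k)).const_mul _).mul_const M) ?_
        filter_upwards [hM] with y hy
        rw [← sub_mul, norm_mul]
        exact mul_le_mul (norm_green_sub_le hk x x' y) hy (norm_nonneg _) (by positivity)
    _ = ‖x - x'‖ * ((1 + k) * ((∫ y in D, (‖x - y‖ ^ 2)⁻¹) + (∫ y in D, (‖x' - y‖ ^ 2)⁻¹)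
          + volume.real D)) * M := by
        rw [integral_mul_const, integral_const_mul, integral_const_mul,
          integral_add (f := fun y => (‖x - y‖ ^ 2)⁻¹ + (‖x' - y‖ ^ 2)⁻¹)
            ((integrableOn_inv_sq_of_finite hD x).add
            (integrableOn_inv_sq_of_finite hD x')) (integrable_const (1 : ℝ)),
          integral_add (integrableOn_inv_sq_of_finite hD x) (integrableOn_inv_sq_of_finite hD x')]
        simp
    _ ≤ ‖x - x'‖ * ((1 + k) * ((4 * Real.pi + volume.real D) + (4 * Real.pi + volume.real D)
          + volume.real D)) * M := by
        gcongr
        · exact integral_inv_sq_le hD x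
        · exact integral_inv_sq_le hD x'
    _ = _ := by unfold potConst; ring

lemma norm_potential_le' {k : ℝ} (hk : 0 ≤ k) (hD : volume D ≠ ⊤) {f : E3 → ℂ} {M : ℝ}
    (hM : ∀ᵐ y ∂volume.restrict D, ‖f y‖ ≤ M) (hM0 : 0 ≤ M) (x : E3) :
    ‖potential k D f x‖ ≤ potConst k D * M := by
  refine (norm_potential_le k hD hM x zero_lt_one hM0).trans ?_
  gcongr
  unfold potConst
  have : 0 ≤ volume.real D := measureReal_nonneg
  have := Real.pi_pos
  simp only [one_pow, mul_one, div_one]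
  nlinarith [mul_nonneg hk this.le, mul_nonneg hk ‹0 ≤ volume.real D›]

lemma memLp_green (k : ℝ) (hD : volume D ≠ ⊤) (x : E3) :
    MemLp (green k x) 2 (volume.restrict D) := by
  rw [memLp_two_iff_integrable_sq_norm (measurable_green_right k x).aestronglyMeasurable]
  refine ((integrableOn_inv_sq_of_finite hD x).const_mul ((4 * Real.pi)⁻¹ ^ 2)).congr
    (Eventually.of_forall fun y => ?_)
  simp only [norm_green]; rw [mul_pow, inv_pow ‖x - y‖]

lemma eLpNorm_green_le (k : ℝ) (hD : volume D ≠ ⊤) (x : E3) :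
    eLpNorm (green k x) 2 (volume.restrict D) ≤
      ENNReal.ofReal (Real.sqrt (4 * Real.pi + volume.real D)) := by
  have h := memLp_green k hD x
  rw [h.eLpNorm_eq_integral_rpow_norm (by simp) (by simp)]
  apply ENNReal.ofReal_le_ofReal
  rw [Real.sqrt_eq_rpow]
  simp only [ENNReal.toReal_ofNat, Real.rpow_ofNat, one_div]
  gcongr
  refine le_trans (integral_mono_of_nonneg (Eventually.of_forall fun y => by positivity)
    (integrableOn_inv_sq_of_finite hD x) (Eventually.of_forall fun y => ?_))
    (integral_inv_sq_le hD x)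
  simp only
  rw [← inv_pow]
  gcongr
  exact norm_green_le k x y

lemma integrable_green_mul_of_memLp (k : ℝ) (hD : volume D ≠ ⊤) {f : E3 → ℂ}
    (hf : MemLp f 2 (volume.restrict D)) (x : E3) :
    IntegrableOn (fun y => green k x y * f y) D :=
  MemLp.integrable_mul (memLp_green k hD x) hf

/-- Cauchy–Schwarz; `g(x,·)` lies in `L²(D)` with a norm bounded uniformly in `x`. -/
lemma norm_potential_le_eLpNorm (k : ℝ) (hD : volume D ≠ ⊤) {f : E3 → ℂ}
    (hf : MemLp f 2 (volume.restrict D)) (x : E3) :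
    ‖potential k D f x‖ ≤ Real.sqrt (4 * Real.pi + volume.real D) *
      (eLpNorm f 2 (volume.restrict D)).toReal := by
  have h1 := eLpNorm_smul_le_mul_eLpNorm (p := 2) (q := 2) (r := 1) hf.1 (memLp_green k hD x).1
  have h2 : ‖potential k D f x‖ₑ ≤ eLpNorm (green k x • f) 1 (volume.restrict D) := by
    rw [eLpNorm_one_eq_lintegral_enorm]
    exact enorm_integral_le_lintegral_enorm _
  have h3 : ‖potential k D f x‖ₑ ≤ ENNReal.ofReal (Real.sqrt (4 * Real.pi + volume.real D)) *
      eLpNorm f 2 (volume.restrict D) :=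
    h2.trans (h1.trans (by gcongr; exact eLpNorm_green_le k hD x))
  have := ENNReal.toReal_mono (ENNReal.mul_ne_top ENNReal.ofReal_ne_top hf.2.ne) h3
  rwa [ENNReal.toReal_mul, ENNReal.toReal_ofReal (Real.sqrt_nonneg _), toReal_enorm] at this

lemma potential_sub (k : ℝ) (hD : volume D ≠ ⊤) {f g : E3 → ℂ}
    (hf : MemLp f 2 (volume.restrict D)) (hg : MemLp g 2 (volume.restrict D)) (x : E3) :
    potential k D (fun y => f y - g y) x = potential k D f x - potential k D g x := by
  unfold potential
  rw [← integral_sub (integrable_green_mul_of_memLp k hD hf x)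
    (integrable_green_mul_of_memLp k hD hg x)]
  simp_rw [mul_sub]

lemma continuous_potential_of_bounded {k : ℝ} (hk : 0 ≤ k) (hD : volume D ≠ ⊤) {f : E3 → ℂ}
    {M : ℝ} (hf : AEStronglyMeasurable f (volume.restrict D))
    (hM : ∀ᵐ y ∂volume.restrict D, ‖f y‖ ≤ M) (hM0 : 0 ≤ M) :
    Continuous (potential k D f) := by
  refine (LipschitzWith.of_dist_le_mul (K := (potConst k D * M).toNNReal) fun x x' => ?_).continuous
  rw [dist_eq_norm, dist_eq_norm, Real.coe_toNNReal _ (mul_nonneg (potConst_nonneg hk) hM0)]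
  exact norm_potential_sub_le hk hD hf hM hM0 x x'

end Kernel

/-- Approximation of the density in `L²` by bounded functions is uniform approximation of the
potential, and potentials of bounded densities are Lipschitz. -/
lemma continuous_potential {k : ℝ} (hk : 0 ≤ k) {D : Set E3} (hD : volume D ≠ ⊤)
    {f : E3 → ℂ} (hf : MemLp f 2 (volume.restrict D)) : Continuous (potential k D f) := by
  have : IsFiniteMeasure (volume.restrict D) := ⟨by simpa using hD.lt_top⟩
  refine continuous_of_uniform_approx_of_continuous fun u hu => ?_
  obtain ⟨ε, hε, hu⟩ := Metric.mem_uniformity_dist.1 hu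
  set C := Real.sqrt (4 * Real.pi + volume.real D) with hC
  have hC0 : 0 ≤ C := Real.sqrt_nonneg _
  obtain ⟨g, hg, hg2⟩ := hf.exists_boundedContinuous_eLpNorm_sub_le (by simp)
    (ε := ENNReal.ofReal (ε / (2 * (C + 1)))) (by simp; positivity)
  refine ⟨potential k D g, continuous_potential_of_bounded hk hD hg2.1
    (Eventually.of_forall g.norm_coe_le_norm) (norm_nonneg _), fun x => hu ?_⟩
  rw [dist_eq_norm, ← potential_sub k hD hf hg2]
  refine (norm_potential_le_eLpNorm k hD (hf.sub hg2) x).trans_lt ?_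
  have h1 : (eLpNorm (f - ⇑g) 2 (volume.restrict D)).toReal ≤ ε / (2 * (C + 1)) :=
    ENNReal.toReal_le_of_le_ofReal (by positivity) hg
  calc C * (eLpNorm (f - ⇑g) 2 (volume.restrict D)).toReal ≤ C * (ε / (2 * (C + 1))) := by gcongr
    _ < ε := by
      rw [mul_div_assoc', div_lt_iff₀ (by positivity)]
      nlinarith

/-! ### Green's identity, plane waves and radial functions. -/

section Laplacian

lemma laplacian_eq_sum {φ : E3 → ℂ} (hφ : ContDiff ℝ 2 φ) (x : E3) :
    Laplacian.laplacian φ x = ∑ i, fderiv ℝ (fun y => fderiv ℝ φ y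
      (EuclideanSpace.basisFun (Fin 3) ℝ i)) x (EuclideanSpace.basisFun (Fin 3) ℝ i) := by
  rw [InnerProductSpace.laplacian_eq_iteratedFDeriv_orthonormalBasis φ
    (EuclideanSpace.basisFun (Fin 3) ℝ)]
  refine Finset.sum_congr rfl fun i _ => ?_
  rw [iteratedFDeriv_two_apply]
  have h : DifferentiableAt ℝ (fderiv ℝ φ) x :=
    ((hφ.fderiv_right (m := 1) (by norm_num)).differentiable (by norm_num)) x
  rw [fderiv_clm_apply h (differentiableAt_const _)]
  simp

lemma contDiff_fderiv_apply {φ : E3 → ℂ} (hφ : ContDiff ℝ 2 φ) (v : E3) :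
    ContDiff ℝ 1 (fun y => fderiv ℝ φ y v) :=
  (hφ.fderiv_right (m := 1) (by norm_num)).clm_apply contDiff_const

lemma continuous_laplacian {φ : E3 → ℂ} (hφ : ContDiff ℝ 2 φ) :
    Continuous (Laplacian.laplacian φ) := by
  have : Laplacian.laplacian φ = fun x => _ := funext fun x => laplacian_eq_sum hφ x
  rw [this]
  refine continuous_finsetSum _ fun i _ => ?_
  exact ((contDiff_fderiv_apply hφ _).continuous_fderiv (by norm_num)).clm_apply continuous_const

lemma hasCompactSupport_laplacian {φ : E3 → ℂ} (hc : HasCompactSupport φ) :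
    HasCompactSupport (Laplacian.laplacian φ) := by
  rw [InnerProductSpace.laplacian_eq_iteratedFDeriv_orthonormalBasis φ
    (EuclideanSpace.basisFun (Fin 3) ℝ)]
  refine (hc.iteratedFDeriv (𝕜 := ℝ) 2).mono' fun x hx => subset_tsupport _ ?_
  rw [Function.mem_support] at hx ⊢
  contrapose! hx
  simp [hx]

/-- Only one factor needs compact support, so the other may be a plane wave or a regularized
spherical wave. -/
lemma integral_mul_laplacian {f φ : E3 → ℂ} (hf : ContDiff ℝ 2 f) (hφ : ContDiff ℝ 2 φ)
    (hc : HasCompactSupport φ) :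
    ∫ x, f x * Laplacian.laplacian φ x = ∫ x, Laplacian.laplacian f x * φ x := by
  have aux : ∀ {f φ : E3 → ℂ}, ContDiff ℝ 1 f → ContDiff ℝ 1 φ → HasCompactSupport φ → ∀ v,
      ∫ x, f x * fderiv ℝ φ x v = - ∫ x, fderiv ℝ f x v * φ x := by
    intro f φ hf hφ hc v
    have c1 : Continuous fun x => fderiv ℝ f x v :=
      (hf.continuous_fderiv (by norm_num)).clm_apply continuous_const
    have c2 : Continuous fun x => fderiv ℝ φ x v :=
      (hφ.continuous_fderiv (by norm_num)).clm_apply continuous_const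
    exact integral_mul_fderiv_eq_neg_fderiv_mul_of_integrable
      ((c1.mul hφ.continuous).integrable_of_hasCompactSupport hc.mul_left)
      ((hf.continuous.mul c2).integrable_of_hasCompactSupport
        ((hc.fderiv_apply (𝕜 := ℝ) v).mul_left))
      ((hf.continuous.mul hφ.continuous).integrable_of_hasCompactSupport hc.mul_left)
      (fun x _ => hf.differentiable (by norm_num) x) (fun x _ => hφ.differentiable (by norm_num) x)
  simp_rw [laplacian_eq_sum hφ, laplacian_eq_sum hf, Finset.mul_sum, Finset.sum_mul]
  have c : ∀ {f : E3 → ℂ}, ContDiff ℝ 2 f → ∀ v : E3, Continuous fun x =>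
      fderiv ℝ (fun y => fderiv ℝ f y v) x v := fun hf v =>
    ((contDiff_fderiv_apply hf v).continuous_fderiv (by norm_num)).clm_apply continuous_const
  rw [integral_finsetSum, integral_finsetSum]
  · refine Finset.sum_congr rfl fun i _ => ?_
    have e1 := aux (hf.of_le (by norm_num)) (contDiff_fderiv_apply hφ
      (EuclideanSpace.basisFun (Fin 3) ℝ i)) (hc.fderiv_apply (𝕜 := ℝ) _)
      (EuclideanSpace.basisFun (Fin 3) ℝ i)
    have e2 := aux (contDiff_fderiv_apply hf (EuclideanSpace.basisFun (Fin 3) ℝ i))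
      (hφ.of_le (by norm_num)) hc (EuclideanSpace.basisFun (Fin 3) ℝ i)
    rw [e1, e2, neg_neg]
  · exact fun i _ => ((c hf _).mul hφ.continuous).integrable_of_hasCompactSupport hc.mul_left
  · exact fun i _ => (hf.continuous.mul (c hφ _)).integrable_of_hasCompactSupport
      (((hc.fderiv_apply (𝕜 := ℝ) _).fderiv_apply (𝕜 := ℝ) _).mul_left)

lemma contDiff_planeWave (k : ℝ) (α : S2) : ContDiff ℝ ∞ (planeWave k α) := by
  unfold planeWave
  refine Complex.contDiff_exp.comp (contDiff_const.mul ?_)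
  exact Complex.ofRealCLM.contDiff.comp (contDiff_const.mul (contDiff_const.inner ℝ contDiff_id))

lemma laplacian_planeWave (k : ℝ) (α : S2) (x : E3) :
    Laplacian.laplacian (planeWave k α) x = -(k : ℂ) ^ 2 * planeWave k α x := by
  have h1 : ∀ x v, fderiv ℝ (planeWave k α) x v =
      Complex.I * ((k * ⟪(α : E3), v⟫_ℝ : ℝ) : ℂ) * planeWave k α x := by
    intro x v
    have hin : HasFDerivAt (fun y : E3 => k * ⟪(α : E3), y⟫_ℝ) (k • innerSL ℝ (α : E3)) x :=
      ((innerSL ℝ (α : E3)).hasFDerivAt).const_mul k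
    have h2 : HasFDerivAt (planeWave k α) _ x :=
      ((Complex.ofRealCLM.hasFDerivAt.comp x hin).const_mul Complex.I).cexp
    rw [h2.fderiv]
    simp [planeWave]
    ring
  have hs : ContDiff ℝ 2 (planeWave k α) := (contDiff_planeWave k α).of_le (by norm_cast)
  rw [laplacian_eq_sum hs]
  have h3 : ∀ v : E3, fderiv ℝ (fun y => fderiv ℝ (planeWave k α) y v) x v =
      -(((k * ⟪(α : E3), v⟫_ℝ) ^ 2 : ℝ) : ℂ) * planeWave k α x := by
    intro v
    simp_rw [h1]
    rw [fderiv_const_mul (hs.differentiable (by norm_num) x)]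
    simp only [smul_apply, smul_eq_mul, h1]
    push_cast
    linear_combination ((k : ℂ) * ((⟪(α : E3), v⟫_ℝ : ℝ) : ℂ)) ^ 2 * planeWave k α x * Complex.I_sq
  simp_rw [h3, ← Finset.sum_mul]
  congr 1
  rw [Finset.sum_neg_distrib, ← Complex.ofReal_sum]
  simp_rw [mul_pow, ← Finset.mul_sum]
  have := (EuclideanSpace.basisFun (Fin 3) ℝ).sum_sq_inner_left (α : E3)
  rw [this]
  simp

lemma integral_planeWave_mul (k : ℝ) (α : S2) {φ : E3 → ℂ} (hφ : ContDiff ℝ 2 φ)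
    (hc : HasCompactSupport φ) :
    ∫ x, planeWave k α x * (Laplacian.laplacian φ x + (k : ℂ) ^ 2 * φ x) = 0 := by
  have hs : ContDiff ℝ 2 (planeWave k α) := (contDiff_planeWave k α).of_le (by norm_cast)
  have i1 : Integrable fun x => planeWave k α x * Laplacian.laplacian φ x :=
    (hs.continuous.mul (continuous_laplacian hφ)).integrable_of_hasCompactSupport
      (hasCompactSupport_laplacian hc).mul_left
  have i2 : Integrable fun x => planeWave k α x * ((k : ℂ) ^ 2 * φ x) :=
    (hs.continuous.mul (continuous_const.mul
      hφ.continuous)).integrable_of_hasCompactSupport hc.mul_left.mul_left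
  simp_rw [mul_add]
  rw [integral_add i1 i2, integral_mul_laplacian hs hφ hc]
  simp_rw [laplacian_planeWave]
  rw [← neg_eq_iff_add_eq_zero, ← integral_neg]
  congr 1; ext x; ring

/-- The Laplacian of a function of `‖y - x‖²` in three dimensions. -/
lemma laplacian_radial {F F' F'' : ℝ → ℂ} (x : E3)
    (hs : ContDiff ℝ 2 fun y : E3 => F (‖y - x‖ ^ 2))
    (h1 : ∀ t, 0 ≤ t → HasDerivAt F (F' t) t) (h2 : ∀ t, 0 ≤ t → HasDerivAt F' (F'' t) t)
    (y : E3) :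
    Laplacian.laplacian (fun y : E3 => F (‖y - x‖ ^ 2)) y =
      4 * ((‖y - x‖ ^ 2 : ℝ) : ℂ) * F'' (‖y - x‖ ^ 2) + 6 * F' (‖y - x‖ ^ 2) := by
  have hn : ∀ y, HasFDerivAt (fun y : E3 => ‖y - x‖ ^ 2) (2 • innerSL ℝ (y - x)) y := by
    intro y
    have := ((hasFDerivAt_id y).sub_const x).norm_sq
    simpa using this
  have d1 : ∀ y v, fderiv ℝ (fun y : E3 => F (‖y - x‖ ^ 2)) y v =
      ((2 * ⟪y - x, v⟫_ℝ : ℝ) : ℂ) * F' (‖y - x‖ ^ 2) := by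
    intro y v
    have := (h1 (‖y - x‖ ^ 2) (by positivity)).hasFDerivAt.comp y (hn y)
    have e := this.fderiv
    simp only [Function.comp_def] at e
    rw [e]
    simp [inner_sub_left]
    ring
  rw [laplacian_eq_sum hs]
  have d2 : ∀ v : E3, fderiv ℝ (fun z => fderiv ℝ (fun y : E3 => F (‖y - x‖ ^ 2)) z v) y v =
      4 * ((⟪v, y - x⟫_ℝ ^ 2 : ℝ) : ℂ) * F'' (‖y - x‖ ^ 2) +
        2 * ((‖v‖ ^ 2 : ℝ) : ℂ) * F' (‖y - x‖ ^ 2) := by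
    intro v
    simp_rw [d1]
    have e1 := (h2 (‖y - x‖ ^ 2) (by positivity)).hasFDerivAt.comp y (hn y)
    have e2 : HasFDerivAt (fun z : E3 => 2 * ⟪z - x, v⟫_ℝ) ((2 : ℝ) • innerSL ℝ v) y := by
      have : HasFDerivAt (fun z : E3 => 2 * ⟪v, z - x⟫_ℝ) ((2 : ℝ) • innerSL ℝ v) y := by
        have := ((innerSL ℝ v).hasFDerivAt.comp y ((hasFDerivAt_id y).sub_const x)).const_mul 2
        simpa [Function.comp_def] using this
      simpa only [real_inner_comm] using this
    have e3 := (Complex.ofRealCLM.hasFDerivAt.comp y e2).mul e1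
    have e := e3.fderiv
    simp only [Function.comp_def, Complex.ofRealCLM_apply] at e
    have e' := DFunLike.congr_fun e v
    refine e'.trans ?_
    have e4 : ⟪y - x, v⟫_ℝ = ⟪v, y - x⟫_ℝ := real_inner_comm _ _
    rw [inner_sub_left] at e4
    simp only [add_apply, smul_apply, ContinuousLinearMap.comp_apply,
      ContinuousLinearMap.toSpanSingleton_apply, innerSL_apply_apply, smul_eq_mul,
      Complex.ofRealCLM_apply, Complex.real_smul, nsmul_eq_mul, inner_sub_left, e4,
      real_inner_self_eq_norm_sq]
    push_cast
    ring
  simp_rw [d2]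
  have hb := (EuclideanSpace.basisFun (Fin 3) ℝ).sum_sq_inner_right (y - x)
  rw [Finset.sum_add_distrib, ← Finset.sum_mul, ← Finset.mul_sum, ← Complex.ofReal_sum, hb]
  simp
  ring

end Laplacian

/-! ### The fundamental solution as a limit of smooth outgoing waves. -/

section Regularization

/-- The regularized outgoing spherical wave `exp(ikρ)/ρ`, `ρ = √(t + ε²)`, where `t = |y|²`. -/
noncomputable def regWave (k ε t : ℝ) : ℂ :=
  Complex.exp (Complex.I * ((k * √(t + ε ^ 2) : ℝ) : ℂ)) * ((√(t + ε ^ 2) : ℝ) : ℂ)⁻¹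

/-- The derivative of `regWave` in `t`. -/
noncomputable def regWave' (k ε t : ℝ) : ℂ :=
  Complex.exp (Complex.I * ((k * √(t + ε ^ 2) : ℝ) : ℂ)) *
    (Complex.I * k * ((√(t + ε ^ 2) : ℝ) : ℂ)⁻¹ ^ 2 - ((√(t + ε ^ 2) : ℝ) : ℂ)⁻¹ ^ 3) / 2

/-- The second derivative of `regWave` in `t`. -/
noncomputable def regWave'' (k ε t : ℝ) : ℂ :=
  Complex.exp (Complex.I * ((k * √(t + ε ^ 2) : ℝ) : ℂ)) *
    (-(k : ℂ) ^ 2 * ((√(t + ε ^ 2) : ℝ) : ℂ)⁻¹ ^ 3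
      - 3 * Complex.I * k * ((√(t + ε ^ 2) : ℝ) : ℂ)⁻¹ ^ 4
      + 3 * ((√(t + ε ^ 2) : ℝ) : ℂ)⁻¹ ^ 5) / 4

/-- The function `(∇² + k²)` of the regularized outgoing wave. -/
noncomputable def regSource (k ε t : ℝ) : ℂ :=
  (ε : ℂ) ^ 2 * Complex.exp (Complex.I * ((k * √(t + ε ^ 2) : ℝ) : ℂ)) *
    ((k : ℂ) ^ 2 * ((√(t + ε ^ 2) : ℝ) : ℂ)⁻¹ ^ 3
      + 3 * Complex.I * k * ((√(t + ε ^ 2) : ℝ) : ℂ)⁻¹ ^ 4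
      - 3 * ((√(t + ε ^ 2) : ℝ) : ℂ)⁻¹ ^ 5)

variable {k ε : ℝ}

lemma hasDerivAt_sqrt_add (hε : 0 < ε) {t : ℝ} (ht : 0 ≤ t) :
    HasDerivAt (fun t : ℝ => ((√(t + ε ^ 2) : ℝ) : ℂ))
      (((√(t + ε ^ 2) : ℝ) : ℂ)⁻¹ / 2) t := by
  have h := ((hasDerivAt_id t).add_const (ε ^ 2)).sqrt (by positivity)
  have := h.ofReal_comp
  refine this.congr_deriv ?_
  simp only [id]
  push_cast
  ring

lemma sqrt_ne_zero' (hε : 0 < ε) {t : ℝ} (ht : 0 ≤ t) : ((√(t + ε ^ 2) : ℝ) : ℂ) ≠ 0 := by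
  have : 0 < √(t + ε ^ 2) := by positivity
  exact_mod_cast this.ne'

lemma hasDerivAt_exp_sqrt (hε : 0 < ε) {t : ℝ} (ht : 0 ≤ t) :
    HasDerivAt (fun t : ℝ => Complex.exp (Complex.I * ((k * √(t + ε ^ 2) : ℝ) : ℂ)))
      (Complex.exp (Complex.I * ((k * √(t + ε ^ 2) : ℝ) : ℂ)) *
        (Complex.I * k * (((√(t + ε ^ 2) : ℝ) : ℂ)⁻¹ / 2))) t := by
  have h := ((hasDerivAt_sqrt_add hε ht).const_mul (Complex.I * k)).cexp
  simp only [Complex.ofReal_mul, ← mul_assoc] at h ⊢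
  exact h

lemma hasDerivAt_inv_sqrt (hε : 0 < ε) {t : ℝ} (ht : 0 ≤ t) :
    HasDerivAt (fun t : ℝ => ((√(t + ε ^ 2) : ℝ) : ℂ)⁻¹)
      (-((√(t + ε ^ 2) : ℝ) : ℂ)⁻¹ ^ 3 / 2) t := by
  have h := (hasDerivAt_sqrt_add hε ht).inv (sqrt_ne_zero' hε ht)
  refine h.congr_deriv ?_
  have := sqrt_ne_zero' hε ht
  field_simp

lemma hasDerivAt_regWave (hε : 0 < ε) {t : ℝ} (ht : 0 ≤ t) :
    HasDerivAt (regWave k ε) (regWave' k ε t) t := by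
  have h := (hasDerivAt_exp_sqrt (k := k) hε ht).mul (hasDerivAt_inv_sqrt hε ht)
  refine h.congr_deriv ?_
  unfold regWave'; ring

lemma hasDerivAt_regWave' (hε : 0 < ε) {t : ℝ} (ht : 0 ≤ t) :
    HasDerivAt (regWave' k ε) (regWave'' k ε t) t := by
  have h := ((hasDerivAt_exp_sqrt (k := k) hε ht).mul
    ((((hasDerivAt_inv_sqrt hε ht).pow 2).const_mul (Complex.I * k)).sub
      ((hasDerivAt_inv_sqrt hε ht).pow 3))).div_const 2
  refine h.congr_deriv ?_
  unfold regWave''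
  simp only [Nat.cast_ofNat, Nat.add_one_sub_one, pow_one, Pi.sub_apply, Pi.pow_apply]
  linear_combination ((k : ℂ) ^ 2 * Complex.exp (Complex.I * ((k * √(t + ε ^ 2) : ℝ) : ℂ)) *
    ((√(t + ε ^ 2) : ℝ) : ℂ)⁻¹ ^ 3 / 4) * Complex.I_sq

/-- Put `t = ρ² - ε²` in the radial Laplacian `4 t F'' + 6 F'`. The terms without `ε` cancel, since
`exp(ikρ)/ρ` solves the Helmholtz equation away from the origin when `ρ` is the distance; the source
therefore carries a factor `ε²`. -/
lemma regSource_eq (hε : 0 < ε) {t : ℝ} (ht : 0 ≤ t) :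
    4 * (t : ℂ) * regWave'' k ε t + 6 * regWave' k ε t + (k : ℂ) ^ 2 * regWave k ε t =
      regSource k ε t := by
  have h0 := sqrt_ne_zero' hε ht
  have h1 : (t : ℂ) = ((√(t + ε ^ 2) : ℝ) : ℂ) ^ 2 - (ε : ℂ) ^ 2 := by
    rw [← Complex.ofReal_pow, Real.sq_sqrt (by positivity)]; push_cast; ring
  unfold regSource regWave regWave' regWave''
  set ρ := ((√(t + ε ^ 2) : ℝ) : ℂ)
  rw [h1]
  field_simp
  ring

lemma norm_regWave_le {t : ℝ} : ‖regWave k ε t‖ ≤ (√(t))⁻¹ ∨ t ≤ 0 := by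
  rcases le_or_gt t 0 with h | h
  · exact Or.inr h
  left
  unfold regWave
  rw [norm_mul, mul_comm Complex.I, Complex.norm_exp_ofReal_mul_I, norm_inv, Complex.norm_real,
    one_mul, Real.norm_of_nonneg (Real.sqrt_nonneg _)]
  have : 0 < √t := Real.sqrt_pos.2 h
  gcongr
  nlinarith

lemma contDiff_regWave (k : ℝ) (hε : 0 < ε) (x : E3) :
    ContDiff ℝ ∞ fun y : E3 => regWave k ε (‖y - x‖ ^ 2) := by
  unfold regWave
  have h : ContDiff ℝ ∞ fun y : E3 => √(‖y - x‖ ^ 2 + ε ^ 2) := by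
    refine ContDiff.sqrt (((contDiff_id.sub contDiff_const).norm_sq ℝ).add contDiff_const)
      fun y => ?_
    positivity
  have hc : ContDiff ℝ ∞ fun y : E3 => ((√(‖y - x‖ ^ 2 + ε ^ 2) : ℝ) : ℂ) :=
    Complex.ofRealCLM.contDiff.comp h
  refine ContDiff.mul ?_ (hc.inv fun y => sqrt_ne_zero' hε (by positivity))
  refine Complex.contDiff_exp.comp (contDiff_const.mul ?_)
  exact Complex.ofRealCLM.contDiff.comp (contDiff_const.mul h)

lemma laplacian_regWave (hε : 0 < ε) (x y : E3) :
    Laplacian.laplacian (fun y : E3 => regWave k ε (‖y - x‖ ^ 2)) y +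
      (k : ℂ) ^ 2 * regWave k ε (‖y - x‖ ^ 2) = regSource k ε (‖y - x‖ ^ 2) := by
  rw [laplacian_radial x ((contDiff_regWave k hε x).of_le (by norm_cast))
    (fun t ht => hasDerivAt_regWave hε ht) (fun t ht => hasDerivAt_regWave' hε ht),
    ← regSource_eq hε (by positivity)]

lemma integral_inv_pow_five :
    ∫ z : E3, (√(1 + ‖z‖ ^ 2))⁻¹ ^ 5 = 4 * Real.pi / 3 := by
  rw [integral_fun_norm_addHaar (volume : Measure E3) (fun t : ℝ => (√(1 + t ^ 2))⁻¹ ^ 5),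
    volume_real_unit_ball, finrank_E3]
  have hpos : ∀ t : ℝ, 0 < √(1 + t ^ 2) := fun t => by positivity
  have h : ∫ y in Ioi (0 : ℝ), y ^ (3 - 1) • (√(1 + y ^ 2))⁻¹ ^ 5 = 1 / 3 - 0 := by
    -- The antiderivative comes from the substitution `t = tan θ`, where it is `sin³ θ / 3`.
    have hd : ∀ t : ℝ, HasDerivAt (fun t : ℝ => (t * (√(1 + t ^ 2))⁻¹) ^ 3 / 3)
        (t ^ (3 - 1) • (√(1 + t ^ 2))⁻¹ ^ 5) t := by
      intro t
      have h1 := (((hasDerivAt_id t).pow 2).const_add 1).sqrt (x := t)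
        (by simp only [Pi.pow_apply, id]; positivity)
      have h2 := ((((hasDerivAt_id t).mul (h1.inv (by simpa using (hpos t).ne'))).pow 3).div_const 3)
      refine h2.congr_deriv ?_
      have hs : √(1 + t ^ 2) ^ 2 = 1 + t ^ 2 := Real.sq_sqrt (by positivity)
      have := (hpos t).ne'
      simp only [Pi.pow_apply, id, Pi.mul_apply, Pi.inv_apply, smul_eq_mul]
      field_simp
      rw [div_pow, hs]
      field_simp
      ring
    have := integral_Ioi_of_hasDerivAt_of_nonneg (a := 0) (l := 1 / 3)
      (hd 0).continuousAt.continuousWithinAt (fun t _ => hd t)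
      (fun t (ht : 0 < t) => by positivity) ?_
    · rw [this]; simp
    · have h3 : Tendsto (fun t : ℝ => t * (√(1 + t ^ 2))⁻¹) atTop (𝓝 1) := by
        have h4 : Tendsto (fun t : ℝ => √(1 - (1 + t ^ 2)⁻¹)) atTop (𝓝 √(1 - 0)) := by
          refine (Real.continuous_sqrt.tendsto _).comp (tendsto_const_nhds.sub ?_)
          refine tendsto_inv_atTop_zero.comp (tendsto_atTop_add_const_left _ _ ?_)
          exact tendsto_pow_atTop (by norm_num)
        rw [sub_zero, Real.sqrt_one] at h4
        refine h4.congr' ?_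
        filter_upwards [eventually_ge_atTop 0] with t ht
        have : 1 - (1 + t ^ 2)⁻¹ = t ^ 2 / (1 + t ^ 2) := by field_simp; ring
        rw [this, Real.sqrt_div (by positivity), Real.sqrt_sq ht, div_eq_mul_inv]
      simpa using (h3.pow 3).div_const 3
  rw [h]
  simp; ring

lemma integrable_inv_pow_four : Integrable fun z : E3 => (√(1 + ‖z‖ ^ 2))⁻¹ ^ 4 := by
  have := integrable_rpow_neg_one_add_norm_sq (E := E3) (μ := volume) (r := 4) (by simp; norm_num)
  refine this.congr (Eventually.of_forall fun z => ?_)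
  have h : (0 : ℝ) < 1 + ‖z‖ ^ 2 := by positivity
  have e : (√(1 + ‖z‖ ^ 2)) ^ 4 = (1 + ‖z‖ ^ 2) ^ 2 := by
    rw [show (4 : ℕ) = 2 * 2 by rfl, pow_mul, Real.sq_sqrt h.le]
  simp only
  rw [show (-4 / 2 : ℝ) = -(2 : ℕ) by norm_num, Real.rpow_neg h.le, Real.rpow_natCast, inv_pow, e]

/-- The regularized sources concentrate at the origin with total mass `-4π`. -/
lemma tendsto_integral_regSource (hk : 0 ≤ k) {v : E3 → ℂ} (hv : Continuous v) {C : ℝ} (x : E3)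
    (hC : ∀ y, ‖v (x + y)‖ * (1 + ‖y‖) ≤ C) :
    Tendsto (fun ε => ∫ y, v y * regSource k ε (‖y - x‖ ^ 2)) (𝓝[>] 0)
      (𝓝 (-(4 * Real.pi) * v x)) := by
  have hC0 : 0 ≤ C := le_trans (by positivity) (hC 0)
  set s : E3 → ℝ := fun z => √(1 + ‖z‖ ^ 2) with hs
  have hs1 : ∀ z, 1 ≤ s z := fun z => Real.one_le_sqrt.2 (by nlinarith [sq_nonneg ‖z‖])
  have hsle : ∀ z, s z ≤ 1 + ‖z‖ := fun z =>
    Real.sqrt_le_iff.2 ⟨by positivity, by nlinarith [norm_nonneg z]⟩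
  have hsc : Continuous s := by fun_prop
  -- The integrand after `y = x + ε z`, with the Jacobian `ε³` absorbed; unlike the source itself it
  -- is continuous at `ε = 0`, where only the `-3 s⁻⁵` term survives and has integral `-4π`.
  set Φ : ℝ → E3 → ℂ := fun ε z => v (x + ε • z) *
    (Complex.exp (Complex.I * ((k * (ε * s z) : ℝ) : ℂ)) *
      ((k : ℂ) ^ 2 * ε ^ 2 * ((s z : ℝ) : ℂ)⁻¹ ^ 3
      + 3 * Complex.I * k * ε * ((s z : ℝ) : ℂ)⁻¹ ^ 4 - 3 * ((s z : ℝ) : ℂ)⁻¹ ^ 5)) with hΦ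
  have hsub : ∀ ε : ℝ, 0 < ε → ∫ y, v y * regSource k ε (‖y - x‖ ^ 2) = ∫ z, Φ ε z := by
    intro ε hε
    have e1 : ∫ y, v y * regSource k ε (‖y - x‖ ^ 2) =
        ∫ y, v (x + y) * regSource k ε (‖y‖ ^ 2) := by
      rw [← integral_add_left_eq_self _ x]; simp
    have e2 := Measure.integral_comp_smul (volume : Measure E3)
      (fun y => v (x + y) * regSource k ε (‖y‖ ^ 2)) ε
    rw [finrank_E3, abs_of_pos (by positivity)] at e2
    rw [e1]
    have e3 : ∫ y, v (x + y) * regSource k ε (‖y‖ ^ 2) =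
        (ε ^ 3) • ∫ z, v (x + ε • z) * regSource k ε (‖ε • z‖ ^ 2) := by
      rw [e2, smul_smul, mul_inv_cancel₀ (by positivity), one_smul]
    rw [e3, ← integral_smul]
    congr 1; ext z
    have e4 : √(‖ε • z‖ ^ 2 + ε ^ 2) = ε * s z := by
      rw [norm_smul, Real.norm_of_nonneg hε.le, hs]
      rw [show (ε * ‖z‖) ^ 2 + ε ^ 2 = ε ^ 2 * (1 + ‖z‖ ^ 2) by ring,
        Real.sqrt_mul (by positivity), Real.sqrt_sq hε.le]
    simp only [hΦ, regSource, e4]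
    have h5 : (ε : ℂ) ≠ 0 := by exact_mod_cast hε.ne'
    have h6 : ((s z : ℝ) : ℂ) ≠ 0 := by exact_mod_cast (zero_lt_one.trans_le (hs1 z)).ne'
    rw [Complex.real_smul]
    push_cast
    field_simp
  have hlim : Tendsto (fun ε => ∫ z, Φ ε z) (𝓝[>] 0)
      (𝓝 (∫ z, v x * (-3 * ((s z : ℝ) : ℂ)⁻¹ ^ 5))) := by
    refine tendsto_integral_filter_of_dominated_convergence
      (fun z => C * (k ^ 2 + 3 * k + 3) * (s z)⁻¹ ^ 4) ?_ ?_ ?_ ?_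
    · refine Eventually.of_forall fun ε => Continuous.aestronglyMeasurable ?_
      have hsne : ∀ z, ((s z : ℝ) : ℂ) ≠ 0 := fun z => by
        exact_mod_cast (zero_lt_one.trans_le (hs1 z)).ne'
      have hsi : Continuous fun z => ((s z : ℝ) : ℂ)⁻¹ :=
        (Complex.continuous_ofReal.comp hsc).inv₀ hsne
      simp only [hΦ]
      fun_prop
    · filter_upwards [Ioc_mem_nhdsGT (zero_lt_one (α := ℝ))] with ε hε
      refine Eventually.of_forall fun z => ?_
      have hε0 := hε.1
      have hs0 : 0 < s z := zero_lt_one.trans_le (hs1 z)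
      have hb := hC (ε • z)
      rw [norm_smul, Real.norm_of_nonneg hε0.le] at hb
      have hvle : ‖v (x + ε • z)‖ ≤ C := by
        refine le_trans ?_ hb
        exact le_mul_of_one_le_right (norm_nonneg _) (by have := norm_nonneg z; nlinarith)
      have hvs : ‖v (x + ε • z)‖ * (ε * s z) ≤ C := by
        refine le_trans ?_ hb
        gcongr
        have := hsle z
        nlinarith [hε.2, norm_nonneg z]
      simp only [hΦ]
      rw [norm_mul, norm_mul, mul_comm Complex.I, Complex.norm_exp_ofReal_mul_I, one_mul]
      have hn : ‖(k : ℂ) ^ 2 * ε ^ 2 * ((s z : ℝ) : ℂ)⁻¹ ^ 3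
        + 3 * Complex.I * k * ε * ((s z : ℝ) : ℂ)⁻¹ ^ 4 - 3 * ((s z : ℝ) : ℂ)⁻¹ ^ 5‖ ≤
          k ^ 2 * ε ^ 2 * (s z)⁻¹ ^ 3 + 3 * k * ε * (s z)⁻¹ ^ 4 + 3 * (s z)⁻¹ ^ 5 := by
        refine (norm_sub_le _ _).trans (add_le_add ((norm_add_le _ _).trans (add_le_add ?_ ?_)) ?_)
        · simp [abs_of_nonneg hk, abs_of_pos hε0, abs_of_pos hs0]
        · simp [abs_of_nonneg hk, abs_of_pos hε0, abs_of_pos hs0]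
        · simp [abs_of_pos hs0]
      refine (mul_le_mul_of_nonneg_left hn (norm_nonneg _)).trans ?_
      set a := ‖v (x + ε • z)‖
      set p := (s z)⁻¹ with hp
      have hp0 : 0 < p := inv_pos.2 hs0
      have hp1 : p ≤ 1 := inv_le_one_of_one_le₀ (hs1 z)
      have ha : 0 ≤ a := norm_nonneg _
      -- The term in `s⁻³` is not integrable by itself; the decay of `v` trades a factor `ε` for a
      -- further `s⁻¹`, giving the integrable majorant `s⁻⁴`.
      have haε : a * ε ≤ C * p := by
        rw [hp, ← div_eq_mul_inv, le_div_iff₀ hs0]; linarith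
      have t1 : a * ε * ε ≤ C * p :=
        (mul_le_of_le_one_right (by positivity) hε.2).trans haε
      have t2 : a * ε ≤ C := haε.trans (mul_le_of_le_one_right hC0 hp1)
      have t3 : a * p ≤ C := (mul_le_of_le_one_right ha hp1).trans hvle
      calc a * (k ^ 2 * ε ^ 2 * p ^ 3 + 3 * k * ε * p ^ 4 + 3 * p ^ 5)
          = k ^ 2 * p ^ 3 * (a * ε * ε) + 3 * k * p ^ 4 * (a * ε) + 3 * p ^ 4 * (a * p) := by ring
        _ ≤ k ^ 2 * p ^ 3 * (C * p) + 3 * k * p ^ 4 * C + 3 * p ^ 4 * C := by gcongr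
        _ = _ := by ring
    · exact integrable_inv_pow_four.const_mul _
    · refine Eventually.of_forall fun z => ?_
      have hc : Continuous fun ε => Φ ε z := by simp only [hΦ]; fun_prop
      have := (hc.tendsto 0).mono_left (nhdsWithin_le_nhds (s := Ioi 0))
      simpa [hΦ] using this
  have hval : ∫ z, v x * (-3 * ((s z : ℝ) : ℂ)⁻¹ ^ 5) = -(4 * Real.pi) * v x := by
    rw [integral_const_mul, integral_const_mul]
    have : ∫ z, ((s z : ℝ) : ℂ)⁻¹ ^ 5 = ((4 * Real.pi / 3 : ℝ) : ℂ) := by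
      rw [← integral_inv_pow_five, ← integral_complex_ofReal]
      simp [hs]
    rw [this]; push_cast; ring
  rw [hval] at hlim
  refine hlim.congr' ?_
  filter_upwards [self_mem_nhdsWithin] with ε hε
  exact (hsub ε hε).symm

lemma tendsto_integral_regWave {f : E3 → ℂ} (x : E3) (hf : AEStronglyMeasurable f)
    (hi : Integrable fun y => ‖y - x‖⁻¹ * ‖f y‖) :
    Tendsto (fun ε => ∫ y, f y * regWave k ε (‖y - x‖ ^ 2)) (𝓝[>] 0)
      (𝓝 (4 * Real.pi * ∫ y, green k x y * f y)) := by
  rw [← integral_const_mul]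
  refine tendsto_integral_filter_of_dominated_convergence _ ?_ ?_ hi ?_
  · filter_upwards [self_mem_nhdsWithin] with ε hε
    exact hf.mul (contDiff_regWave k hε x).continuous.aestronglyMeasurable
  · filter_upwards [self_mem_nhdsWithin] with ε hε
    have : ∀ᵐ y : E3, y ≠ x := by simp [ae_iff]
    filter_upwards [this] with y hy
    have h0 : 0 < ‖y - x‖ := norm_pos_iff.2 (sub_ne_zero.2 hy)
    rcases norm_regWave_le (k := k) (ε := ε) (t := ‖y - x‖ ^ 2) with h | h
    · rw [norm_mul, mul_comm]
      rw [Real.sqrt_sq h0.le] at h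
      gcongr
    · exact absurd h (by have := sq_pos_of_pos h0; linarith)
  · have : ∀ᵐ y : E3, y ≠ x := by simp [ae_iff]
    filter_upwards [this] with y hy
    have h0 : 0 < ‖y - x‖ := norm_pos_iff.2 (sub_ne_zero.2 hy)
    have hc : ContinuousAt (fun ε => f y * regWave k ε (‖y - x‖ ^ 2)) 0 := by
      unfold regWave
      refine continuousAt_const.mul (ContinuousAt.mul (by fun_prop) (ContinuousAt.inv₀
        (by fun_prop) ?_))
      simp [h0.ne']
    have := hc.tendsto.mono_left (nhdsWithin_le_nhds (s := Ioi 0))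
    convert this using 2
    unfold green regWave
    rw [norm_sub_rev x y]
    have hp : (Real.pi : ℂ) ≠ 0 := by exact_mod_cast Real.pi_ne_zero
    have hy : (‖y - x‖ : ℂ) ≠ 0 := by exact_mod_cast h0.ne'
    simp only [ne_eq, OfNat.ofNat_ne_zero, not_false_eq_true, zero_pow, add_zero,
      Real.sqrt_sq h0.le]
    push_cast
    field_simp

lemma integrable_inv_norm_mul {f : E3 → ℂ} (hf : Continuous f) (hc : HasCompactSupport f)
    (x : E3) : Integrable fun y => ‖y - x‖⁻¹ * ‖f y‖ := by
  obtain ⟨M, hM⟩ := hc.exists_bound_of_continuous hf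
  have hK : volume (tsupport f) ≠ ⊤ := (IsCompact.measure_lt_top hc).ne
  have h := (integrableOn_inv_of_finite hK x).mul_const M
  rw [← IntegrableOn, ← integrable_indicator_iff (isClosed_tsupport f).measurableSet] at h
  refine h.mono' ?_ (Eventually.of_forall fun y => ?_)
  · exact (Measurable.aestronglyMeasurable (by fun_prop)).mul hf.norm.aestronglyMeasurable
  · rw [Real.norm_of_nonneg (by positivity)]
    by_cases hy : y ∈ tsupport f
    · simp only [indicator, hy, if_true, norm_sub_rev x y]
      gcongr
      exact hM y
    · simp [indicator, hy, image_eq_zero_of_notMem_tsupport hy]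

/-- `g(x,·)` is a fundamental solution of the Helmholtz operator. -/
lemma integral_green_mul_helmholtz (hk : 0 ≤ k) {φ : E3 → ℂ} (hφ : ContDiff ℝ 2 φ)
    (hc : HasCompactSupport φ) (x : E3) :
    ∫ y, green k x y * (Laplacian.laplacian φ y + (k : ℂ) ^ 2 * φ y) = -φ x := by
  set f : E3 → ℂ := fun y => Laplacian.laplacian φ y + (k : ℂ) ^ 2 * φ y with hf
  have hfc : Continuous f := (continuous_laplacian hφ).add (continuous_const.mul hφ.continuous)
  have hfs : HasCompactSupport f := (hasCompactSupport_laplacian hc).add hc.mul_left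
  have l1 := tendsto_integral_regWave (k := k) x hfc.aestronglyMeasurable
    (integrable_inv_norm_mul hfc hfs x)
  obtain ⟨C, hC⟩ : ∃ C, ∀ y, ‖φ (x + y)‖ * (1 + ‖y‖) ≤ C := by
    have h1 : HasCompactSupport fun y => φ (x + y) := hc.comp_homeomorph (Homeomorph.addLeft x)
    have h2 : HasCompactSupport fun y => φ (x + y) * ((1 + ‖y‖ : ℝ) : ℂ) := h1.mul_right
    obtain ⟨C, hC⟩ := h2.exists_bound_of_continuous (by have := hφ.continuous; fun_prop)
    refine ⟨C, fun y => ?_⟩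
    have := hC y
    rwa [norm_mul, Complex.norm_real, Real.norm_of_nonneg (by positivity)] at this
  have l2 := tendsto_integral_regSource hk hφ.continuous x hC
  -- Green's identity moves the Helmholtz operator from `φ` to the smooth wave, so the limits `l1`
  -- and `l2` concern the same integral.
  have he : ∀ᶠ ε in 𝓝[>] (0 : ℝ), ∫ y, φ y * regSource k ε (‖y - x‖ ^ 2) =
      ∫ y, f y * regWave k ε (‖y - x‖ ^ 2) := by
    filter_upwards [self_mem_nhdsWithin] with ε hε
    have hG : ContDiff ℝ 2 fun y : E3 => regWave k ε (‖y - x‖ ^ 2) :=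
      (contDiff_regWave k hε x).of_le (by norm_cast)
    have i1 : Integrable fun y => regWave k ε (‖y - x‖ ^ 2) * Laplacian.laplacian φ y :=
      (hG.continuous.mul (continuous_laplacian hφ)).integrable_of_hasCompactSupport
        (hasCompactSupport_laplacian hc).mul_left
    have i2 : Integrable fun y => (k : ℂ) ^ 2 * regWave k ε (‖y - x‖ ^ 2) * φ y :=
      ((continuous_const.mul hG.continuous).mul hφ.continuous).integrable_of_hasCompactSupport
        hc.mul_left
    have i3 : Integrable fun y =>
        Laplacian.laplacian (fun y : E3 => regWave k ε (‖y - x‖ ^ 2)) y * φ y :=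
      ((continuous_laplacian hG).mul hφ.continuous).integrable_of_hasCompactSupport hc.mul_left
    calc ∫ y, φ y * regSource k ε (‖y - x‖ ^ 2)
        = ∫ y, (Laplacian.laplacian (fun y : E3 => regWave k ε (‖y - x‖ ^ 2)) y * φ y +
          (k : ℂ) ^ 2 * regWave k ε (‖y - x‖ ^ 2) * φ y) := by
          congr 1; ext y; rw [← laplacian_regWave hε]; ring
      _ = ∫ y, (regWave k ε (‖y - x‖ ^ 2) * Laplacian.laplacian φ y +
          (k : ℂ) ^ 2 * regWave k ε (‖y - x‖ ^ 2) * φ y) := by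
          rw [integral_add i3 i2, integral_add i1 i2, integral_mul_laplacian hG hφ hc]
      _ = _ := by congr 1; ext y; simp only [hf]; ring
  have := tendsto_nhds_unique (l2.congr' he) l1
  have hp : (4 * Real.pi : ℂ) ≠ 0 := by
    exact_mod_cast (mul_pos (by norm_num : (0 : ℝ) < 4) Real.pi_pos).ne'
  have h2 : (4 * Real.pi : ℂ) * ∫ y, green k x y * f y = 4 * Real.pi * (-φ x) := by
    rw [← this]; ring
  exact mul_left_cancel₀ hp h2

end Regularization

/-! ### The function `ψ` solves the equation and has the stated far field. -/

section ExplicitSolution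

variable {k : ℝ} {D : Set E3}

/-- This is `(∇² + k²) G h = -h` in the sense of distributions: Fubini reduces it to the fundamental
solution. Fubini applies because `∫ |g(x,y) f(x)| dx` is bounded in `y` and `h` is integrable on
`D`. -/
lemma integral_potential_mul_helmholtz (hk : 0 ≤ k) (hD : volume D ≠ ⊤)
    {h : E3 → ℂ} (hh : MemLp h 2 (volume.restrict D)) {φ : E3 → ℂ} (hφ : ContDiff ℝ 2 φ)
    (hc : HasCompactSupport φ) :
    ∫ x, potential k D h x * (Laplacian.laplacian φ x + (k : ℂ) ^ 2 * φ x) =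
      -∫ y in D, h y * φ y := by
  have : IsFiniteMeasure (volume.restrict D) := ⟨by simpa using hD.lt_top⟩
  set f : E3 → ℂ := fun y => Laplacian.laplacian φ y + (k : ℂ) ^ 2 * φ y with hf
  have hfc : Continuous f := (continuous_laplacian hφ).add (continuous_const.mul hφ.continuous)
  have hfs : HasCompactSupport f := (hasCompactSupport_laplacian hc).add hc.mul_left
  obtain ⟨M, hM⟩ := hfs.exists_bound_of_continuous hfc
  have hM0 : 0 ≤ M := (norm_nonneg _).trans (hM 0)
  have hK : volume (tsupport f) ≠ ⊤ := (IsCompact.measure_lt_top hfs).ne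
  have hgm : ∀ y, Integrable fun x => green k x y * f x := by
    intro y
    refine (integrable_inv_norm_mul hfc hfs y).mono' ?_ (Eventually.of_forall fun x => ?_)
    · simp_rw [green_comm k _ y]
      exact (measurable_green_right k y).aestronglyMeasurable.mul hfc.aestronglyMeasurable
    · rw [norm_mul]
      gcongr
      exact norm_green_le k x y
  have hbound : ∀ y, ∫ x, ‖green k x y * f x‖ ≤ (4 * Real.pi * 1 ^ 2 +
      volume.real (tsupport f) / 1) * M := by
    intro y
    calc ∫ x, ‖green k x y * f x‖ = ∫ x in tsupport f, ‖green k x y * f x‖ := by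
          rw [setIntegral_eq_integral_of_forall_compl_eq_zero]
          intro x hx
          simp [image_eq_zero_of_notMem_tsupport hx]
      _ ≤ ∫ x in tsupport f, ‖y - x‖⁻¹ * M := by
          refine integral_mono_of_nonneg (Eventually.of_forall fun x => norm_nonneg _)
            ((integrableOn_inv_of_finite hK y).mul_const M) (Eventually.of_forall fun x => ?_)
          simp only [norm_mul]
          rw [green_comm]
          exact mul_le_mul (norm_green_le k y x) (hM x) (norm_nonneg _) (by positivity)
      _ = (∫ x in tsupport f, ‖y - x‖⁻¹) * M := integral_mul_const _ _
      _ ≤ _ := by gcongr; exact integral_inv_le hK y zero_lt_one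
  have hint : Integrable (Function.uncurry fun x y => green k x y * h y * f x)
      (volume.prod (volume.restrict D)) := by
    have hmeas : AEStronglyMeasurable (Function.uncurry fun x y => green k x y * h y * f x)
        (volume.prod (volume.restrict D)) :=
      ((measurable_green k).aestronglyMeasurable.mul hh.1.comp_snd).mul
        (hfc.comp continuous_fst).aestronglyMeasurable
    rw [integrable_prod_iff' hmeas]
    refine ⟨Eventually.of_forall fun y => ?_, ?_⟩
    · refine ((hgm y).mul_const (h y)).congr (Eventually.of_forall fun x => ?_)
      simp only [Function.uncurry]; ring
    · have hh1 : Integrable h (volume.restrict D) := hh.integrable (by norm_num)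
      refine (hh1.norm.const_mul ((4 * Real.pi * 1 ^ 2 +
        volume.real (tsupport f) / 1) * M)).mono' ?_ (Eventually.of_forall fun y => ?_)
      · exact hmeas.norm.prod_swap.integral_prod_right'
      · have e : ∫ x, ‖Function.uncurry (fun x y => green k x y * h y * f x) (x, y)‖ =
            (∫ x, ‖green k x y * f x‖) * ‖h y‖ := by
          rw [← integral_mul_const]
          congr 1; ext x; simp only [Function.uncurry, norm_mul]; ring
        rw [e, Real.norm_of_nonneg (by positivity)]
        gcongr
        exact hbound y
  calc ∫ x, potential k D h x * f x
      = ∫ x, ∫ y in D, green k x y * h y * f x := by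
        simp_rw [potential, integral_mul_const]
    _ = ∫ y in D, ∫ x, green k x y * h y * f x := integral_integral_swap hint
    _ = ∫ y in D, -(h y * φ y) := by
        congr 1; ext y
        have := integral_green_mul_helmholtz hk hφ hc y
        rw [← mul_neg, ← this, ← integral_const_mul]
        congr 1; ext x; rw [green_comm k x y]; ring
    _ = _ := integral_neg _

lemma continuous_denom (hk : 0 ≤ k) (α : S2) (hD : volume D ≠ ⊤)
    {h : E3 → ℂ} (hh : MemLp h 2 (volume.restrict D)) : Continuous (denom k α D h) :=
  (contDiff_planeWave k α).continuous.sub (continuous_potential hk hD hh)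

/-- The plane wave contributes nothing and the potential contributes `h`, which equals `q ψ`. Only
this product identity enters, not any lower bound on `ψ`. -/
lemma solvesSchrodinger_denom (hk : 0 ≤ k) (α : S2) (hDm : MeasurableSet D) (hD : volume D ≠ ⊤)
    {h q : E3 → ℂ} (hh : MemLp h 2 (volume.restrict D))
    (hq : ∀ᵐ x ∂volume.restrict D, q x * denom k α D h x = h x) :
    SolvesSchrodinger k (D.indicator q) (denom k α D h) := by
  intro φ hφ hc
  have hφ2 : ContDiff ℝ 2 φ := hφ.of_le (by norm_cast)
  set f : E3 → ℂ := fun y => Laplacian.laplacian φ y + (k : ℂ) ^ 2 * φ y with hf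
  have hfc : Continuous f := (continuous_laplacian hφ2).add (continuous_const.mul hφ.continuous)
  have hfs : HasCompactSupport f := (hasCompactSupport_laplacian hc).add hc.mul_left
  have i1 : Integrable fun x => planeWave k α x * f x :=
    ((contDiff_planeWave k α).continuous.mul hfc).integrable_of_hasCompactSupport hfs.mul_left
  have i2 : Integrable fun x => potential k D h x * f x :=
    ((continuous_potential hk hD hh).mul hfc).integrable_of_hasCompactSupport hfs.mul_left
  have hae : (fun x => D.indicator q x * denom k α D h x * φ x) =ᵐ[volume]
      D.indicator fun x => h x * φ x := by
    rw [ae_restrict_iff' hDm] at hq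
    filter_upwards [hq] with x hx
    by_cases hxD : x ∈ D
    · simp [hxD, hx hxD]
    · simp [hxD]
  have i3 : IntegrableOn (fun x => h x * φ x) D := by
    obtain ⟨M, hM⟩ := hc.exists_bound_of_continuous hφ.continuous
    have : IsFiniteMeasure (volume.restrict D) := ⟨by simpa using hD.lt_top⟩
    exact (hh.integrable (by norm_num)).mul_bdd (c := M) hφ.continuous.aestronglyMeasurable
      (Eventually.of_forall hM)
  have i3' : Integrable fun x => D.indicator q x * denom k α D h x * φ x :=
    (i3.integrable_indicator hDm).congr hae.symm
  have i4 : Integrable fun x => denom k α D h x * f x := by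
    refine (i1.sub i2).congr (Eventually.of_forall fun x => ?_)
    simp [denom_eq]; ring
  change ∫ x, (denom k α D h x * f x - D.indicator q x * denom k α D h x * φ x) = 0
  rw [integral_sub i4 i3', integral_congr_ae hae, integral_indicator hDm]
  have e : ∫ x, denom k α D h x * f x =
      (∫ x, planeWave k α x * f x) - ∫ x, potential k D h x * f x := by
    rw [← integral_sub i1 i2]
    congr 1; ext x; rw [denom_eq]; ring
  rw [e, integral_planeWave_mul k α hφ2 hc, integral_potential_mul_helmholtz hk hD hh hφ2 hc]
  ring

lemma norm_S2 (β : S2) : ‖(β : E3)‖ = 1 := by simp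

/-- Distance from a far point to a bounded one. -/
lemma abs_norm_sub_le (β : S2) {R r : ℝ} (hR : 0 < R) (hr : 2 * R ≤ r) {y : E3} (hy : ‖y‖ ≤ R) :
    r / 2 ≤ ‖r • (β : E3) - y‖ ∧
      |‖r • (β : E3) - y‖ - (r - ⟪(β : E3), y⟫_ℝ)| ≤ R ^ 2 / r := by
  have hr0 : 0 < r := by linarith
  have hin : |⟪(β : E3), y⟫_ℝ| ≤ R := by
    have := abs_real_inner_le_norm (β : E3) y
    rw [norm_S2, one_mul] at this
    exact this.trans hy
  have hb := abs_le.1 hin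
  have hd : r / 2 ≤ ‖r • (β : E3) - y‖ := by
    have := norm_sub_norm_le (r • (β : E3)) y
    rw [norm_smul, norm_S2, mul_one, Real.norm_of_nonneg hr0.le] at this
    linarith
  refine ⟨hd, ?_⟩
  have hsq : ‖r • (β : E3) - y‖ ^ 2 = r ^ 2 - 2 * r * ⟪(β : E3), y⟫_ℝ + ‖y‖ ^ 2 := by
    rw [norm_sub_sq_real, norm_smul, norm_S2, mul_one, Real.norm_of_nonneg hr0.le,
      real_inner_smul_left]; ring
  set d := ‖r • (β : E3) - y‖
  set b := ⟪(β : E3), y⟫_ℝ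
  rw [le_div_iff₀ hr0]
  -- Difference of squares: `d² - (r - b)² = |y|² - b²`, and `d + (r - b) ≥ r` because each summand
  -- is at least `r/2`.
  have h1 : |d - (r - b)| * (d + (r - b)) = |‖y‖ ^ 2 - b ^ 2| := by
    rw [← abs_of_nonneg (by linarith : 0 ≤ d + (r - b)), ← abs_mul]
    congr 1
    linear_combination hsq
  have h2 : b ^ 2 ≤ ‖y‖ ^ 2 := by
    have := abs_real_inner_le_norm (β : E3) y
    rw [norm_S2, one_mul] at this
    exact sq_le_sq' (by linarith [(abs_le.1 this).1]) (abs_le.1 this).2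
  have h3 : |‖y‖ ^ 2 - b ^ 2| ≤ R ^ 2 := by
    rw [abs_of_nonneg (by linarith)]
    have := pow_le_pow_left₀ (norm_nonneg y) hy 2
    nlinarith [sq_nonneg b]
  calc |d - (r - b)| * r ≤ |d - (r - b)| * (d + (r - b)) := by gcongr; linarith
    _ ≤ R ^ 2 := by rw [h1]; exact h3

lemma norm_exp_I_sub_le (a b : ℝ) :
    ‖Complex.exp (Complex.I * (a : ℂ)) - Complex.exp (Complex.I * (b : ℂ))‖ ≤ |a - b| := by
  have e : Complex.exp (Complex.I * (a : ℂ)) - Complex.exp (Complex.I * (b : ℂ)) =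
      Complex.exp ((b : ℂ) * Complex.I) * (Complex.exp (Complex.I * ((a - b : ℝ) : ℂ)) - 1) := by
    rw [mul_sub, ← Complex.exp_add, mul_one, mul_comm (b : ℂ)]
    congr 2; push_cast; ring
  rw [e, norm_mul, Complex.norm_exp_ofReal_mul_I, one_mul]
  exact Real.norm_exp_I_mul_ofReal_sub_one_le

/-- Far-field expansion of the outgoing spherical wave. -/
lemma norm_green_sub_farField_le (hk : 0 ≤ k) (β : S2) {R r : ℝ} (hR : 0 < R) (hr : 2 * R ≤ r)
    {y : E3} (hy : ‖y‖ ≤ R) :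
    ‖green k (r • (β : E3)) y - (1 / (4 * (Real.pi : ℂ))) *
      (Complex.exp (-(Complex.I * ((k * ⟪(β : E3), y⟫_ℝ : ℝ) : ℂ)))) *
      (Complex.exp (Complex.I * ((k * r : ℝ) : ℂ)) / (r : ℂ))‖ ≤
      (2 * k * R ^ 2 + 2 * R) / r ^ 2 := by
  have hr0 : 0 < r := by linarith
  obtain ⟨h1, h2⟩ := abs_norm_sub_le β hR hr hy
  have hin : |⟪(β : E3), y⟫_ℝ| ≤ R := by
    have := abs_real_inner_le_norm (β : E3) y
    rw [norm_S2, one_mul] at this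
    exact this.trans hy
  have hdr : |‖r • (β : E3) - y‖ - r| ≤ R := by
    have := abs_norm_sub_norm_le (r • (β : E3) - y) (r • (β : E3))
    rw [norm_smul, norm_S2, mul_one, Real.norm_of_nonneg hr0.le] at this
    refine this.trans ?_
    simpa using hy
  unfold green
  set d := ‖r • (β : E3) - y‖
  set b := ⟪(β : E3), y⟫_ℝ
  have hd0 : 0 < d := by linarith
  -- Separates the phase error (`d` against `r - b`) from the amplitude error (`d⁻¹` against `r⁻¹`);
  -- each is `O(r⁻²)`.
  have e : Complex.exp (Complex.I * ((k * d : ℝ) : ℂ)) / ((4 * Real.pi * d : ℝ) : ℂ) -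
      (1 / (4 * (Real.pi : ℂ))) * Complex.exp (-(Complex.I * ((k * b : ℝ) : ℂ))) *
      (Complex.exp (Complex.I * ((k * r : ℝ) : ℂ)) / (r : ℂ)) =
      ((4 * Real.pi)⁻¹ : ℝ) * ((Complex.exp (Complex.I * ((k * d : ℝ) : ℂ)) -
        Complex.exp (Complex.I * ((k * (r - b) : ℝ) : ℂ))) * ((d⁻¹ : ℝ) : ℂ) +
        Complex.exp (((k * (r - b) : ℝ) : ℂ) * Complex.I) * ((d⁻¹ - r⁻¹ : ℝ) : ℂ)) := by
    have ee : Complex.exp (-(Complex.I * ((k * b : ℝ) : ℂ))) *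
        Complex.exp (Complex.I * ((k * r : ℝ) : ℂ)) =
        Complex.exp (((k * (r - b) : ℝ) : ℂ) * Complex.I) := by
      rw [← Complex.exp_add]; congr 1; push_cast; ring
    rw [mul_comm Complex.I ((k * (r - b) : ℝ) : ℂ)]
    rw [mul_assoc (1 / (4 * (Real.pi : ℂ))),
      ← mul_div_assoc (Complex.exp (-(Complex.I * ((k * b : ℝ) : ℂ)))), ee]
    have hp : (Real.pi : ℂ) ≠ 0 := by exact_mod_cast Real.pi_ne_zero
    have h4 : (d : ℂ) ≠ 0 := by exact_mod_cast hd0.ne'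
    have h5 : (r : ℂ) ≠ 0 := by exact_mod_cast hr0.ne'
    push_cast
    field_simp
    ring
  rw [e, norm_mul, Complex.norm_real, Real.norm_of_nonneg (by positivity)]
  refine (mul_le_of_le_one_left (norm_nonneg _) four_pi_inv_le_one).trans ?_
  refine (norm_add_le _ _).trans ?_
  rw [norm_mul, norm_mul, Complex.norm_exp_ofReal_mul_I, one_mul, Complex.norm_real,
    Complex.norm_real]
  have hdi : d⁻¹ ≤ 2 / r := by
    rw [inv_eq_one_div, div_le_div_iff₀ hd0 hr0]; linarith
  have t1 : ‖Complex.exp (Complex.I * ((k * d : ℝ) : ℂ)) -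
      Complex.exp (Complex.I * ((k * (r - b) : ℝ) : ℂ))‖ * ‖d⁻¹‖ ≤ k * (R ^ 2 / r) * (2 / r) := by
    refine mul_le_mul ((norm_exp_I_sub_le _ _).trans ?_) ?_ (norm_nonneg _) (by positivity)
    · rw [← mul_sub, abs_mul, abs_of_nonneg hk]; gcongr
    · rwa [Real.norm_of_nonneg (by positivity)]
  have t2 : ‖d⁻¹ - r⁻¹‖ ≤ R * (2 / r) * (1 / r) := by
    rw [inv_sub_inv hd0.ne' hr0.ne', Real.norm_eq_abs, abs_div, abs_mul, abs_of_pos hd0,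
      abs_of_pos hr0, abs_sub_comm, div_eq_mul_inv, mul_inv, ← mul_assoc]
    rw [one_div]
    gcongr
  calc _ ≤ k * (R ^ 2 / r) * (2 / r) + R * (2 / r) * (1 / r) := add_le_add t1 t2
    _ = _ := by field_simp

lemma norm_exp_neg_I_inner (k : ℝ) (β y : E3) :
    ‖Complex.exp (-(Complex.I * ((k * ⟪β, y⟫_ℝ : ℝ) : ℂ)))‖ = 1 := by
  rw [← mul_neg, mul_comm, ← Complex.ofReal_neg, Complex.norm_exp_ofReal_mul_I]

lemma integrable_exp_mul {h : E3 → ℂ} (hh : IntegrableOn h D) (β : E3) :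
    IntegrableOn (fun y => Complex.exp (-(Complex.I * ((k * ⟪β, y⟫_ℝ : ℝ) : ℂ))) * h y) D := by
  refine hh.bdd_mul (c := 1) (Continuous.aestronglyMeasurable (by fun_prop))
    (Eventually.of_forall fun y => (norm_exp_neg_I_inner k β y).le)

/-- The kernel expansion has error `C/r²`, uniformly for `y` in the bounded set `D` and for all
directions; integration against `h ∈ L¹(D)` keeps this rate. -/
lemma hasFarField_denom (hk : 0 ≤ k) (α : S2) (hDm : MeasurableSet D)
    (hDb : Bornology.IsBounded D)
    {h : E3 → ℂ} (hh : MemLp h 2 (volume.restrict D)) :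
    HasFarField k α (denom k α D h)
      (fun β => -(1 / (4 * (Real.pi : ℂ))) * farField k D h β) := by
  have hD : volume D ≠ ⊤ := hDb.measure_lt_top.ne
  have : IsFiniteMeasure (volume.restrict D) := ⟨by simpa using hD.lt_top⟩
  have hh1 : IntegrableOn h D := hh.integrable (by norm_num)
  obtain ⟨R, hR, hDR⟩ : ∃ R : ℝ, 0 < R ∧ ∀ y ∈ D, ‖y‖ ≤ R := by
    obtain ⟨R, hR⟩ := hDb.exists_norm_le
    exact ⟨max R 1, by positivity, fun y hy => (hR y hy).trans (le_max_left _ _)⟩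
  intro η hη
  set N := ∫ y in D, ‖h y‖
  have hN : 0 ≤ N := integral_nonneg fun _ => norm_nonneg _
  set C := (2 * k * R ^ 2 + 2 * R)
  have hC : 0 < C := by positivity
  refine ⟨max (2 * R) (C * N / η), by positivity, fun r hr β => ?_⟩
  have hr1 : 2 * R ≤ r := (le_max_left _ _).trans hr
  have hr2 : C * N / η ≤ r := (le_max_right _ _).trans hr
  have hr0 : 0 < r := by linarith
  have e : denom k α D h (r • (β : E3)) - planeWave k α (r • (β : E3)) -
      (-(1 / (4 * (Real.pi : ℂ))) * farField k D h β) *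
        (Complex.exp (Complex.I * ((k * r : ℝ) : ℂ)) / (r : ℂ)) =
      -∫ y in D, (green k (r • (β : E3)) y - (1 / (4 * (Real.pi : ℂ))) *
      (Complex.exp (-(Complex.I * ((k * ⟪(β : E3), y⟫_ℝ : ℝ) : ℂ)))) *
      (Complex.exp (Complex.I * ((k * r : ℝ) : ℂ)) / (r : ℂ))) * h y := by
    have i1 := integrable_green_mul_of_memLp k hD hh (r • (β : E3))
    have i2 := (integrable_exp_mul (k := k) hh1 (β : E3)).const_mul ((1 / (4 * (Real.pi : ℂ))) *
      (Complex.exp (Complex.I * ((k * r : ℝ) : ℂ)) / (r : ℂ)))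
    have : ∀ y, (green k (r • (β : E3)) y - (1 / (4 * (Real.pi : ℂ))) *
      (Complex.exp (-(Complex.I * ((k * ⟪(β : E3), y⟫_ℝ : ℝ) : ℂ)))) *
      (Complex.exp (Complex.I * ((k * r : ℝ) : ℂ)) / (r : ℂ))) * h y =
      green k (r • (β : E3)) y * h y - (1 / (4 * (Real.pi : ℂ))) *
      (Complex.exp (Complex.I * ((k * r : ℝ) : ℂ)) / (r : ℂ)) *
      (Complex.exp (-(Complex.I * ((k * ⟪(β : E3), y⟫_ℝ : ℝ) : ℂ))) * h y) := fun y => by ring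
    simp_rw [this]
    rw [integral_sub i1 i2, integral_const_mul, denom_eq]
    unfold potential farField
    ring
  rw [e, norm_neg]
  calc _ ≤ ∫ y in D, C / r ^ 2 * ‖h y‖ := by
        refine norm_integral_le_of_norm_le (hh1.norm.const_mul _) ?_
        rw [ae_restrict_iff' hDm]
        refine Eventually.of_forall fun y hy => ?_
        rw [norm_mul]
        gcongr
        exact norm_green_sub_farField_le hk β hR hr1 (hDR y hy)
    _ = C / r ^ 2 * N := integral_const_mul _ _
    _ ≤ η / r := by
        rw [div_le_iff₀ hη] at hr2
        rw [div_mul_eq_mul_div, div_le_div_iff₀ (by positivity) hr0]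
        nlinarith

lemma isScatteringSolution_denom (hk : 0 ≤ k) (α : S2) (hDm : MeasurableSet D)
    (hDb : Bornology.IsBounded D) {h q : E3 → ℂ} (hh : MemLp h 2 (volume.restrict D))
    (hq : ∀ᵐ x ∂volume.restrict D, q x * denom k α D h x = h x) :
    IsScatteringSolution k α (D.indicator q) (denom k α D h)
      (fun β => -(1 / (4 * (Real.pi : ℂ))) * farField k D h β) :=
  ⟨continuous_denom hk α hDb.measure_lt_top.ne hh,
    solvesSchrodinger_denom hk α hDm hDb.measure_lt_top.ne hh hq,
    hasFarField_denom hk α hDm hDb hh⟩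

lemma IsQuotientPotential.mul_denom {α : S2} {h q : E3 → ℂ}
    (hq : IsQuotientPotential k α D h q) :
    ∀ᵐ x ∂volume.restrict D, q x * denom k α D h x = h x := by
  filter_upwards [hq.1, hq.2] with x h1 h2
  rw [h2]
  by_cases h0 : h x = 0
  · simp [h0]
  · exact div_mul_cancel₀ _ (h1 h0)

lemma continuous_farField {h : E3 → ℂ} (hh : IntegrableOn h D) : Continuous (farField k D h) := by
  unfold farField
  refine continuous_of_dominated (bound := fun y => ‖h y‖) ?_ ?_ hh.norm ?_
  · exact fun β => (integrable_exp_mul hh (β : E3)).1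
  · exact fun β => Eventually.of_forall fun y => by rw [norm_mul, norm_exp_neg_I_inner, one_mul]
  · exact Eventually.of_forall fun y => by fun_prop

lemma norm_farField_le {h : E3 → ℂ} (β : S2) : ‖farField k D h β‖ ≤ ∫ y in D, ‖h y‖ := by
  refine (norm_integral_le_integral_norm _).trans (le_of_eq ?_)
  congr 1; ext y; rw [norm_mul, norm_exp_neg_I_inner, one_mul]

end ExplicitSolution

/-! ### A smooth radial cutoff and bounds for its derivatives. -/

section Cutoff

/-- A smooth cutoff: `1` for `t ≤ 1` and `0` for `t ≥ 2`. -/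
noncomputable def cut (t : ℝ) : ℝ := Real.smoothTransition (2 - t)

lemma contDiff_cut : ContDiff ℝ ∞ cut :=
  Real.smoothTransition.contDiff.comp (contDiff_const.sub contDiff_id)

lemma cut_of_le {t : ℝ} (ht : t ≤ 1) : cut t = 1 :=
  Real.smoothTransition.one_of_one_le (by linarith)

lemma cut_of_ge {t : ℝ} (ht : 2 ≤ t) : cut t = 0 :=
  Real.smoothTransition.zero_of_nonpos (by linarith)

lemma abs_cut_le (t : ℝ) : |cut t| ≤ 1 := by
  unfold cut
  rw [abs_of_nonneg (Real.smoothTransition.nonneg _)]; exact Real.smoothTransition.le_one _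

lemma cut_eventually_const {t : ℝ} (ht : t ∉ Icc (1 : ℝ) 2) :
    ∃ a : ℝ, cut =ᶠ[𝓝 t] fun _ => a := by
  rw [mem_Icc, not_and_or, not_le, not_le] at ht
  rcases ht with h | h
  · exact ⟨1, by filter_upwards [Iio_mem_nhds h] with s hs using cut_of_le (le_of_lt hs)⟩
  · exact ⟨0, by filter_upwards [Ioi_mem_nhds h] with s hs using cut_of_ge (le_of_lt hs)⟩

lemma deriv_cut_eq_zero {t : ℝ} (ht : t ∉ Icc (1 : ℝ) 2) : deriv cut t = 0 := by
  obtain ⟨a, ha⟩ := cut_eventually_const ht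
  rw [ha.deriv_eq, deriv_const]

lemma deriv_deriv_cut_eq_zero {t : ℝ} (ht : t ∉ Icc (1 : ℝ) 2) : deriv (deriv cut) t = 0 := by
  obtain ⟨a, ha⟩ := cut_eventually_const ht
  rw [ha.deriv.deriv_eq]; simp

lemma contDiff_deriv_cut : ContDiff ℝ ∞ (deriv cut) := by
  have h : ContDiff ℝ (((⊤ : ℕ∞) : WithTop ℕ∞) + 1) cut := contDiff_cut
  exact (contDiff_succ_iff_deriv.1 h).2.2

lemma contDiff_deriv_deriv_cut : ContDiff ℝ ∞ (deriv (deriv cut)) := by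
  have h : ContDiff ℝ (((⊤ : ℕ∞) : WithTop ℕ∞) + 1) (deriv cut) := contDiff_deriv_cut
  exact (contDiff_succ_iff_deriv.1 h).2.2

lemma hasDerivAt_cut (t : ℝ) : HasDerivAt cut (deriv cut t) t :=
  (contDiff_cut.differentiable (by simp) t).hasDerivAt

lemma hasDerivAt_deriv_cut (t : ℝ) : HasDerivAt (deriv cut) (deriv (deriv cut) t) t :=
  (contDiff_deriv_cut.differentiable (by simp) t).hasDerivAt

lemma exists_bound_cut : ∃ M : ℝ, 0 ≤ M ∧ ∀ t, |deriv cut t| ≤ M ∧ |deriv (deriv cut) t| ≤ M := by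
  have h1 : HasCompactSupport (deriv cut) :=
    HasCompactSupport.intro isCompact_Icc fun t ht => deriv_cut_eq_zero ht
  have h2 : HasCompactSupport (deriv (deriv cut)) :=
    HasCompactSupport.intro isCompact_Icc fun t ht => deriv_deriv_cut_eq_zero ht
  obtain ⟨M1, hM1⟩ := h1.exists_bound_of_continuous contDiff_deriv_cut.continuous
  obtain ⟨M2, hM2⟩ := h2.exists_bound_of_continuous contDiff_deriv_deriv_cut.continuous
  exact ⟨max M1 M2, ((norm_nonneg _).trans (hM1 0)).trans (le_max_left _ _),
    fun t => ⟨(hM1 t).trans (le_max_left _ _), (hM2 t).trans (le_max_right _ _)⟩⟩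

end Cutoff

/-! ### Polar coordinates and radial oscillation. -/

section Polar

/-- Homogeneous extension (of degree zero) of a function on the sphere. -/
noncomputable def sphereExt (c : S2 → ℂ) (z : E3) : ℂ :=
  if h : z = 0 then 0 else c ⟨‖z‖⁻¹ • z, by simp [norm_smul, h]⟩

/-- No measurability or integrability of `c` or `f` is required: changes of variables and
`integral_prod_mul` hold unconditionally, thanks to the value `0` of a divergent integral. -/
lemma integral_sphereExt_mul (c : S2 → ℂ) (f : ℝ → ℂ) :
    ∫ z : E3, sphereExt c z * f ‖z‖ = (∫ β, c β ∂surf) * ∫ r in Ioi (0 : ℝ), (r ^ 2 : ℝ) • f r := by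
  have h0 : MeasurableSet ({0}ᶜ : Set E3) := (measurableSet_singleton _).compl
  calc ∫ z : E3, sphereExt c z * f ‖z‖
      = ∫ z : ({(0)}ᶜ : Set E3), sphereExt c z.1 * f ‖z.1‖
          ∂((volume : Measure E3).comap Subtype.val) := by
        rw [integral_subtype_comap h0 fun z => sphereExt c z * f ‖z‖, restrict_compl_singleton]
    _ = ∫ x : S2 × Ioi (0 : ℝ), c x.1 * f (x.2 : ℝ)
          ∂(surf.prod (Measure.volumeIoiPow (Module.finrank ℝ E3 - 1))) := by
        have := (volume : Measure E3).measurePreserving_homeomorphUnitSphereProd.integral_comp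
          (Homeomorph.measurableEmbedding _)
          (fun x : S2 × Ioi (0 : ℝ) => c x.1 * f (x.2 : ℝ))
        rw [← this]
        refine integral_congr_ae (Eventually.of_forall fun z => ?_)
        have hz : (z : E3) ≠ 0 := z.2
        simp only [homeomorphUnitSphereProd_apply_snd_coe]
        congr 1
        simp only [sphereExt, hz, dite_false]
        congr 1
        exact Subtype.ext (homeomorphUnitSphereProd_apply_fst_coe E3 z).symm
    _ = (∫ β, c β ∂surf) * ∫ x : Ioi (0 : ℝ), f (x : ℝ)
          ∂(Measure.volumeIoiPow (Module.finrank ℝ E3 - 1)) :=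
        integral_prod_mul c (fun x : Ioi (0 : ℝ) => f (x : ℝ))
    _ = _ := by
        congr 1
        simp only [Measure.volumeIoiPow, ENNReal.ofReal]
        rw [integral_withDensity_eq_integral_smul
            ((measurable_subtype_coe.pow_const _).real_toNNReal),
          integral_subtype_comap measurableSet_Ioi
            fun a => Real.toNNReal (a ^ (Module.finrank ℝ E3 - 1)) • f a]
        refine setIntegral_congr_fun measurableSet_Ioi fun x hx => ?_
        simp only [finrank_E3]
        rw [NNReal.smul_def, Real.coe_toNNReal _ (pow_nonneg (le_of_lt hx) _)]

/-- A Riemann–Lebesgue lemma for spherical oscillations. -/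
lemma tendsto_integral_sphereExt_mul_exp {k : ℝ} (hk : 0 < k) (c : S2 → ℂ) (f : ℝ → ℂ) :
    Tendsto (fun R : ℝ => ∫ z : E3, sphereExt c z * f ‖z‖ *
      Complex.exp (Complex.I * ((k * R * ‖z‖ : ℝ) : ℂ)) ^ 2) atTop (𝓝 0) := by
  -- The squared phase `exp(2ikRr)` is the Fourier character at frequency `-kR/π`, which leaves
  -- every compact set.
  have h1 : Tendsto (fun R : ℝ => -(k * R / Real.pi)) atTop (cocompact ℝ) := by
    refine Tendsto.mono_right ?_ atBot_le_cocompact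
    refine tendsto_neg_atTop_atBot.comp ?_
    exact (tendsto_id.const_mul_atTop hk).atTop_div_const Real.pi_pos
  have h2 := (Real.tendsto_integral_exp_smul_cocompact
    ((Ioi (0 : ℝ)).indicator fun r : ℝ => (r ^ 2 : ℝ) • f r)).comp h1
  have h3 := h2.const_mul (∫ β, c β ∂surf)
  rw [mul_zero] at h3
  refine h3.congr fun R => ?_
  have := integral_sphereExt_mul c
    (fun r => f r * Complex.exp (Complex.I * ((k * R * r : ℝ) : ℂ)) ^ 2)
  simp only [← mul_assoc] at this
  simp only [Function.comp_apply]
  rw [this, ← integral_indicator measurableSet_Ioi]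
  congr 2; ext r
  by_cases hr : r ∈ Ioi (0 : ℝ)
  · simp only [indicator, hr, if_true]
    rw [Circle.smul_def, Real.fourierChar_apply, smul_eq_mul, ← Complex.exp_nat_mul,
      Complex.real_smul, Complex.real_smul]
    have e : ((2 * Real.pi * -(r * -(k * R / Real.pi)) : ℝ) : ℂ) * Complex.I =
        ((2 : ℕ) : ℂ) * (Complex.I * ((k * R * r : ℝ) : ℂ)) := by
      have hp : (Real.pi : ℂ) ≠ 0 := by exact_mod_cast Real.pi_ne_zero
      push_cast
      field_simp
    rw [e]; ring
  · simp [indicator, hr]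

end Polar

/-! ### The error produced by the cutoff vanishes at infinity. -/

section CutoffError

variable {k ε : ℝ}

/-- The terms of `(∇² + k²)(cut(|y|²/R²) regWave(|y|²))` that contain derivatives of the cutoff. -/
noncomputable def cutError (k ε R t : ℝ) : ℂ :=
  8 * t * (deriv cut (t / R ^ 2) / R ^ 2 : ℝ) * regWave' k ε t +
    (4 * t * (deriv (deriv cut) (t / R ^ 2) / R ^ 4 : ℝ) + 6 * (deriv cut (t / R ^ 2) / R ^ 2 : ℝ))
      * regWave k ε t

/-- By size alone the integral is only `O(1)`: the shell `|z| ~ R` has volume of order `R³`, while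
`u` contributes `R⁻¹` and the error term `R⁻²`. But `u` and the regularized wave are both outgoing,
so their phases add up to `exp(2ik|z|)`, and after rescaling to a fixed shell the Riemann–Lebesgue
lemma gives the limit `0`. This takes the place of a radiation condition on derivatives. -/
lemma tendsto_integral_cutError (hk : 0 < k) (hε : 0 < ε) {u : E3 → ℂ} (hu : Continuous u) {C : ℝ}
    (hC : ∀ z, ‖u z‖ * (1 + ‖z‖) ≤ C) {c : S2 → ℂ}
    (hc : ∀ β : S2, Tendsto (fun r : ℝ => (r : ℂ) *
      (Complex.exp (Complex.I * ((k * r : ℝ) : ℂ)))⁻¹ * u (r • (β : E3))) atTop (𝓝 (c β))) :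
    Tendsto (fun R : ℝ => ∫ z, u z * cutError k ε R (‖z‖ ^ 2)) atTop (𝓝 0) := by
  obtain ⟨M, hM0, hM⟩ := exists_bound_cut
  have hC0 : 0 ≤ C := le_trans (by positivity) (hC 0)
  set ρ : ℝ → E3 → ℝ := fun R z => √((R * ‖z‖) ^ 2 + ε ^ 2) with hρ
  have hρ0 : ∀ R z, 0 < ρ R z := fun R z => by simp only [hρ]; positivity
  have hρge : ∀ R z, 0 < R → R * ‖z‖ ≤ ρ R z := fun R z hR =>
    Real.le_sqrt_of_sq_le (by nlinarith [sq_nonneg ε])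
  set e1 : ℝ → E3 → ℂ := fun R z => Complex.exp (Complex.I * ((k * R * ‖z‖ : ℝ) : ℂ)) with he1
  have he1n : ∀ R z, ‖e1 R z‖ = 1 := fun R z => by
    simp only [he1]; rw [mul_comm, Complex.norm_exp_ofReal_mul_I]
  have he1ne : ∀ R z, e1 R z ≠ 0 := fun R z => Complex.exp_ne_zero _
  set eδ : ℝ → E3 → ℂ := fun R z =>
    Complex.exp (Complex.I * ((k * (ρ R z - R * ‖z‖) : ℝ) : ℂ)) with heδ
  have heδn : ∀ R z, ‖eδ R z‖ = 1 := fun R z => by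
    simp only [heδ]; rw [mul_comm, Complex.norm_exp_ofReal_mul_I]
  -- `a` and `K` are the rescaled amplitudes of `u` and of the error term once a factor `e1` has
  -- been taken out of each; both converge pointwise off the origin.
  set a : ℝ → E3 → ℂ := fun R z => (R : ℂ) * (e1 R z)⁻¹ * u (R • z) with ha
  set K : ℝ → E3 → ℂ := fun R z => eδ R z *
    (8 * (‖z‖ ^ 2 : ℝ) * (deriv cut (‖z‖ ^ 2) : ℝ) *
      ((Complex.I * k * ((R / ρ R z : ℝ) : ℂ) ^ 2
        - ((R / ρ R z : ℝ) : ℂ) ^ 2 * (((ρ R z)⁻¹ : ℝ) : ℂ)) / 2) +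
    (4 * (‖z‖ ^ 2 : ℝ) * (deriv (deriv cut) (‖z‖ ^ 2) : ℝ) + 6 * (deriv cut (‖z‖ ^ 2) : ℝ)) *
      (((ρ R z)⁻¹ : ℝ) : ℂ)) with hK
  set f : ℝ → ℂ := fun s => 4 * Complex.I * k * (deriv cut (s ^ 2) : ℝ) * ((s⁻¹ : ℝ) : ℂ) with hf
  -- rescaling
  have hsub : ∀ R : ℝ, 0 < R → ∫ z, u z * cutError k ε R (‖z‖ ^ 2) =
      ∫ z, a R z * K R z * e1 R z ^ 2 := by
    intro R hR
    have e2 := Measure.integral_comp_smul (volume : Measure E3)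
      (fun y => u y * cutError k ε R (‖y‖ ^ 2)) R
    rw [finrank_E3, abs_of_pos (by positivity)] at e2
    have e3 : ∫ y, u y * cutError k ε R (‖y‖ ^ 2) =
        (R ^ 3) • ∫ z, u (R • z) * cutError k ε R (‖R • z‖ ^ 2) := by
      rw [e2, smul_smul, mul_inv_cancel₀ (by positivity), one_smul]
    rw [e3, ← integral_smul]
    congr 1; ext z
    have e4 : ‖R • z‖ ^ 2 / R ^ 2 = ‖z‖ ^ 2 := by
      rw [norm_smul, Real.norm_of_nonneg hR.le]; field_simp
    have e5 : √(‖R • z‖ ^ 2 + ε ^ 2) = ρ R z := by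
      simp only [hρ]; rw [norm_smul, Real.norm_of_nonneg hR.le]
    have e6 : Complex.exp (Complex.I * ((k * ρ R z : ℝ) : ℂ)) = eδ R z * e1 R z := by
      simp only [heδ, he1]; rw [← Complex.exp_add]; congr 1; push_cast; ring
    have e7 : ‖R • z‖ ^ 2 = R ^ 2 * ‖z‖ ^ 2 := by
      rw [norm_smul, Real.norm_of_nonneg hR.le]; ring
    simp only [cutError, regWave, regWave', e4, e5, e6]
    rw [e7]
    have hR' : (R : ℂ) ≠ 0 := by exact_mod_cast hR.ne'
    have hρ' : ((ρ R z : ℝ) : ℂ) ≠ 0 := by exact_mod_cast (hρ0 R z).ne'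
    have h1 := he1ne R z
    simp only [ha, hK, Complex.real_smul]
    push_cast
    field_simp
  -- pointwise limits
  have hz : ∀ z : E3, z ≠ 0 → Tendsto (fun R => a R z) atTop
      (𝓝 (sphereExt c z * ((‖z‖⁻¹ : ℝ) : ℂ))) := by
    intro z hz
    have hz0 : 0 < ‖z‖ := norm_pos_iff.2 hz
    have := ((hc ⟨‖z‖⁻¹ • z, by simp [norm_smul, hz]⟩).comp
      (tendsto_id.atTop_mul_const hz0)).mul_const ((‖z‖⁻¹ : ℝ) : ℂ)
    simp only [sphereExt, hz, dite_false]
    refine this.congr fun R => ?_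
    have hz' : ((‖z‖ : ℝ) : ℂ) ≠ 0 := by exact_mod_cast hz0.ne'
    simp only [ha, he1, Function.comp_apply, id]
    rw [smul_smul, mul_assoc R, mul_inv_cancel₀ hz0.ne', mul_one, mul_assoc k]
    push_cast
    field_simp
  have hρinf : ∀ z : E3, z ≠ 0 → Tendsto (fun R => ρ R z) atTop atTop := by
    intro z hz
    refine tendsto_atTop_mono' _ ?_ (tendsto_id.atTop_mul_const (norm_pos_iff.2 hz))
    filter_upwards [eventually_gt_atTop 0] with R hR using hρge R z hR
  have hRinf : ∀ z : E3, z ≠ 0 → Tendsto (fun R : ℝ => R * ‖z‖) atTop atTop := fun z hz =>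
    tendsto_id.atTop_mul_const (norm_pos_iff.2 hz)
  have hδ : ∀ z : E3, z ≠ 0 → Tendsto (fun R => ρ R z - R * ‖z‖) atTop (𝓝 0) := by
    intro z hz
    have h1 : Tendsto (fun R : ℝ => ε ^ 2 / (R * ‖z‖)) atTop (𝓝 0) :=
      (hRinf z hz).const_div_atTop _
    refine squeeze_zero' ?_ ?_ h1
    · filter_upwards [eventually_gt_atTop 0] with R hR
      linarith [hρge R z hR]
    · filter_upwards [eventually_gt_atTop 0] with R hR
      have hp : 0 < R * ‖z‖ := mul_pos hR (norm_pos_iff.2 hz)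
      rw [le_div_iff₀ hp]
      have h2 : ρ R z ^ 2 = (R * ‖z‖) ^ 2 + ε ^ 2 := Real.sq_sqrt (by positivity)
      nlinarith [hρge R z hR]
  have hρinv : ∀ z : E3, z ≠ 0 → Tendsto (fun R => (ρ R z)⁻¹) atTop (𝓝 0) := fun z hz =>
    tendsto_inv_atTop_zero.comp (hρinf z hz)
  have hRρ : ∀ z : E3, z ≠ 0 → Tendsto (fun R => R / ρ R z) atTop (𝓝 ‖z‖⁻¹) := by
    intro z hz
    have hz0 : 0 < ‖z‖ := norm_pos_iff.2 hz
    have h1 : Tendsto (fun R => (1 - (ρ R z - R * ‖z‖) * (ρ R z)⁻¹) * ‖z‖⁻¹) atTop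
        (𝓝 ((1 - 0 * 0) * ‖z‖⁻¹)) :=
      (tendsto_const_nhds.sub ((hδ z hz).mul (hρinv z hz))).mul_const _
    rw [mul_zero, sub_zero, one_mul] at h1
    refine h1.congr fun R => ?_
    have := (hρ0 R z).ne'
    field_simp
    ring
  have hKlim : ∀ z : E3, z ≠ 0 → Tendsto (fun R => K R z) atTop
      (𝓝 (4 * Complex.I * k * (deriv cut (‖z‖ ^ 2) : ℝ))) := by
    intro z hz
    have hz0 : 0 < ‖z‖ := norm_pos_iff.2 hz
    have t1 : Tendsto (fun R => eδ R z) atTop (𝓝 1) := by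
      have hcont : Continuous fun s : ℝ => Complex.exp (Complex.I * ((k * s : ℝ) : ℂ)) := by fun_prop
      have := (hcont.tendsto 0).comp (hδ z hz)
      simpa [heδ, Function.comp_def] using this
    have t2 : Tendsto (fun R => ((R / ρ R z : ℝ) : ℂ)) atTop (𝓝 ((‖z‖⁻¹ : ℝ) : ℂ)) :=
      (Complex.continuous_ofReal.tendsto _).comp (hRρ z hz)
    have t3 : Tendsto (fun R => (((ρ R z)⁻¹ : ℝ) : ℂ)) atTop (𝓝 ((0 : ℝ) : ℂ)) :=
      (Complex.continuous_ofReal.tendsto _).comp (hρinv z hz)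
    have := t1.mul ((((((t2.pow 2).const_mul (Complex.I * k)).sub ((t2.pow 2).mul t3)).div_const
      2).const_mul (8 * ((‖z‖ ^ 2 : ℝ) : ℂ) * (deriv cut (‖z‖ ^ 2) : ℝ))).add
      (t3.const_mul (4 * ((‖z‖ ^ 2 : ℝ) : ℂ) * (deriv (deriv cut) (‖z‖ ^ 2) : ℝ) +
        6 * (deriv cut (‖z‖ ^ 2) : ℝ))))
    convert this using 2
    have hz' : ((‖z‖ : ℝ) : ℂ) ≠ 0 := by exact_mod_cast hz0.ne'
    push_cast
    field_simp
    ring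
  -- uniform bounds on the support of the derivatives of the cutoff
  set S : Set E3 := {z | ‖z‖ ^ 2 ∈ Icc (1 : ℝ) 2} with hS
  have hSm : MeasurableSet S := by
    have : Measurable fun z : E3 => ‖z‖ ^ 2 := by fun_prop
    exact this measurableSet_Icc
  have hSfin : volume S ≠ ⊤ := by
    have : S ⊆ closedBall 0 2 := fun z hz => by
      have := hz.2
      rw [mem_closedBall_zero_iff]
      nlinarith [norm_nonneg z]
    exact ((measure_mono this).trans_lt measure_closedBall_lt_top).ne
  have hK0 : ∀ R z, z ∉ S → K R z = 0 := by
    intro R z hz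
    have h1 := deriv_cut_eq_zero (t := ‖z‖ ^ 2) hz
    have h2 := deriv_deriv_cut_eq_zero (t := ‖z‖ ^ 2) hz
    simp [hK, h1, h2]
  set L : ℝ := 8 * 2 * M * (k + 1) + (4 * 2 * M + 6 * M) with hL
  have hS1 : ∀ z ∈ S, 1 ≤ ‖z‖ := fun z hz => by
    have := hz.1; nlinarith [norm_nonneg z]
  have hab : ∀ R z, 1 ≤ R → ‖a R z * K R z‖ ≤ S.indicator (fun _ => C * L) z := by
    intro R z hR
    by_cases hzS : z ∈ S
    swap
    · simp [hK0 R z hzS, hzS]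
    simp only [indicator, hzS, if_true]
    have hz1 := hS1 z hzS
    have hz2 : ‖z‖ ^ 2 ≤ 2 := hzS.2
    have hR0 : 0 < R := by linarith
    have hna : ‖a R z‖ ≤ C := by
      simp only [ha]
      rw [norm_mul, norm_mul, norm_inv, he1n, inv_one, mul_one, Complex.norm_real,
        Real.norm_of_nonneg hR0.le]
      refine le_trans ?_ (hC (R • z))
      rw [mul_comm, norm_smul, Real.norm_of_nonneg hR0.le]
      gcongr
      nlinarith
    have hρR : R ≤ ρ R z := le_trans (by nlinarith) (hρge R z hR0)
    have hb1 : R / ρ R z ≤ 1 := (div_le_one (hρ0 R z)).2 hρR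
    have hb1' : 0 ≤ R / ρ R z := div_nonneg hR0.le (hρ0 R z).le
    have hb2 : (ρ R z)⁻¹ ≤ 1 := inv_le_one_of_one_le₀ (hR.trans hρR)
    have hb2' : 0 ≤ (ρ R z)⁻¹ := inv_nonneg.2 (hρ0 R z).le
    have hm1 := (hM (‖z‖ ^ 2)).1
    have hm2 := (hM (‖z‖ ^ 2)).2
    have hnK : ‖K R z‖ ≤ L := by
      simp only [hK]
      rw [norm_mul, heδn, one_mul]
      refine (norm_add_le _ _).trans (add_le_add ?_ ?_)
      · rw [norm_mul, norm_mul, norm_mul, Complex.norm_real, Complex.norm_real,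
          Real.norm_of_nonneg (by positivity), Real.norm_eq_abs, norm_div]
        have h3 : ‖Complex.I * k * ((R / ρ R z : ℝ) : ℂ) ^ 2
          - ((R / ρ R z : ℝ) : ℂ) ^ 2 * (((ρ R z)⁻¹ : ℝ) : ℂ)‖ / ‖(2 : ℂ)‖ ≤ k + 1 := by
          have : ‖Complex.I * k * ((R / ρ R z : ℝ) : ℂ) ^ 2
            - ((R / ρ R z : ℝ) : ℂ) ^ 2 * (((ρ R z)⁻¹ : ℝ) : ℂ)‖ ≤ k * 1 ^ 2 + 1 ^ 2 * 1 := by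
            refine (norm_sub_le _ _).trans ?_
            rw [norm_mul, norm_mul, norm_mul, norm_pow, Complex.norm_I, one_mul,
              Complex.norm_real, Complex.norm_real, Complex.norm_real,
              Real.norm_of_nonneg hk.le, Real.norm_of_nonneg hb1', Real.norm_of_nonneg hb2']
            gcongr
          rw [Complex.norm_two]
          linarith
        have h8 : ‖(8 : ℂ)‖ = 8 := by simp
        rw [h8]
        gcongr
      · rw [norm_mul, Complex.norm_real, Real.norm_of_nonneg hb2']
        refine (mul_le_of_le_one_right (norm_nonneg _) hb2).trans ?_
        refine (norm_add_le _ _).trans ?_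
        rw [norm_mul, norm_mul, norm_mul, Complex.norm_real, Complex.norm_real, Complex.norm_real,
          Real.norm_of_nonneg (by positivity : 0 ≤ ‖z‖ ^ 2), Real.norm_eq_abs, Real.norm_eq_abs]
        have h4 : ‖(4 : ℂ)‖ = 4 := by simp
        have h6 : ‖(6 : ℂ)‖ = 6 := by simp
        rw [h4, h6]
        gcongr
    rw [norm_mul]
    gcongr
  have hP : ∀ᵐ z : E3, Tendsto (fun R => a R z * K R z) atTop
      (𝓝 (sphereExt c z * f ‖z‖)) := by
    have : ∀ᵐ z : E3, z ≠ 0 := by simp [ae_iff]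
    filter_upwards [this] with z hz0
    have := (hz z hz0).mul (hKlim z hz0)
    convert this using 2
    simp only [hf]; ring
  have hPb : ∀ᵐ z : E3, ‖sphereExt c z * f ‖z‖‖ ≤ S.indicator (fun _ => C * L) z := by
    filter_upwards [hP] with z hz
    refine le_of_tendsto hz.norm ?_
    filter_upwards [eventually_ge_atTop 1] with R hR using hab R z hR
  have hac : ∀ R, 1 ≤ R → Continuous fun z => a R z * K R z := by
    intro R hR
    have c1 : Continuous fun z => ρ R z := by simp only [hρ]; fun_prop
    have c2 : Continuous fun z => R / ρ R z := continuous_const.div c1 fun z => (hρ0 R z).ne'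
    have c3 : Continuous fun z => (ρ R z)⁻¹ := c1.inv₀ fun z => (hρ0 R z).ne'
    have c4 : Continuous fun z => (e1 R z)⁻¹ :=
      Continuous.inv₀ (by simp only [he1]; fun_prop) (he1ne R)
    have c5 : Continuous fun z : E3 => deriv cut (‖z‖ ^ 2) :=
      contDiff_deriv_cut.continuous.comp (by fun_prop)
    have c6 : Continuous fun z : E3 => deriv (deriv cut) (‖z‖ ^ 2) :=
      contDiff_deriv_deriv_cut.continuous.comp (by fun_prop)
    simp only [ha, hK, heδ]
    fun_prop
  -- Nothing is assumed about `c` itself; measurability is inherited from the continuous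
  -- approximations.
  have hPm : AEStronglyMeasurable (fun z : E3 => sphereExt c z * f ‖z‖) volume := by
    refine aestronglyMeasurable_of_tendsto_ae (u := atTop) (f := fun n : ℕ => fun z =>
      a (n + 1) z * K (n + 1) z) (fun n => ?_) ?_
    · exact (hac _ (by have : (0 : ℝ) ≤ n := n.cast_nonneg
                       linarith)).aestronglyMeasurable
    · filter_upwards [hP] with z hz
      exact hz.comp (tendsto_atTop_add_const_right _ _ tendsto_natCast_atTop_atTop)
  have he1c : ∀ R, Continuous fun z => e1 R z ^ 2 := fun R => by simp only [he1]; fun_prop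
  have hbi : Integrable (S.indicator fun _ => C * L) := by
    rw [integrable_indicator_iff hSm]
    exact integrableOn_const hSfin
  -- The oscillating factor has modulus one, so dominated convergence may replace the amplitudes by
  -- their limits before the oscillation is used.
  have hdiff : Tendsto (fun R => ∫ z, (a R z * K R z - sphereExt c z * f ‖z‖) * e1 R z ^ 2) atTop
      (𝓝 (∫ _z : E3, (0 : ℂ))) := by
    refine tendsto_integral_filter_of_dominated_convergence
      (fun z => S.indicator (fun _ => C * L) z + S.indicator (fun _ => C * L) z) ?_ ?_
      (hbi.add hbi) ?_
    · filter_upwards [eventually_ge_atTop 1] with R hR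
      exact ((hac R hR).aestronglyMeasurable.sub hPm).mul (he1c R).aestronglyMeasurable
    · filter_upwards [eventually_ge_atTop 1] with R hR
      filter_upwards [hPb] with z hz
      rw [norm_mul, norm_pow, he1n, one_pow, mul_one]
      exact (norm_sub_le _ _).trans (add_le_add (hab R z hR) hz)
    · filter_upwards [hP] with z hz
      rw [tendsto_zero_iff_norm_tendsto_zero]
      have h0 : Tendsto (fun R => a R z * K R z - sphereExt c z * f ‖z‖) atTop (𝓝 0) := by
        simpa using hz.sub_const (sphereExt c z * f ‖z‖)
      refine h0.norm.congr' (Eventually.of_forall fun R => ?_) |>.trans (by simp)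
      rw [norm_mul, norm_pow, he1n, one_pow, mul_one]
  rw [integral_zero] at hdiff
  have hRL := tendsto_integral_sphereExt_mul_exp hk c f
  have hsum := hdiff.add hRL
  rw [add_zero] at hsum
  refine hsum.congr' ?_
  filter_upwards [eventually_ge_atTop 1] with R hR
  rw [hsub R (by linarith), ← integral_add]
  · congr 1; ext z; simp only [he1]; ring
  · refine (hbi.add hbi).mono' (((hac R hR).aestronglyMeasurable.sub hPm).mul
      (he1c R).aestronglyMeasurable) ?_
    filter_upwards [hPb] with z hz
    rw [norm_mul, norm_pow, he1n, one_pow, mul_one]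
    exact (norm_sub_le _ _).trans (add_le_add (hab R z hR) hz)
  · refine hbi.mono' (hPm.mul (he1c R).aestronglyMeasurable) ?_
    filter_upwards [hPb] with z hz
    have := he1n R z
    simp only [he1] at this
    rw [norm_mul, norm_pow, this, one_pow, mul_one]
    exact hz

end CutoffError

/-! ### Outgoing functions: decay and change of origin. -/

section Representation

variable {k : ℝ}

/-- `w = B(β) exp(ikr)/r + o(1/r)` uniformly in `β`. -/
def IsOutgoing (k : ℝ) (w : E3 → ℂ) (B : S2 → ℂ) : Prop :=
  ∀ η : ℝ, 0 < η → ∃ R : ℝ, 0 < R ∧ ∀ r : ℝ, R ≤ r → ∀ β : S2,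
    ‖w (r • (β : E3)) - B β * (Complex.exp (Complex.I * ((k * r : ℝ) : ℂ)) / (r : ℂ))‖ ≤ η / r

lemma HasFarField.sub {α : S2} {u u' : E3 → ℂ} {A A' : S2 → ℂ} (h : HasFarField k α u A)
    (h' : HasFarField k α u' A') :
    IsOutgoing k (fun x => u x - u' x) (fun β => A β - A' β) := by
  intro η hη
  obtain ⟨R, hR, H⟩ := h (η / 2) (by positivity)
  obtain ⟨R', hR', H'⟩ := h' (η / 2) (by positivity)
  refine ⟨max R R', by positivity, fun r hr β => ?_⟩
  have h1 := H r ((le_max_left _ _).trans hr) β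
  have h2 := H' r ((le_max_right _ _).trans hr) β
  calc _ = ‖(u (r • (β : E3)) - planeWave k α (r • (β : E3))
      - A β * (Complex.exp (Complex.I * ((k * r : ℝ) : ℂ)) / (r : ℂ))) -
      (u' (r • (β : E3)) - planeWave k α (r • (β : E3))
      - A' β * (Complex.exp (Complex.I * ((k * r : ℝ) : ℂ)) / (r : ℂ)))‖ := by congr 1; ring
    _ ≤ η / 2 / r + η / 2 / r := (norm_sub_le _ _).trans (add_le_add h1 h2)
    _ = η / r := by ring

namespace IsOutgoing

variable {w : E3 → ℂ} {B : S2 → ℂ}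

lemma norm_exp_div {r : ℝ} (hr : 0 < r) :
    ‖Complex.exp (Complex.I * ((k * r : ℝ) : ℂ)) / (r : ℂ)‖ = 1 / r := by
  rw [norm_div, mul_comm Complex.I, Complex.norm_exp_ofReal_mul_I, Complex.norm_real,
    Real.norm_of_nonneg hr.le]

lemma tendstoUniformly (h : IsOutgoing k w B) :
    TendstoUniformly (fun (r : ℝ) (β : S2) => (r : ℂ) *
      (Complex.exp (Complex.I * ((k * r : ℝ) : ℂ)))⁻¹ * w (r • (β : E3))) B atTop := by
  rw [Metric.tendstoUniformly_iff]
  intro η hη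
  obtain ⟨R, hR, H⟩ := h (η / 2) (by positivity)
  filter_upwards [eventually_ge_atTop R] with r hr β
  have hr0 : 0 < r := hR.trans_le hr
  have h1 := H r hr β
  have hr' : (r : ℂ) ≠ 0 := by exact_mod_cast hr0.ne'
  have e : B β - (r : ℂ) * (Complex.exp (Complex.I * ((k * r : ℝ) : ℂ)))⁻¹ * w (r • (β : E3)) =
      -((r : ℂ) * (Complex.exp (Complex.I * ((k * r : ℝ) : ℂ)))⁻¹ * (w (r • (β : E3)) -
        B β * (Complex.exp (Complex.I * ((k * r : ℝ) : ℂ)) / (r : ℂ)))) := by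
    have := Complex.exp_ne_zero (Complex.I * ((k * r : ℝ) : ℂ))
    field_simp
    ring
  rw [dist_eq_norm, e, norm_neg, norm_mul, norm_mul, norm_inv, mul_comm Complex.I,
    Complex.norm_exp_ofReal_mul_I, inv_one, mul_one, Complex.norm_real, Real.norm_of_nonneg hr0.le,
    mul_comm _ Complex.I]
  calc _ ≤ r * (η / 2 / r) := by gcongr
    _ = η / 2 := by field_simp
    _ < η := by linarith

lemma continuous_amplitude (h : IsOutgoing k w B) (hw : Continuous w) : Continuous B :=
  h.tendstoUniformly.continuous (Frequently.of_forall fun r => by fun_prop)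

lemma exists_bound (h : IsOutgoing k w B) (hw : Continuous w) :
    ∃ C, ∀ y, ‖w y‖ * (1 + ‖y‖) ≤ C := by
  obtain ⟨R, hR, H⟩ := h 1 one_pos
  obtain ⟨M, hM⟩ := (isCompact_closedBall (0 : E3) (max R 1)).exists_bound_of_continuousOn
    hw.continuousOn
  obtain ⟨M', hM'⟩ := (isCompact_univ (X := S2)).exists_bound_of_continuousOn
    (h.continuous_amplitude hw).continuousOn
  set ρ := max R 1
  have hM0 : 0 ≤ M := (norm_nonneg _).trans (hM 0 (by simp [ρ]))
  refine ⟨max (M * (1 + ρ)) (2 * (M' + 1)), fun y => ?_⟩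
  rcases le_or_gt ‖y‖ ρ with hy | hy
  · refine le_trans ?_ (le_max_left _ _)
    gcongr
    exact hM y (by simpa using hy)
  · refine le_trans ?_ (le_max_right _ _)
    have hy1 : 1 < ‖y‖ := (le_max_right _ _).trans_lt hy
    have hy0 : 0 < ‖y‖ := by linarith
    have hne : y ≠ 0 := norm_pos_iff.1 hy0
    have h1 := H ‖y‖ ((le_max_left _ _).trans hy.le) ⟨‖y‖⁻¹ • y, by simp [norm_smul, hne]⟩
    rw [smul_smul, mul_inv_cancel₀ hy0.ne', one_smul] at h1
    have h2 := norm_le_norm_add_norm_sub' (w y)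
      (B ⟨‖y‖⁻¹ • y, by simp [norm_smul, hne]⟩ *
        (Complex.exp (Complex.I * ((k * ‖y‖ : ℝ) : ℂ)) / (‖y‖ : ℂ)))
    rw [norm_mul, norm_exp_div hy0] at h2
    have h3 := hM' ⟨‖y‖⁻¹ • y, by simp [norm_smul, hne]⟩ (mem_univ _)
    have h4 : ‖w y‖ ≤ (M' + 1) / ‖y‖ := by
      calc ‖w y‖ ≤ _ := h2
        _ ≤ M' * (1 / ‖y‖) + 1 / ‖y‖ := by gcongr
        _ = _ := by ring
    rw [le_div_iff₀ hy0] at h4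
    nlinarith [norm_nonneg (w y)]

/-- Decay measured from an arbitrary centre, since the representation formula is proved with test
functions centred at the evaluation point. -/
lemma exists_bound_shift (h : IsOutgoing k w B) (hw : Continuous w) (x : E3) :
    ∃ C, ∀ y, ‖w (x + y)‖ * (1 + ‖y‖) ≤ C := by
  obtain ⟨C, hC⟩ := h.exists_bound hw
  refine ⟨C * (1 + ‖x‖), fun y => ?_⟩
  have h1 : 1 + ‖y‖ ≤ (1 + ‖x + y‖) * (1 + ‖x‖) := by
    have := norm_sub_le (x + y) x
    rw [add_sub_cancel_left] at this
    nlinarith [norm_nonneg x, norm_nonneg (x + y)]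
  calc ‖w (x + y)‖ * (1 + ‖y‖) ≤ ‖w (x + y)‖ * ((1 + ‖x + y‖) * (1 + ‖x‖)) := by gcongr
    _ = (‖w (x + y)‖ * (1 + ‖x + y‖)) * (1 + ‖x‖) := by ring
    _ ≤ _ := by gcongr; exact hC _

/-- As `r → ∞` one has `|x + rβ| = r + β·x + O(1/r)`, and the direction of `x + rβ` tends to `β`. So
moving the origin only multiplies the amplitude by a phase. The moving direction is handled by
uniformity in the direction and continuity of `B`. -/
lemma tendsto_shift (h : IsOutgoing k w B) (hw : Continuous w) (x : E3) (β : S2) :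
    Tendsto (fun r : ℝ => (r : ℂ) * (Complex.exp (Complex.I * ((k * r : ℝ) : ℂ)))⁻¹ *
      w (x + r • (β : E3))) atTop
      (𝓝 (B β * Complex.exp (Complex.I * ((k * ⟪(β : E3), x⟫_ℝ : ℝ) : ℂ)))) := by
  set R := max ‖x‖ 1 with hR
  have hR0 : 0 < R := by positivity
  have hexp : ∀ r : ℝ, 2 * R ≤ r → r / 2 ≤ ‖x + r • (β : E3)‖ ∧
      |‖x + r • (β : E3)‖ - (r + ⟪(β : E3), x⟫_ℝ)| ≤ R ^ 2 / r := by
    intro r hr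
    have := abs_norm_sub_le β hR0 hr (y := -x) (by rw [norm_neg]; exact le_max_left _ _)
    rwa [sub_neg_eq_add, inner_neg_right, sub_neg_eq_add, add_comm (r • (β : E3)) x] at this
  set ν : ℝ → ℝ := fun r => ‖x + r • (β : E3)‖ with hν
  have hdiff : Tendsto (fun r => ν r - r) atTop (𝓝 ⟪(β : E3), x⟫_ℝ) := by
    have h1 : Tendsto (fun r : ℝ => R ^ 2 / r) atTop (𝓝 0) := tendsto_id.const_div_atTop _
    have h2 : Tendsto (fun r => ν r - (r + ⟪(β : E3), x⟫_ℝ)) atTop (𝓝 0) := by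
      refine squeeze_zero_norm' ?_ h1
      filter_upwards [eventually_ge_atTop (2 * R)] with r hr using (hexp r hr).2
    have h3 := h2.add_const ⟪(β : E3), x⟫_ℝ
    rw [zero_add] at h3
    exact h3.congr fun r => by ring
  have hνtop : Tendsto ν atTop atTop := by
    refine tendsto_atTop_mono' _ ?_ (tendsto_id.atTop_div_const (two_pos (α := ℝ)))
    filter_upwards [eventually_ge_atTop (2 * R)] with r hr using (hexp r hr).1
  have hratio : Tendsto (fun r => r / ν r) atTop (𝓝 1) := by
    have h1 : Tendsto (fun r => 1 - (ν r - r) * (ν r)⁻¹) atTop (𝓝 (1 - ⟪(β : E3), x⟫_ℝ * 0)) :=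
      tendsto_const_nhds.sub (hdiff.mul (tendsto_inv_atTop_zero.comp hνtop))
    rw [mul_zero, sub_zero] at h1
    refine h1.congr' ?_
    filter_upwards [hνtop.eventually_gt_atTop 0] with r hr
    field_simp
    ring
  set β' : ℝ → S2 := fun r => if h : x + r • (β : E3) = 0 then β else
    ⟨‖x + r • (β : E3)‖⁻¹ • (x + r • (β : E3)), by simp [norm_smul, h, -smul_add]⟩ with hβ'
  have hβ'eq : ∀ᶠ r in atTop, (β' r : E3) = (ν r)⁻¹ • (x + r • (β : E3)) := by
    filter_upwards [hνtop.eventually_gt_atTop 0] with r hr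
    have : x + r • (β : E3) ≠ 0 := norm_pos_iff.1 hr
    simp [hβ', this, hν]
  have hβ'lim : Tendsto β' atTop (𝓝 β) := by
    rw [tendsto_subtype_rng]
    have h1 : Tendsto (fun r => (ν r)⁻¹ • x + (r / ν r) • (β : E3)) atTop
        (𝓝 ((0 : ℝ) • x + (1 : ℝ) • (β : E3))) :=
      ((tendsto_inv_atTop_zero.comp hνtop).smul_const x).add (hratio.smul_const _)
    rw [zero_smul, one_smul, zero_add] at h1
    refine h1.congr' ?_
    filter_upwards [hβ'eq] with r hr
    rw [hr, smul_add, smul_smul, div_eq_inv_mul]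
  have hmain : Tendsto (fun r => (ν r : ℂ) *
      (Complex.exp (Complex.I * ((k * ν r : ℝ) : ℂ)))⁻¹ * w (ν r • (β' r : E3))) atTop (𝓝 (B β)) := by
    have hB := (h.continuous_amplitude hw).tendsto β |>.comp hβ'lim
    rw [Metric.tendsto_nhds] at hB ⊢
    intro η hη
    have hu := (Metric.tendstoUniformly_iff.1 h.tendstoUniformly) (η / 2) (by positivity)
    filter_upwards [hB (η / 2) (by positivity), hνtop.eventually hu] with r h1 h2
    have h3 := h2 (β' r)
    rw [dist_comm] at h3
    exact (dist_triangle _ _ _).trans_lt (by simpa using add_lt_add h3 h1)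
  have t2 : Tendsto (fun r => ((r / ν r : ℝ) : ℂ)) atTop (𝓝 ((1 : ℝ) : ℂ)) :=
    (Complex.continuous_ofReal.tendsto _).comp hratio
  have t3 : Tendsto (fun r => Complex.exp (Complex.I * ((k * (ν r - r) : ℝ) : ℂ))) atTop
      (𝓝 (Complex.exp (Complex.I * ((k * ⟪(β : E3), x⟫_ℝ : ℝ) : ℂ)))) := by
    have hc : Continuous fun s : ℝ => Complex.exp (Complex.I * ((k * s : ℝ) : ℂ)) := by fun_prop
    exact (hc.tendsto _).comp hdiff
  have := (hmain.mul t2).mul t3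
  rw [Complex.ofReal_one, mul_one] at this
  refine this.congr' ?_
  filter_upwards [hβ'eq, hνtop.eventually_gt_atTop 0] with r h1 h2
  rw [h1, smul_smul, mul_inv_cancel₀ h2.ne', one_smul]
  have e : Complex.exp (Complex.I * ((k * (ν r - r) : ℝ) : ℂ)) =
      Complex.exp (Complex.I * ((k * ν r : ℝ) : ℂ)) *
        (Complex.exp (Complex.I * ((k * r : ℝ) : ℂ)))⁻¹ := by
    rw [← Complex.exp_neg, ← Complex.exp_add]; congr 1; push_cast; ring
  rw [e]
  have h3 : ((ν r : ℝ) : ℂ) ≠ 0 := by exact_mod_cast h2.ne'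
  have := Complex.exp_ne_zero (Complex.I * ((k * ν r : ℝ) : ℂ))
  push_cast at this ⊢
  field_simp

end IsOutgoing

end Representation

/-! ### From outgoing solutions to the homogeneous integral equation. -/

section RepresentationFormula

variable {k ε : ℝ}

lemma tendsto_integral_cut_mul {F : E3 → ℂ} (hF : Integrable F) (x : E3) :
    Tendsto (fun R : ℝ => ∫ y, (cut (‖y - x‖ ^ 2 / R ^ 2) : ℂ) * F y) atTop (𝓝 (∫ y, F y)) := by
  refine tendsto_integral_filter_of_dominated_convergence (fun y => ‖F y‖) ?_ ?_ hF.norm ?_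
  · refine Eventually.of_forall fun R => AEStronglyMeasurable.mul ?_ hF.1
    have := contDiff_cut.continuous
    exact Continuous.aestronglyMeasurable (by fun_prop)
  · refine Eventually.of_forall fun R => Eventually.of_forall fun y => ?_
    rw [norm_mul, Complex.norm_real]
    exact mul_le_of_le_one_left (norm_nonneg _) (abs_cut_le _)
  · refine Eventually.of_forall fun y => ?_
    refine tendsto_const_nhds.congr' ?_
    filter_upwards [eventually_gt_atTop 0, eventually_ge_atTop ‖y - x‖] with R h0 h1
    rw [cut_of_le, Complex.ofReal_one, one_mul]
    rw [div_le_one (by positivity)]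
    gcongr

lemma continuous_regSource (hε : 0 < ε) (x : E3) :
    Continuous fun y : E3 => regSource k ε (‖y - x‖ ^ 2) := by
  have hs := (contDiff_regWave k hε x)
  have : (fun y : E3 => regSource k ε (‖y - x‖ ^ 2)) = fun y =>
      Laplacian.laplacian (fun y : E3 => regWave k ε (‖y - x‖ ^ 2)) y +
      (k : ℂ) ^ 2 * regWave k ε (‖y - x‖ ^ 2) := funext fun y => (laplacian_regWave hε x y).symm
  rw [this]
  exact (continuous_laplacian (hs.of_le (by norm_cast))).add (continuous_const.mul hs.continuous)

/-- The source decays only like the inverse cube of the distance, which just fails to be integrable;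
the decay of `v` supplies the missing power. -/
lemma integrable_mul_regSource (hk : 0 ≤ k) (hε : 0 < ε) (hε1 : ε ≤ 1) {v : E3 → ℂ}
    (hv : Continuous v) {C : ℝ} (x : E3) (hC : ∀ y, ‖v (x + y)‖ * (1 + ‖y‖) ≤ C) :
    Integrable fun y => v y * regSource k ε (‖y - x‖ ^ 2) := by
  have hC0 : 0 ≤ C := le_trans (by positivity) (hC 0)
  have h4 := (integrable_inv_pow_four.comp_sub_right x).const_mul
    (C * ((k ^ 2 + 3 * k + 3) * (ε⁻¹ ^ 3)))
  refine h4.mono' (hv.mul (continuous_regSource hε x)).aestronglyMeasurable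
    (Eventually.of_forall fun y => ?_)
  set z := y - x with hz
  set s := √(1 + ‖z‖ ^ 2)
  have hs1 : 1 ≤ s := Real.one_le_sqrt.2 (by nlinarith [sq_nonneg ‖z‖])
  have hs0 : 0 < s := by linarith
  have hsle : s ≤ 1 + ‖z‖ := Real.sqrt_le_iff.2 ⟨by positivity, by nlinarith [norm_nonneg z]⟩
  have hb := hC z
  rw [hz, add_sub_cancel] at hb
  have hv1 : ‖v y‖ ≤ C * s⁻¹ := by
    rw [← div_eq_mul_inv, le_div_iff₀ hs0]
    exact (mul_le_mul_of_nonneg_left hsle (norm_nonneg _)).trans hb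
  have hρ : ε * s ≤ √(‖z‖ ^ 2 + ε ^ 2) := by
    refine Real.le_sqrt_of_sq_le ?_
    rw [mul_pow, Real.sq_sqrt (by positivity)]
    nlinarith [mul_le_of_le_one_left (sq_nonneg ‖z‖) (pow_le_one₀ hε.le hε1 (n := 2))]
  have hS : ‖regSource k ε (‖z‖ ^ 2)‖ ≤ (k ^ 2 + 3 * k + 3) * (ε⁻¹ ^ 3) * s⁻¹ ^ 3 := by
    unfold regSource
    set ρ := √(‖z‖ ^ 2 + ε ^ 2)
    have hρ0 : 0 < ρ := lt_of_lt_of_le (by positivity) hρ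
    set p := ρ⁻¹ with hp
    have hp0 : 0 < p := inv_pos.2 hρ0
    have hp1 : p ≤ ε⁻¹ * s⁻¹ := by rw [← mul_inv]; exact inv_anti₀ (by positivity) hρ
    have hpε : ε * p ≤ 1 := by
      rw [hp, mul_inv_le_iff₀ hρ0, one_mul]
      exact (le_mul_of_one_le_right hε.le hs1).trans hρ
    have hn : ‖(k : ℂ) ^ 2 * ((ρ : ℝ) : ℂ)⁻¹ ^ 3 + 3 * Complex.I * k * ((ρ : ℝ) : ℂ)⁻¹ ^ 4
        - 3 * ((ρ : ℝ) : ℂ)⁻¹ ^ 5‖ ≤ k ^ 2 * p ^ 3 + 3 * k * p ^ 4 + 3 * p ^ 5 := by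
      refine (norm_sub_le _ _).trans (add_le_add ((norm_add_le _ _).trans (add_le_add ?_ ?_)) ?_)
      · simp [hp, abs_of_nonneg hk, abs_of_pos hρ0]
      · simp [hp, abs_of_nonneg hk, abs_of_pos hρ0]
      · simp [hp, abs_of_pos hρ0]
    rw [norm_mul, norm_mul, mul_comm Complex.I, Complex.norm_exp_ofReal_mul_I, mul_one, norm_pow,
      Complex.norm_real, Real.norm_of_nonneg hε.le]
    have e1 : ε ^ 2 ≤ 1 := pow_le_one₀ hε.le hε1
    have e2 : ε ^ 2 * p ≤ 1 := by nlinarith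
    have e3 : ε ^ 2 * p ^ 2 ≤ 1 := by rw [← mul_pow]; exact pow_le_one₀ (by positivity) hpε
    calc ε ^ 2 * ‖_‖ ≤ ε ^ 2 * (k ^ 2 * p ^ 3 + 3 * k * p ^ 4 + 3 * p ^ 5) := by gcongr
      _ = (k ^ 2 * (ε ^ 2) + 3 * k * (ε ^ 2 * p) + 3 * (ε ^ 2 * p ^ 2)) * p ^ 3 := by ring
      _ ≤ (k ^ 2 * 1 + 3 * k * 1 + 3 * 1) * (ε⁻¹ * s⁻¹) ^ 3 := by gcongr
      _ = _ := by ring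
  rw [norm_mul]
  calc ‖v y‖ * ‖regSource k ε (‖z‖ ^ 2)‖
      ≤ (C * s⁻¹) * ((k ^ 2 + 3 * k + 3) * (ε⁻¹ ^ 3) * s⁻¹ ^ 3) := by gcongr
    _ = _ := by ring

/-- The radial test function used in the representation formula. -/
noncomputable def cutWave (k ε R : ℝ) (x y : E3) : ℂ :=
  (cut (‖y - x‖ ^ 2 / R ^ 2) : ℂ) * regWave k ε (‖y - x‖ ^ 2)

lemma contDiff_cutWave (k : ℝ) (hε : 0 < ε) (R : ℝ) (x : E3) :
    ContDiff ℝ ∞ (cutWave k ε R x) := by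
  refine ContDiff.mul ?_ (contDiff_regWave k hε x)
  refine Complex.ofRealCLM.contDiff.comp (contDiff_cut.comp ?_)
  exact ((contDiff_id.sub contDiff_const).norm_sq ℝ).div_const _

lemma hasCompactSupport_cutWave {R : ℝ} (hR : 0 < R) (x : E3) :
    HasCompactSupport (cutWave k ε R x) := by
  refine HasCompactSupport.intro (isCompact_closedBall x (2 * R)) fun y hy => ?_
  rw [mem_closedBall, not_le, dist_eq_norm] at hy
  unfold cutWave
  rw [cut_of_ge, Complex.ofReal_zero, zero_mul]
  rw [le_div_iff₀ (by positivity)]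
  nlinarith [norm_nonneg (y - x)]

lemma laplacian_cutWave (hε : 0 < ε) (R : ℝ) (x y : E3) :
    Laplacian.laplacian (cutWave k ε R x) y + (k : ℂ) ^ 2 * cutWave k ε R x y =
      (cut (‖y - x‖ ^ 2 / R ^ 2) : ℂ) * regSource k ε (‖y - x‖ ^ 2) +
        cutError k ε R (‖y - x‖ ^ 2) := by
  have d0 : ∀ t : ℝ, HasDerivAt (fun t => (cut (t / R ^ 2) : ℂ))
      ((deriv cut (t / R ^ 2) / R ^ 2 : ℝ) : ℂ) t := by
    intro t
    have h1 := (hasDerivAt_cut (t / R ^ 2)).comp t ((hasDerivAt_id t).div_const (R ^ 2))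
    refine (h1.congr_deriv ?_).ofReal_comp
    ring
  have d1 : ∀ t : ℝ, HasDerivAt (fun t => ((deriv cut (t / R ^ 2) / R ^ 2 : ℝ) : ℂ))
      ((deriv (deriv cut) (t / R ^ 2) / R ^ 4 : ℝ) : ℂ) t := by
    intro t
    have h1 := ((hasDerivAt_deriv_cut (t / R ^ 2)).comp t
      ((hasDerivAt_id t).div_const (R ^ 2))).div_const (R ^ 2)
    refine (h1.congr_deriv ?_).ofReal_comp
    ring
  have h := laplacian_radial (F := fun t => (cut (t / R ^ 2) : ℂ) * regWave k ε t)
    (F' := fun t => ((deriv cut (t / R ^ 2) / R ^ 2 : ℝ) : ℂ) * regWave k ε t +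
      (cut (t / R ^ 2) : ℂ) * regWave' k ε t)
    (F'' := fun t => (((deriv (deriv cut) (t / R ^ 2) / R ^ 4 : ℝ) : ℂ) * regWave k ε t +
      ((deriv cut (t / R ^ 2) / R ^ 2 : ℝ) : ℂ) * regWave' k ε t) +
      (((deriv cut (t / R ^ 2) / R ^ 2 : ℝ) : ℂ) * regWave' k ε t +
        (cut (t / R ^ 2) : ℂ) * regWave'' k ε t)) x
    ((contDiff_cutWave k hε R x).of_le (by norm_cast))
    (fun t ht => (d0 t).mul (hasDerivAt_regWave hε ht))
    (fun t ht => ((d1 t).mul (hasDerivAt_regWave hε ht)).add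
      ((d0 t).mul (hasDerivAt_regWave' hε ht))) y
  have h' : Laplacian.laplacian (cutWave k ε R x) y = _ := h
  rw [h', ← regSource_eq hε (by positivity)]
  unfold cutWave cutError
  ring

/-- An outgoing solution of the Schrödinger equation solves the homogeneous
Lippmann–Schwinger equation. -/
theorem eq_neg_potential_of_isOutgoing (hk : 0 < k) {D : Set E3} (hDm : MeasurableSet D)
    (hDb : Bornology.IsBounded D) {q w : E3 → ℂ} {M : ℝ}
    (hqm : AEStronglyMeasurable q (volume.restrict D))
    (hq : ∀ᵐ y ∂volume.restrict D, ‖q y‖ ≤ M) (hw : Continuous w) {B : S2 → ℂ}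
    (hout : IsOutgoing k w B) (hsol : SolvesSchrodinger k (D.indicator q) w) (x : E3) :
    w x = -potential k D (fun y => q y * w y) x := by
  have hD : volume D ≠ ⊤ := hDb.measure_lt_top.ne
  have hfin : IsFiniteMeasure (volume.restrict D) := ⟨by simpa using hD.lt_top⟩
  obtain ⟨C, hC⟩ := hout.exists_bound_shift hw x
  have hqi : Integrable (D.indicator q) := by
    rw [integrable_indicator_iff hDm]
    exact (integrable_const M).mono' hqm hq
  have hCw : ∀ y, ‖w y‖ ≤ C := fun y => by
    have := hC (y - x)
    rw [add_sub_cancel] at this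
    exact (le_mul_of_one_le_right (norm_nonneg _) (by simp)).trans this
  have hqwi : Integrable fun y => D.indicator q y * w y :=
    hqi.mul_bdd (c := C) hw.aestronglyMeasurable (Eventually.of_forall hCw)
  have hind : ∀ f : E3 → ℂ, ∫ y, D.indicator q y * w y * f y = ∫ y in D, q y * w y * f y := by
    intro f
    rw [← integral_indicator hDm]
    congr 1; ext y
    by_cases hy : y ∈ D <;> simp [hy]
  -- the identity for the regularized kernel
  have key : ∀ ε : ℝ, 0 < ε → ε ≤ 1 → ∫ y, w y * regSource k ε (‖y - x‖ ^ 2) =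
      ∫ y, D.indicator q y * w y * regWave k ε (‖y - x‖ ^ 2) := by
    intro ε hε hε1
    have hGc : Continuous fun y : E3 => regWave k ε (‖y - x‖ ^ 2) :=
      (contDiff_regWave k hε x).continuous
    have hSc := continuous_regSource (k := k) hε x
    have hGb : ∀ y : E3, ‖regWave k ε (‖y - x‖ ^ 2)‖ ≤ ε⁻¹ := by
      intro y
      unfold regWave
      rw [norm_mul, mul_comm Complex.I, Complex.norm_exp_ofReal_mul_I, norm_inv,
        Complex.norm_real, one_mul, Real.norm_of_nonneg (Real.sqrt_nonneg _)]
      refine inv_anti₀ hε (Real.le_sqrt_of_sq_le ?_)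
      nlinarith [sq_nonneg ‖y - x‖]
    have iS := integrable_mul_regSource hk.le hε hε1 hw x hC
    have iG : Integrable fun y => D.indicator q y * w y * regWave k ε (‖y - x‖ ^ 2) :=
      hqwi.mul_bdd (c := ε⁻¹) hGc.aestronglyMeasurable (Eventually.of_forall hGb)
    have l1 := tendsto_integral_cut_mul iS x
    have l2 := tendsto_integral_cut_mul iG x
    have l3 : Tendsto (fun R : ℝ => ∫ y, w y * cutError k ε R (‖y - x‖ ^ 2)) atTop (𝓝 0) := by
      have := tendsto_integral_cutError hk hε (u := fun z => w (x + z)) (by fun_prop) hC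
        (c := fun β => B β * Complex.exp (Complex.I * ((k * ⟪(β : E3), x⟫_ℝ : ℝ) : ℂ)))
        (fun β => hout.tendsto_shift hw x β)
      refine this.congr fun R => ?_
      rw [← integral_add_left_eq_self (fun y => w y * cutError k ε R (‖y - x‖ ^ 2)) x]
      simp
    have l4 := l1.add l3
    rw [add_zero] at l4
    -- For finite `R` the weak equation is tested with `cutWave`; letting `R → ∞` at fixed `ε`
    -- removes the cutoff and its error.
    refine tendsto_nhds_unique l4 (l2.congr' ?_)
    filter_upwards [eventually_gt_atTop 0] with R hR
    have hφ := contDiff_cutWave k hε R x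
    have hφ2 : ContDiff ℝ 2 (cutWave k ε R x) := hφ.of_le (by norm_cast)
    have hφc : HasCompactSupport (cutWave k ε R x) := hasCompactSupport_cutWave hR x
    have hs := hsol _ hφ hφc
    have j1 : Integrable fun y => w y * (Laplacian.laplacian (cutWave k ε R x) y +
        (k : ℂ) ^ 2 * cutWave k ε R x y) :=
      (hw.mul ((continuous_laplacian hφ2).add
        (continuous_const.mul hφ.continuous))).integrable_of_hasCompactSupport
        ((hasCompactSupport_laplacian hφc).add hφc.mul_left).mul_left
    have hcutc : Continuous fun y : E3 => (cut (‖y - x‖ ^ 2 / R ^ 2) : ℂ) := by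
      have := contDiff_cut.continuous
      fun_prop
    have j2 : Integrable fun y => (cut (‖y - x‖ ^ 2 / R ^ 2) : ℂ) *
        (w y * regSource k ε (‖y - x‖ ^ 2)) := iS.bdd_mul (c := 1) hcutc.aestronglyMeasurable
      (Eventually.of_forall fun y => by rw [Complex.norm_real]; exact abs_cut_le _)
    have j3 : Integrable fun y => w y * cutError k ε R (‖y - x‖ ^ 2) := by
      refine (j1.sub j2).congr (Eventually.of_forall fun y => ?_)
      simp only [Pi.sub_apply]
      rw [laplacian_cutWave hε]; ring
    have j4 : Integrable fun y => D.indicator q y * w y * cutWave k ε R x y := by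
      refine (iG.bdd_mul (c := 1) hcutc.aestronglyMeasurable (Eventually.of_forall fun y => by
        rw [Complex.norm_real]; exact abs_cut_le _)).congr (Eventually.of_forall fun y => ?_)
      simp only [cutWave]; ring
    rw [integral_sub j1 j4, sub_eq_zero] at hs
    calc ∫ y, (cut (‖y - x‖ ^ 2 / R ^ 2) : ℂ) *
          (D.indicator q y * w y * regWave k ε (‖y - x‖ ^ 2))
        = ∫ y, D.indicator q y * w y * cutWave k ε R x y := by
          congr 1; ext y; simp only [cutWave]; ring
      _ = ∫ y, w y * (Laplacian.laplacian (cutWave k ε R x) y +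
        (k : ℂ) ^ 2 * cutWave k ε R x y) := hs.symm
      _ = _ := by
          rw [← integral_add j2 j3]
          congr 1; ext y
          rw [laplacian_cutWave hε]; ring
  have hi : Integrable fun y => ‖y - x‖⁻¹ * ‖D.indicator q y * w y‖ := by
    have hint : IntegrableOn (fun y => ‖x - y‖⁻¹ * (M * C)) D :=
      (integrableOn_inv_of_finite hD x).mul_const _
    have hm : AEStronglyMeasurable (fun y => ‖y - x‖⁻¹ * ‖D.indicator q y * w y‖) volume :=
      (Measurable.aestronglyMeasurable (by fun_prop)).mul hqwi.1.norm
    have : Integrable (D.indicator fun y => ‖x - y‖⁻¹ * (M * C)) := hint.integrable_indicator hDm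
    refine this.mono' hm ?_
    rw [ae_restrict_iff' hDm] at hq
    filter_upwards [hq] with y hy
    rw [Real.norm_of_nonneg (by positivity), norm_sub_rev y x]
    by_cases hyD : y ∈ D
    · simp only [hyD, indicator_of_mem, norm_mul]
      have := hy hyD
      gcongr
      · exact (norm_nonneg _).trans this
      · exact hCw y
    · simp [hyD]
  -- Now `ε → 0`: the source side tends to `-4π w(x)`, the wave side to `4π` times the potential of
  -- `q w`.
  have l1 := tendsto_integral_regSource hk.le hw x hC
  have l2 := tendsto_integral_regWave (k := k) x hqwi.1 hi
  have l3 := l1.congr' (f₂ := fun ε => ∫ y, D.indicator q y * w y * regWave k ε (‖y - x‖ ^ 2)) (by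
    filter_upwards [Ioc_mem_nhdsGT (zero_lt_one (α := ℝ))] with ε hε using key ε hε.1 hε.2)
  have h := tendsto_nhds_unique l3 l2
  have hp : (4 * Real.pi : ℂ) ≠ 0 := by
    exact_mod_cast (mul_pos (by norm_num : (0 : ℝ) < 4) Real.pi_pos).ne'
  have e : ∫ y, green k x y * (D.indicator q y * w y) = potential k D (fun y => q y * w y) x := by
    have := hind (green k x)
    unfold potential
    simp_rw [mul_comm (green k x _)]
    exact this
  rw [e] at h
  refine mul_left_cancel₀ hp ?_
  rw [mul_neg, ← h]
  ring

end RepresentationFormula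

/-! ### Compactness of the homogeneous solution spaces. -/

section HomogeneousSolutions

open scoped BoundedContinuousFunction

variable {k : ℝ} {D : Set E3}

/-- The bounded continuous solutions of the homogeneous Lippmann–Schwinger equation. -/
noncomputable def homSol (k : ℝ) (D : Set E3) (q : E3 → ℂ) : Submodule ℂ (E3 →ᵇ ℂ) where
  carrier := {w | ∀ x, IntegrableOn (fun y => green k x y * (q y * w y)) D ∧
    w x = -potential k D (fun y => q y * w y) x}
  zero_mem' x := by simp [potential]
  add_mem' {v w} hv hw x := by
    have e : ∀ y, green k x y * (q y * (v + w) y) =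
        green k x y * (q y * v y) + green k x y * (q y * w y) := fun y => by
      rw [BoundedContinuousFunction.coe_add, Pi.add_apply]; ring
    refine ⟨((hv x).1.add (hw x).1).congr (Eventually.of_forall fun y => (e y).symm), ?_⟩
    rw [BoundedContinuousFunction.coe_add, Pi.add_apply, (hv x).2, (hw x).2]
    unfold potential
    rw [← neg_add, ← integral_add (hv x).1 (hw x).1]
    simp_rw [← e]; rfl
  smul_mem' c w hw x := by
    have e : ∀ y, green k x y * (q y * (c • w) y) = c * (green k x y * (q y * w y)) := fun y => by
      change green k x y * (q y * (c * w y)) = _; ring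
    refine ⟨((hw x).1.const_mul c).congr (Eventually.of_forall fun y => (e y).symm), ?_⟩
    change c * w x = _
    rw [(hw x).2, mul_neg]
    unfold potential
    rw [← integral_const_mul]
    simp_rw [← e]

/-- The integrability clause makes `homSol` a submodule for every `q`; for bounded measurable `q` it
is automatic. -/
lemma mem_homSol (hD : volume D ≠ ⊤) {q : E3 → ℂ} (hq : Measurable q) {M : ℝ}
    (hM : ∀ y, ‖q y‖ ≤ M) {w : E3 →ᵇ ℂ} :
    w ∈ homSol k D q ↔ ∀ x, w x = -potential k D (fun y => q y * w y) x := by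
  refine ⟨fun h x => (h x).2, fun h x => ⟨?_, h x⟩⟩
  refine integrable_green_mul (M := M * ‖w‖) k hD
    (hq.mul w.continuous.measurable).aestronglyMeasurable (Eventually.of_forall fun y => ?_) x
  change ‖q y * w y‖ ≤ _
  rw [norm_mul]
  exact mul_le_mul (hM y) (w.norm_coe_le_norm y) (norm_nonneg _) ((norm_nonneg _).trans (hM y))

lemma homSol_apply {q : E3 → ℂ} {w : E3 →ᵇ ℂ} (h : w ∈ homSol k D q) (x : E3) :
    w x = -potential k D (fun y => q y * w y) x := (h x).2

lemma potential_congr {f g : E3 → ℂ} (h : f =ᵐ[volume.restrict D] g) (x : E3) :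
    potential k D f x = potential k D g x := by
  refine integral_congr_ae ?_
  filter_upwards [h] with y hy
  rw [hy]

lemma potential_sub_of_bounded (hD : volume D ≠ ⊤) {f g : E3 → ℂ} {M N : ℝ}
    (hf : Measurable f) (hg : Measurable g) (hfM : ∀ y, ‖f y‖ ≤ M) (hgN : ∀ y, ‖g y‖ ≤ N) (x : E3) :
    potential k D (fun y => f y - g y) x = potential k D f x - potential k D g x := by
  unfold potential
  rw [← integral_sub (integrable_green_mul k hD hf.aestronglyMeasurable
    (Eventually.of_forall hfM) x) (integrable_green_mul k hD hg.aestronglyMeasurable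
    (Eventually.of_forall hgN) x)]
  simp_rw [mul_sub]

lemma potential_const_mul (c : ℂ) (f : E3 → ℂ) (x : E3) :
    potential k D (fun y => c * f y) x = c * potential k D f x := by
  unfold potential
  rw [← integral_const_mul]
  congr 1; ext y; ring

/-- Difference of two potentials, controlled by the densities on `D`. -/
lemma norm_potential_sub_potential_le (hk : 0 ≤ k) (hDm : MeasurableSet D) (hD : volume D ≠ ⊤)
    {f g : E3 → ℂ} {M N δ : ℝ}
    (hf : Measurable f) (hg : Measurable g) (hfM : ∀ y, ‖f y‖ ≤ M) (hgN : ∀ y, ‖g y‖ ≤ N)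
    (hδ : ∀ y ∈ D, ‖f y - g y‖ ≤ δ) (hδ0 : 0 ≤ δ) (x : E3) :
    ‖potential k D f x - potential k D g x‖ ≤ potConst k D * δ := by
  rw [← potential_sub_of_bounded hD hf hg hfM hgN]
  refine norm_potential_le' hk hD ?_ hδ0 x
  rw [ae_restrict_iff' hDm]
  exact Eventually.of_forall hδ

/-- Bounded families of solutions with convergent potentials are relatively compact. -/
lemma exists_subseq_homSol (hk : 0 ≤ k) (hDm : MeasurableSet D) (hDb : Bornology.IsBounded D)
    {qs : ℕ → E3 → ℂ} {q : E3 → ℂ} {M : ℝ} (hqs : ∀ n, Measurable (qs n)) (hq : Measurable q)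
    (hM : ∀ n y, ‖qs n y‖ ≤ M) (hM' : ∀ y, ‖q y‖ ≤ M) {δ : ℕ → ℝ} (hδ : Tendsto δ atTop (𝓝 0))
    (hqδ : ∀ n y, ‖qs n y - q y‖ ≤ δ n) {ws : ℕ → E3 →ᵇ ℂ} (hws : ∀ n, ws n ∈ homSol k D (qs n))
    (hw1 : ∀ n, ‖ws n‖ ≤ 1) :
    ∃ (φ : ℕ → ℕ) (w : E3 →ᵇ ℂ), StrictMono φ ∧ w ∈ homSol k D q ∧
      Tendsto (fun n => ws (φ n)) atTop (𝓝 w) := by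
  have hD : volume D ≠ ⊤ := hDb.measure_lt_top.ne
  have hM0 : 0 ≤ M := (norm_nonneg _).trans (hM' 0)
  have hP0 : 0 ≤ potConst k D := potConst_nonneg hk
  have hm : ∀ n, Measurable fun y => qs n y * ws n y := fun n =>
    (hqs n).mul (ws n).continuous.measurable
  have hb : ∀ n y, ‖qs n y * ws n y‖ ≤ M := fun n y => by
    rw [norm_mul]
    calc _ ≤ M * 1 := mul_le_mul (hM n y) (((ws n).norm_coe_le_norm y).trans (hw1 n))
          (norm_nonneg _) hM0
      _ = M := mul_one M
  -- compactness on the closure of `D`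
  have hcpt : CompactSpace (closure D) := isCompact_iff_compactSpace.1 hDb.isCompact_closure
  -- The potential sees `w` only on `D`. Restrictions to the compact closure are uniformly
  -- Lipschitz, so Arzelà–Ascoli applies there, and the integral equation carries uniform
  -- convergence on `D` to the whole space.
  set r : (E3 →ᵇ ℂ) → (closure D →ᵇ ℂ) := fun w =>
    w.compContinuous ⟨Subtype.val, continuous_subtype_val⟩ with hr
  have hL0 : 0 ≤ potConst k D * M := mul_nonneg hP0 hM0
  set A : Set (closure D →ᵇ ℂ) := {f | (∀ x, f x ∈ closedBall (0 : ℂ) 1) ∧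
    LipschitzWith (potConst k D * M).toNNReal f}
  have hA : IsCompact (closure A) := by
    refine BoundedContinuousFunction.arzela_ascoli (closedBall (0 : ℂ) 1)
      (isCompact_closedBall _ _) A (fun f x hf => hf.1 x) ?_
    exact (LipschitzWith.uniformEquicontinuous _ (potConst k D * M).toNNReal
      fun f : A => f.2.2).equicontinuous
  have hrA : ∀ n, r (ws n) ∈ closure A := by
    refine fun n => subset_closure ⟨fun x => ?_, LipschitzWith.of_dist_le_mul fun x y => ?_⟩
    · rw [mem_closedBall_zero_iff]
      exact ((ws n).norm_coe_le_norm _).trans (hw1 n)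
    · rw [Real.coe_toNNReal _ hL0, dist_eq_norm, Subtype.dist_eq, dist_eq_norm]
      change ‖ws n x - ws n y‖ ≤ _
      rw [homSol_apply (hws n), homSol_apply (hws n) y, neg_sub_neg, norm_sub_rev]
      exact norm_potential_sub_le hk hD (hm n).aestronglyMeasurable
        (Eventually.of_forall (hb n)) hM0 _ _
  obtain ⟨_, _, φ, hφ, hlim⟩ := hA.tendsto_subseq hrA
  have hcau := hlim.cauchySeq
  -- upgrade to uniform convergence
  have hδn : ∀ n, 0 ≤ δ n := fun n => (norm_nonneg _).trans (hqδ n 0)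
  have hest : ∀ n m, dist (ws (φ n)) (ws (φ m)) ≤
      potConst k D * ((δ (φ n) + δ (φ m)) + M * dist (r (ws (φ n))) (r (ws (φ m)))) := by
    intro n m
    rw [BoundedContinuousFunction.dist_le (by have := hδn (φ n); have := hδn (φ m); positivity)]
    intro x
    rw [dist_eq_norm, homSol_apply (hws _), homSol_apply (hws (φ m)), neg_sub_neg, norm_sub_rev]
    refine norm_potential_sub_potential_le hk hDm hD (hm _) (hm _) (hb _) (hb _) (fun y hy => ?_)
      (by have := hδn (φ n); have := hδn (φ m); positivity) x
    have e : qs (φ n) y * ws (φ n) y - qs (φ m) y * ws (φ m) y =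
        (qs (φ n) y - q y) * ws (φ n) y - (qs (φ m) y - q y) * ws (φ n) y +
          qs (φ m) y * (ws (φ n) y - ws (φ m) y) := by ring
    have h1 : ‖ws (φ n) y‖ ≤ 1 := ((ws _).norm_coe_le_norm y).trans (hw1 _)
    have h2 : ‖ws (φ n) y - ws (φ m) y‖ ≤ dist (r (ws (φ n))) (r (ws (φ m))) := by
      rw [← dist_eq_norm]
      exact BoundedContinuousFunction.dist_coe_le_dist (f := r (ws (φ n))) (g := r (ws (φ m)))
        ⟨y, subset_closure hy⟩
    rw [e]
    refine (norm_add_le _ _).trans (add_le_add ((norm_sub_le _ _).trans (add_le_add ?_ ?_)) ?_)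
    · rw [norm_mul]
      calc _ ≤ δ (φ n) * 1 := mul_le_mul (hqδ _ y) h1 (norm_nonneg _) (hδn _)
        _ = _ := mul_one _
    · rw [norm_mul]
      calc _ ≤ δ (φ m) * 1 := mul_le_mul (hqδ _ y) h1 (norm_nonneg _) (hδn _)
        _ = _ := mul_one _
    · rw [norm_mul]
      exact mul_le_mul (hM _ y) h2 (norm_nonneg _) hM0
  have hcauchy : CauchySeq fun n => ws (φ n) := by
    rw [Metric.cauchySeq_iff']
    intro η hη
    set c := potConst k D * (2 + M) + 1
    have hc : 0 < c := by positivity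
    have hδφ : Tendsto (fun n => δ (φ n)) atTop (𝓝 0) := hδ.comp hφ.tendsto_atTop
    obtain ⟨N2, hN2⟩ := (hδφ.eventually
      (gt_mem_nhds (show 0 < η / c by positivity))).exists_forall_of_atTop
    obtain ⟨N3, hN3⟩ := Metric.cauchySeq_iff.1 hcau (η / c) (by positivity)
    refine ⟨max N2 N3, fun n hn => (hest n _).trans_lt ?_⟩
    have a1 := hN2 n ((le_max_left _ _).trans hn)
    have a2 := hN2 (max N2 N3) (le_max_left _ _)
    have a3 := hN3 n ((le_max_right _ _).trans hn) (max N2 N3) (le_max_right _ _)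
    calc _ ≤ potConst k D * ((η / c + η / c) + M * (η / c)) := by
          gcongr
          exact a3.le
      _ = (potConst k D * (2 + M)) * (η / c) := by ring
      _ < c * (η / c) := by gcongr; simp [c]
      _ = η := by field_simp
  obtain ⟨w, hw⟩ := cauchySeq_tendsto_of_complete hcauchy
  refine ⟨φ, w, hφ, ?_, hw⟩
  rw [mem_homSol hD hq hM']
  intro x
  have hw1' : ‖w‖ ≤ 1 := le_of_tendsto hw.norm (Eventually.of_forall fun n => hw1 _)
  have hwx : Tendsto (fun n => ws (φ n) x) atTop (𝓝 (w x)) := by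
    have := (BoundedContinuousFunction.tendsto_iff_tendstoUniformly.1 hw).tendsto_at x
    exact this
  have hpx : Tendsto (fun n => potential k D (fun y => qs (φ n) y * ws (φ n) y) x) atTop
      (𝓝 (potential k D (fun y => q y * w y) x)) := by
    rw [tendsto_iff_norm_sub_tendsto_zero]
    have hz : Tendsto (fun n => potConst k D * (δ (φ n) + M * ‖ws (φ n) - w‖)) atTop (𝓝 0) := by
      have h1 := (hδ.comp hφ.tendsto_atTop).add
        ((tendsto_iff_norm_sub_tendsto_zero.1 hw).const_mul M)
      simpa using h1.const_mul (potConst k D)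
    refine squeeze_zero (fun _ => norm_nonneg _) (fun n => ?_) hz
    refine norm_potential_sub_potential_le (M := M) (N := M) hk hDm hD (hm _)
      (hq.mul w.continuous.measurable) (hb _) (fun y => ?_) (fun y _ => ?_)
      (by have := hδn (φ n); positivity) x
    · change ‖q y * w y‖ ≤ _
      rw [norm_mul]
      calc _ ≤ M * 1 := mul_le_mul (hM' y) ((w.norm_coe_le_norm y).trans hw1') (norm_nonneg _) hM0
        _ = M := mul_one M
    · have e : qs (φ n) y * ws (φ n) y - q y * w y =
        (qs (φ n) y - q y) * ws (φ n) y + q y * (ws (φ n) y - w y) := by ring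
      change ‖qs (φ n) y * ws (φ n) y - q y * w y‖ ≤ _
      rw [e]
      refine (norm_add_le _ _).trans (add_le_add ?_ ?_)
      · rw [norm_mul]
        calc _ ≤ δ (φ n) * 1 := mul_le_mul (hqδ _ y)
              (((ws _).norm_coe_le_norm y).trans (hw1 _)) (norm_nonneg _) (hδn _)
          _ = _ := mul_one _
      · rw [norm_mul]
        exact mul_le_mul (hM' y) ((ws (φ n) - w).norm_coe_le_norm y) (norm_nonneg _) hM0
  refine tendsto_nhds_unique hwx (hpx.neg.congr fun n => ?_)
  exact (homSol_apply (hws _) x).symm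

/-- Riesz's theorem: the compactness statement for a constant sequence of potentials makes the
closed unit ball compact. -/
lemma finiteDimensional_homSol (hk : 0 ≤ k) (hDm : MeasurableSet D) (hDb : Bornology.IsBounded D)
    {q : E3 → ℂ} {M : ℝ} (hq : Measurable q) (hM : ∀ y, ‖q y‖ ≤ M) :
    FiniteDimensional ℂ (homSol k D q) := by
  have hc : IsSeqCompact (closedBall (0 : homSol k D q) 1) := by
    intro x hx
    have hx1 : ∀ n, ‖(x n : E3 →ᵇ ℂ)‖ ≤ 1 := fun n => mem_closedBall_zero_iff.1 (hx n)
    obtain ⟨φ, w, hφ, hw, hlim⟩ := exists_subseq_homSol hk hDm hDb (fun _ => hq) hq (fun _ => hM)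
      hM (δ := fun _ => 0) tendsto_const_nhds (fun _ _ => by rw [sub_self, norm_zero])
      (ws := fun n => (x n : E3 →ᵇ ℂ)) (fun n => (x n).2) hx1
    refine ⟨⟨w, hw⟩, ?_, φ, hφ, tendsto_subtype_rng.2 hlim⟩
    exact mem_closedBall_zero_iff.2
      (le_of_tendsto hlim.norm (Eventually.of_forall fun n => hx1 (φ n)))
  exact FiniteDimensional.of_isCompact_closedBall₀ ℂ one_pos hc.isCompact

/-- If the solution spaces along a sequence are larger than a subspace `Y`, some limit of
solutions lies outside `Y`. -/
lemma exists_limit_notMem (hk : 0 ≤ k) (hDm : MeasurableSet D) (hDb : Bornology.IsBounded D)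
    {qs : ℕ → E3 → ℂ} {q : E3 → ℂ} {M : ℝ} (hqs : ∀ n, Measurable (qs n)) (hq : Measurable q)
    (hM : ∀ n y, ‖qs n y‖ ≤ M) (hM' : ∀ y, ‖q y‖ ≤ M) {δ : ℕ → ℝ} (hδ : Tendsto δ atTop (𝓝 0))
    (hqδ : ∀ n y, ‖qs n y - q y‖ ≤ δ n) (Y : Submodule ℂ (E3 →ᵇ ℂ)) [FiniteDimensional ℂ Y]
    (hY : ∀ n, Module.finrank ℂ Y < Module.finrank ℂ (homSol k D (qs n))) :
    ∃ (φ : ℕ → ℕ) (ws : ℕ → E3 →ᵇ ℂ) (w : E3 →ᵇ ℂ), StrictMono φ ∧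
      (∀ n, ws n ∈ homSol k D (qs (φ n))) ∧ w ∈ homSol k D q ∧ Tendsto ws atTop (𝓝 w) ∧
      w ∉ Y := by
  -- A continuous projection onto `Y` must kill a unit vector of each larger solution space. A limit
  -- of such vectors has norm one and is still killed, while `π` is the identity on `Y`.
  obtain ⟨π, hπ⟩ := Submodule.ClosedComplemented.of_finiteDimensional Y
  have hex : ∀ n, ∃ w ∈ homSol k D (qs n), ‖w‖ = 1 ∧ π w = 0 := by
    intro n
    have := finiteDimensional_homSol hk hDm hDb (hqs n) (hM n)
    have hne := LinearMap.ker_ne_bot_of_finrank_lt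
      (f := (π : (E3 →ᵇ ℂ) →ₗ[ℂ] Y).domRestrict (homSol k D (qs n))) (hY n)
    obtain ⟨v, hv, hv0⟩ := Submodule.exists_mem_ne_zero_of_ne_bot hne
    have hv0' : (v : E3 →ᵇ ℂ) ≠ 0 := fun h => hv0 (Subtype.ext h)
    have hn : ‖(v : E3 →ᵇ ℂ)‖ ≠ 0 := norm_ne_zero_iff.2 hv0'
    refine ⟨((‖(v : E3 →ᵇ ℂ)‖⁻¹ : ℝ) : ℂ) • (v : E3 →ᵇ ℂ), Submodule.smul_mem _ _ v.2, ?_, ?_⟩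
    · rw [norm_smul, Complex.norm_real, norm_inv, norm_norm, inv_mul_cancel₀ hn]
    · have : π (v : E3 →ᵇ ℂ) = 0 := hv
      rw [map_smul, this, smul_zero]
  choose ws hws hw1 hwπ using hex
  obtain ⟨φ, w, hφ, hw, hlim⟩ := exists_subseq_homSol hk hDm hDb hqs hq hM hM' hδ hqδ hws
    (fun n => (hw1 n).le)
  refine ⟨φ, fun n => ws (φ n), w, hφ, fun n => hws _, hw, hlim, fun hwY => ?_⟩
  have h1 : ‖w‖ = 1 := by
    refine tendsto_nhds_unique hlim.norm ?_
    simp [hw1]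
  have h2 : π w = 0 := by
    refine tendsto_nhds_unique ((π.continuous.tendsto w).comp hlim) ?_
    simp [Function.comp_def, hwπ]
  have h3 := hπ ⟨w, hwY⟩
  have h4 : w = 0 := by
    have := congrArg Subtype.val (h3.symm.trans h2)
    simpa using this
  rw [h4, norm_zero] at h1
  exact zero_ne_one h1

end HomogeneousSolutions


/-! ### Densities with `ψ` bounded below, and their stability. -/

section AdmissibleDensities

open scoped BoundedContinuousFunction

variable {k : ℝ} {α : S2} {D E : Set E3} {c M : ℝ} {h : E3 → ℂ}

/-- Bounded densities `h` carried by `E ⊆ D` for which `|ψ_h| ≥ c` on `E`. -/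
structure IsAdmissible (k : ℝ) (α : S2) (D E : Set E3) (c M : ℝ) (h : E3 → ℂ) : Prop where
  measurable : Measurable h
  norm_le : ∀ x, ‖h x‖ ≤ M
  eq_zero : ∀ x ∉ E, h x = 0
  le_denom : ∀ x ∈ E, c ≤ ‖denom k α D h x‖

/-- The function `1 / ψ_h` on `E`, extended by zero. -/
noncomputable def recip (k : ℝ) (α : S2) (D E : Set E3) (h : E3 → ℂ) : E3 → ℂ :=
  E.indicator fun x => (denom k α D h x)⁻¹

/-- The potential `h / ψ_h`, extended by zero off `E`. -/
noncomputable def quot (k : ℝ) (α : S2) (D E : Set E3) (h : E3 → ℂ) : E3 → ℂ :=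
  fun x => h x * recip k α D E h x

lemma continuous_denom_of_bounded (hk : 0 ≤ k) (hD : volume D ≠ ⊤) (hh : Measurable h)
    (hM : ∀ x, ‖h x‖ ≤ M) : Continuous (denom k α D h) := by
  have h1 : Continuous (potential k D h) :=
    continuous_potential_of_bounded hk hD hh.aestronglyMeasurable (Eventually.of_forall hM)
      ((norm_nonneg _).trans (hM 0))
  exact (contDiff_planeWave k α).continuous.sub h1

lemma denom_sub_denom (hD : volume D ≠ ⊤) {h' : E3 → ℂ} {M' : ℝ} (hh : Measurable h)
    (hM : ∀ x, ‖h x‖ ≤ M) (hh' : Measurable h') (hM' : ∀ x, ‖h' x‖ ≤ M') (x : E3) :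
    denom k α D h x - denom k α D h' x = potential k D (fun y => h' y - h y) x := by
  rw [potential_sub_of_bounded hD hh' hh hM' hM, denom_eq, denom_eq]
  ring

lemma norm_denom_sub_denom_le (hk : 0 ≤ k) (hD : volume D ≠ ⊤) {h' : E3 → ℂ} {M' δ : ℝ}
    (hh : Measurable h) (hM : ∀ x, ‖h x‖ ≤ M) (hh' : Measurable h') (hM' : ∀ x, ‖h' x‖ ≤ M')
    (hδ : ∀ x, ‖h' x - h x‖ ≤ δ) (x : E3) :
    ‖denom k α D h x - denom k α D h' x‖ ≤ potConst k D * δ := by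
  rw [denom_sub_denom hD hh hM hh' hM']
  exact norm_potential_le' hk hD (Eventually.of_forall hδ) ((norm_nonneg _).trans (hδ 0)) x

namespace IsAdmissible

lemma nonneg (hh : IsAdmissible k α D E c M h) : 0 ≤ M := (norm_nonneg _).trans (hh.norm_le 0)

lemma continuous_denom (hh : IsAdmissible k α D E c M h) (hk : 0 ≤ k) (hD : volume D ≠ ⊤) :
    Continuous (denom k α D h) :=
  continuous_denom_of_bounded hk hD hh.measurable hh.norm_le

lemma measurable_recip (hh : IsAdmissible k α D E c M h) (hk : 0 ≤ k) (hD : volume D ≠ ⊤)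
    (hE : MeasurableSet E) : Measurable (recip k α D E h) :=
  (hh.continuous_denom hk hD).measurable.inv.indicator hE

lemma norm_recip_le (hh : IsAdmissible k α D E c M h) (hc : 0 < c) (x : E3) :
    ‖recip k α D E h x‖ ≤ c⁻¹ := by
  by_cases hx : x ∈ E
  · rw [recip, indicator_of_mem hx, norm_inv]
    exact inv_anti₀ hc (hh.le_denom x hx)
  · rw [recip, indicator_of_notMem hx, norm_zero]
    positivity

lemma denom_ne_zero (hh : IsAdmissible k α D E c M h) (hc : 0 < c) {x : E3} (hx : x ∈ E) :
    denom k α D h x ≠ 0 := norm_pos_iff.1 (hc.trans_le (hh.le_denom x hx))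

lemma denom_mul_recip (hh : IsAdmissible k α D E c M h) (hc : 0 < c) {x : E3} (hx : x ∈ E) :
    denom k α D h x * recip k α D E h x = 1 := by
  rw [recip, indicator_of_mem hx, mul_inv_cancel₀ (hh.denom_ne_zero hc hx)]

lemma quot_mul_denom (hh : IsAdmissible k α D E c M h) (hc : 0 < c) (x : E3) :
    quot k α D E h x * denom k α D h x = h x := by
  by_cases hx : x ∈ E
  · rw [quot, mul_assoc, mul_comm (recip _ _ _ _ _ _), hh.denom_mul_recip hc hx, mul_one]
  · rw [quot, hh.eq_zero x hx, zero_mul, zero_mul]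

lemma quot_eq_zero (hh : IsAdmissible k α D E c M h) {x : E3} (hx : x ∉ E) :
    quot k α D E h x = 0 := by rw [quot, hh.eq_zero x hx, zero_mul]

lemma measurable_quot (hh : IsAdmissible k α D E c M h) (hk : 0 ≤ k) (hD : volume D ≠ ⊤)
    (hE : MeasurableSet E) : Measurable (quot k α D E h) :=
  hh.measurable.mul (hh.measurable_recip hk hD hE)

lemma norm_quot_le (hh : IsAdmissible k α D E c M h) (hc : 0 < c) (x : E3) :
    ‖quot k α D E h x‖ ≤ M * c⁻¹ := by
  rw [quot, norm_mul]
  exact mul_le_mul (hh.norm_le x) (hh.norm_recip_le hc x) (norm_nonneg _) hh.nonneg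

/-- Continuity of `h ↦ h/ψ_h` in the sup norm: `ψ_h` is Lipschitz in `h`, and the lower bound `c`
controls the difference of the reciprocals. -/
lemma norm_quot_sub_le (hh : IsAdmissible k α D E c M h) (hc : 0 < c) (hk : 0 ≤ k)
    (hD : volume D ≠ ⊤) {h' : E3 → ℂ} (hh' : IsAdmissible k α D E c M h') {δ : ℝ}
    (hδ : ∀ x, ‖h' x - h x‖ ≤ δ) (x : E3) :
    ‖quot k α D E h' x - quot k α D E h x‖ ≤
      c⁻¹ * δ + M * (c⁻¹ * c⁻¹ * (potConst k D * δ)) := by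
  have hδ0 : 0 ≤ δ := (norm_nonneg _).trans (hδ 0)
  have hM := hh.nonneg
  have hP : 0 ≤ potConst k D := potConst_nonneg hk
  by_cases hx : x ∈ E
  · have e : quot k α D E h' x - quot k α D E h x = recip k α D E h' x * (h' x - h x) +
        h x * (recip k α D E h x * recip k α D E h' x *
          (denom k α D h x - denom k α D h' x)) := by
      have e1 := hh.denom_mul_recip hc hx
      have e2 := hh'.denom_mul_recip hc hx
      rw [quot, quot]
      linear_combination (-(h x) * recip k α D E h' x) * e1 + (h x * recip k α D E h x) * e2
    rw [e]
    refine (norm_add_le _ _).trans (add_le_add ?_ ?_)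
    · rw [norm_mul]
      exact mul_le_mul (hh'.norm_recip_le hc x) (hδ x) (norm_nonneg _) (by positivity)
    · rw [norm_mul, norm_mul, norm_mul]
      have h1 := hh.norm_recip_le hc x
      have h2 := hh'.norm_recip_le hc x
      have h3 := norm_denom_sub_denom_le (α := α) hk hD hh.measurable hh.norm_le hh'.measurable
        hh'.norm_le hδ x
      have h4 := hh.norm_le x
      gcongr
  · rw [hh.quot_eq_zero hx, hh'.quot_eq_zero hx, sub_zero, norm_zero]
    positivity

/-- Admissibility survives uniformly small changes carried by `E`, with a small loss in the
constants. -/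
lemma of_norm_sub_le (hh : IsAdmissible k α D E c M h) (hk : 0 ≤ k)
    (hD : volume D ≠ ⊤) {h' : E3 → ℂ} {δ : ℝ} (hm : Measurable h') (hE : ∀ x ∉ E, h' x = 0)
    (hδ : ∀ x, ‖h' x - h x‖ ≤ δ) :
    IsAdmissible k α D E (c - potConst k D * δ) (M + δ) h' := by
  have hM' : ∀ x, ‖h' x‖ ≤ M + δ := fun x => by
    calc ‖h' x‖ = ‖h x + (h' x - h x)‖ := by rw [add_sub_cancel]
      _ ≤ M + δ := (norm_add_le _ _).trans (add_le_add (hh.norm_le x) (hδ x))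
  refine ⟨hm, hM', hE, fun x hx => ?_⟩
  have h1 := hh.le_denom x hx
  have h2 := norm_denom_sub_denom_le (α := α) hk hD hh.measurable hh.norm_le hm hM' hδ x
  have h3 := norm_sub_norm_le (denom k α D h x) (denom k α D h' x)
  linarith

lemma mono (hh : IsAdmissible k α D E c M h) {c' M' : ℝ} (hc : c' ≤ c) (hM : M ≤ M') :
    IsAdmissible k α D E c' M' h :=
  ⟨hh.measurable, fun x => (hh.norm_le x).trans hM, hh.eq_zero,
    fun x hx => hc.trans (hh.le_denom x hx)⟩

end IsAdmissible

/-- The Green function is symmetric, so the potential operator is symmetric for the bilinear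
pairing on `D`. -/
lemma integral_potential_mul (hD : volume D ≠ ⊤) {a b : E3 → ℂ} {A B : ℝ} (ha : Measurable a)
    (hb : Measurable b) (hA : ∀ x, ‖a x‖ ≤ A) (hB : ∀ x, ‖b x‖ ≤ B) :
    ∫ x in D, potential k D a x * b x = ∫ x in D, a x * potential k D b x := by
  have hfin : IsFiniteMeasure (volume.restrict D) := ⟨by
    rw [Measure.restrict_apply_univ]; exact hD.lt_top⟩
  have hA0 : 0 ≤ A := (norm_nonneg _).trans (hA 0)
  have hB0 : 0 ≤ B := (norm_nonneg _).trans (hB 0)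
  have hm : AEStronglyMeasurable (Function.uncurry fun x y => green k x y * a y * b x)
      ((volume.restrict D).prod (volume.restrict D)) :=
    (((measurable_green k).mul (ha.comp measurable_snd)).mul
      (hb.comp measurable_fst)).aestronglyMeasurable
  have hint : Integrable (Function.uncurry fun x y => green k x y * a y * b x)
      ((volume.restrict D).prod (volume.restrict D)) := by
    rw [integrable_prod_iff hm]
    refine ⟨Eventually.of_forall fun x => ((integrable_green_mul k hD ha.aestronglyMeasurable
      (Eventually.of_forall hA) x).mul_const (b x)), ?_⟩
    refine Integrable.of_bound (C := (4 * Real.pi * 1 ^ 2 + volume.real D / 1) * A * B)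
      hm.norm.integral_prod_right' (Eventually.of_forall fun x => ?_)
    rw [Real.norm_of_nonneg (integral_nonneg fun _ => norm_nonneg _)]
    have hle : ∀ y, ‖green k x y * a y * b x‖ ≤ ‖x - y‖⁻¹ * (A * B) := fun y => by
      rw [norm_mul, norm_mul, mul_assoc]
      exact mul_le_mul (norm_green_le k x y) (mul_le_mul (hA y) (hB x) (norm_nonneg _) hA0)
        (by positivity) (by positivity)
    calc ∫ y in D, ‖green k x y * a y * b x‖ ≤ ∫ y in D, ‖x - y‖⁻¹ * (A * B) := by
          refine integral_mono_of_nonneg (Eventually.of_forall fun _ => norm_nonneg _)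
            ((integrableOn_inv_of_finite hD x).mul_const _) (Eventually.of_forall hle)
      _ = (∫ y in D, ‖x - y‖⁻¹) * (A * B) := integral_mul_const _ _
      _ ≤ (4 * Real.pi * 1 ^ 2 + volume.real D / 1) * (A * B) := by
          gcongr
          exact integral_inv_le hD x one_pos
      _ = _ := by ring
  have h1 : ∀ x, potential k D a x * b x = ∫ y in D, green k x y * a y * b x := fun x =>
    (integral_mul_const _ _).symm
  have h2 : ∀ y, a y * potential k D b y = ∫ x in D, green k x y * a y * b x := fun y => by
    unfold potential
    rw [← integral_const_mul]
    congr 1; ext x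
    rw [green_comm k y x]; ring
  simp_rw [h1, h2]
  exact integral_integral_swap hint

end AdmissibleDensities


/-! ### Perturbation theory: minimal nullity gives a product. -/

section ProductStructure

open scoped BoundedContinuousFunction

variable {k : ℝ} {α : S2} {D E : Set E3} {c M : ℝ} {h : E3 → ℂ}

lemma integrableOn_of_bounded (hD : volume D ≠ ⊤) {f : E3 → ℂ} {B : ℝ} (hf : Measurable f)
    (hB : ∀ x, ‖f x‖ ≤ B) : IntegrableOn f D := by
  have hfin : IsFiniteMeasure (volume.restrict D) := ⟨by
    rw [Measure.restrict_apply_univ]; exact hD.lt_top⟩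
  exact Integrable.of_bound hf.aestronglyMeasurable B (Eventually.of_forall hB)

lemma norm_mul_bound {a b : ℂ} {A B : ℝ} (ha : ‖a‖ ≤ A) (hb : ‖b‖ ≤ B) : ‖a * b‖ ≤ A * B := by
  rw [norm_mul]
  exact mul_le_mul ha hb (norm_nonneg _) ((norm_nonneg _).trans ha)

/-- Integration against a fixed integrable weight, as a functional on bounded functions. -/
noncomputable def weightIntegral {p : E3 → ℂ} (hp : IntegrableOn p D) :
    (E3 →ᵇ ℂ) →ₗ[ℂ] ℂ where
  toFun w := ∫ x in D, p x * w x
  map_add' v w := by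
    have hi : ∀ w : E3 →ᵇ ℂ, IntegrableOn (fun x => p x * w x) D := fun w =>
      hp.mul_bdd (c := ‖w‖) w.continuous.aestronglyMeasurable
        (Eventually.of_forall fun x => w.norm_coe_le_norm x)
    rw [← integral_add (hi v) (hi w)]
    refine integral_congr_ae (Eventually.of_forall fun x => ?_)
    change p x * (v x + w x) = _
    exact mul_add _ _ _
  map_smul' a w := by
    rw [RingHom.id_apply, smul_eq_mul, ← integral_const_mul]
    refine integral_congr_ae (Eventually.of_forall fun x => ?_)
    change p x * (a * w x) = a * (p x * w x)
    ring

lemma weightIntegral_apply {p : E3 → ℂ} (hp : IntegrableOn p D) (w : E3 →ᵇ ℂ) :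
    weightIntegral hp w = ∫ x in D, p x * w x := rfl

/-- The variational identity linking solutions for `h` and for `h + s η`. -/
lemma integral_variation_eq_zero (hk : 0 ≤ k) (hD : volume D ≠ ⊤) (hE : MeasurableSet E)
    (hc : 0 < c) (hh : IsAdmissible k α D E c M h) {η : E3 → ℂ}
    (hηE : ∀ x ∉ E, η x = 0) {s : ℂ} (hs : s ≠ 0)
    (hhs : IsAdmissible k α D E c M fun x => h x + s * η x) {v w : E3 →ᵇ ℂ}
    (hv : v ∈ homSol k D (quot k α D E h))
    (hw : w ∈ homSol k D (quot k α D E fun x => h x + s * η x)) :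
    ∫ x in D, (η x + quot k α D E (fun x => h x + s * η x) x * potential k D η x) *
      (v x * w x * recip k α D E h x) = 0 := by
  set qs := quot k α D E fun x => h x + s * η x with hqs
  set q := quot k α D E h with hq
  have hqv : Measurable fun x => q x * v x :=
    (hh.measurable_quot hk hD hE).mul v.continuous.measurable
  have hqw : Measurable fun x => qs x * w x :=
    (hhs.measurable_quot hk hD hE).mul w.continuous.measurable
  have bqv : ∀ x, ‖q x * v x‖ ≤ M * c⁻¹ * ‖v‖ := fun x =>
    norm_mul_bound (hh.norm_quot_le hc x) (v.norm_coe_le_norm x)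
  have bqw : ∀ x, ‖qs x * w x‖ ≤ M * c⁻¹ * ‖w‖ := fun x =>
    norm_mul_bound (hhs.norm_quot_le hc x) (w.norm_coe_le_norm x)
  -- The right side is `(q_s - q) v w`. From `ψ_{h+sη} = ψ_h - s G η` one gets `q_s ψ_h = h + s η +
  -- s q_s G η`; dividing by `ψ_h` exhibits the factor `s`.
  have hpt : ∀ x, s * ((η x + qs x * potential k D η x) * (v x * w x * recip k α D E h x)) =
      v x * (qs x * w x) - q x * v x * w x := by
    intro x
    by_cases hx : x ∈ E
    · have e1 := hh.denom_mul_recip hc hx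
      have e2 := hhs.quot_mul_denom hc x
      have e3 := denom_sub_denom (k := k) (α := α) hD hh.measurable hh.norm_le hhs.measurable
        hhs.norm_le x
      simp only [add_sub_cancel_left] at e3
      rw [potential_const_mul] at e3
      have e4 : q x = h x * recip k α D E h x := rfl
      rw [← hqs] at e2
      rw [e4]
      have e5 : qs x * (denom k α D h x - s * potential k D η x) = h x + s * η x := by
        rw [← e2, ← e3]; ring
      linear_combination (v x * w x * qs x) * e1 - (v x * w x * recip k α D E h x) * e5
    · have e1 : qs x = 0 := hhs.quot_eq_zero hx
      have e2 : q x = 0 := hh.quot_eq_zero hx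
      rw [e1, e2, hηE x hx]; ring
  have i1 : IntegrableOn (fun x => v x * (qs x * w x)) D :=
    integrableOn_of_bounded hD (v.continuous.measurable.mul hqw)
      fun x => norm_mul_bound (v.norm_coe_le_norm x) (bqw x)
  have i2 : IntegrableOn (fun x => q x * v x * w x) D :=
    integrableOn_of_bounded hD (hqv.mul w.continuous.measurable)
      fun x => norm_mul_bound (bqv x) (w.norm_coe_le_norm x)
  have hsym := integral_potential_mul (k := k) hD hqv hqw bqv bqw
  have hzero : s * ∫ x in D, (η x + qs x * potential k D η x) *
      (v x * w x * recip k α D E h x) = 0 := by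
    rw [← integral_const_mul]
    simp_rw [hpt]
    rw [integral_sub i1 i2, sub_eq_zero]
    have e1 : ∀ x, v x * (qs x * w x) = -(potential k D (fun y => q y * v y) x * (qs x * w x)) :=
      fun x => by rw [homSol_apply hv x]; ring
    have e2 : ∀ x, q x * v x * w x = -(q x * v x * potential k D (fun y => qs y * w y) x) :=
      fun x => by rw [homSol_apply hw x]; ring
    -- Insert `v = -G(q v)`, transfer `G` by symmetry, then use `G(q_s w) = -w`.
    calc ∫ x in D, v x * (qs x * w x) = ∫ x in D,
          -(potential k D (fun y => q y * v y) x * (qs x * w x)) :=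
          integral_congr_ae (Eventually.of_forall e1)
      _ = ∫ x in D, -(q x * v x * potential k D (fun y => qs y * w y) x) := by
          rw [integral_neg, integral_neg, hsym]
      _ = _ := integral_congr_ae (Eventually.of_forall fun x => (e2 x).symm)
  exact (mul_eq_zero.1 hzero).resolve_left hs

/-- The variational identity in the limit `s → 0`. -/
lemma integral_variation_limit (hk : 0 ≤ k) (hD : volume D ≠ ⊤) (hE : MeasurableSet E)
    (hc : 0 < c) (hh : IsAdmissible k α D E c M h) {η : E3 → ℂ} {B : ℝ} (hη : Measurable η)
    (hηB : ∀ x, ‖η x‖ ≤ B) (hηE : ∀ x ∉ E, η x = 0) {s : ℕ → ℂ} (hs : ∀ n, s n ≠ 0)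
    (hs0 : Tendsto s atTop (𝓝 0))
    (hhs : ∀ n, IsAdmissible k α D E c M fun x => h x + s n * η x) {v w : E3 →ᵇ ℂ}
    (hv : v ∈ homSol k D (quot k α D E h)) {ws : ℕ → E3 →ᵇ ℂ}
    (hws : ∀ n, ws n ∈ homSol k D (quot k α D E fun x => h x + s n * η x))
    (hlim : Tendsto ws atTop (𝓝 w)) :
    ∫ x in D, (η x + quot k α D E h x * potential k D η x) *
      (v x * w x * recip k α D E h x) = 0 := by
  have hfin : IsFiniteMeasure (volume.restrict D) := ⟨by
    rw [Measure.restrict_apply_univ]; exact hD.lt_top⟩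
  have hB0 : 0 ≤ B := (norm_nonneg _).trans (hηB 0)
  have hG : Continuous (potential k D η) :=
    continuous_potential_of_bounded hk hD hη.aestronglyMeasurable (Eventually.of_forall hηB) hB0
  have bG : ∀ x, ‖potential k D η x‖ ≤ potConst k D * B := fun x =>
    norm_potential_le' hk hD (Eventually.of_forall hηB) hB0 x
  have hκ := hh.measurable_recip hk hD hE
  have hbw : ∀ᶠ n in atTop, ‖ws n‖ ≤ ‖w‖ + 1 :=
    (hlim.norm.eventually (gt_mem_nhds (lt_add_one ‖w‖))).mono fun n hn => hn.le
  have hconv := tendsto_integral_filter_of_dominated_convergence (μ := volume.restrict D)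
    (l := atTop) (F := fun n x => (η x + quot k α D E (fun x => h x + s n * η x) x *
      potential k D η x) * (v x * ws n x * recip k α D E h x))
    (f := fun x => (η x + quot k α D E h x * potential k D η x) *
      (v x * w x * recip k α D E h x))
    (fun _ => (B + M * c⁻¹ * (potConst k D * B)) * (‖v‖ * (‖w‖ + 1) * c⁻¹))
    (Eventually.of_forall fun n => ((hη.add (((hhs n).measurable_quot hk hD hE).mul
      hG.measurable)).mul ((v.continuous.measurable.mul
        (ws n).continuous.measurable).mul hκ)).aestronglyMeasurable)
    (hbw.mono fun n hn => Eventually.of_forall fun x => norm_mul_bound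
      ((norm_add_le _ _).trans (add_le_add (hηB x)
        (norm_mul_bound ((hhs n).norm_quot_le hc x) (bG x))))
      (norm_mul_bound (norm_mul_bound (v.norm_coe_le_norm x)
        (((ws n).norm_coe_le_norm x).trans hn)) (hh.norm_recip_le hc x)))
    (integrable_const _)
    (Eventually.of_forall fun x => by
      have hwx : Tendsto (fun n => ws n x) atTop (𝓝 (w x)) :=
        (BoundedContinuousFunction.tendsto_iff_tendstoUniformly.1 hlim).tendsto_at x
      have hqx : Tendsto (fun n => quot k α D E (fun x => h x + s n * η x) x) atTop
          (𝓝 (quot k α D E h x)) := by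
        rw [tendsto_iff_norm_sub_tendsto_zero]
        refine squeeze_zero (fun _ => norm_nonneg _)
          (g := fun n => c⁻¹ * (‖s n‖ * B) + M * (c⁻¹ * c⁻¹ * (potConst k D * (‖s n‖ * B))))
          (fun n => ?_) ?_
        · refine hh.norm_quot_sub_le hc hk hD (hhs n) (fun y => ?_) x
          rw [add_sub_cancel_left]
          exact norm_mul_bound le_rfl (hηB y)
        · have h1 : Tendsto (fun n => ‖s n‖ * B) atTop (𝓝 0) := by
            simpa using hs0.norm.mul_const B
          simpa using (h1.const_mul c⁻¹).add
            (((h1.const_mul (potConst k D)).const_mul (c⁻¹ * c⁻¹)).const_mul M)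
      exact (tendsto_const_nhds.add (hqx.mul_const _)).mul
        ((tendsto_const_nhds.mul hwx).mul_const _))
  refine tendsto_nhds_unique hconv ?_
  have : ∀ n, ∫ x in D, (η x + quot k α D E (fun x => h x + s n * η x) x *
      potential k D η x) * (v x * ws n x * recip k α D E h x) = 0 := fun n =>
    integral_variation_eq_zero hk hD hE hc hh hηE (hs n) (hhs n) hv (hws n)
  simp_rw [this]
  exact tendsto_const_nhds

/-- If the dimension of the solution space does not drop under small perturbations of `h`, the
solution space is closed under `(v, w) ↦ v w / ψ_h`. -/
lemma exists_mul_mem_homSol (hk : 0 ≤ k) (hDm : MeasurableSet D) (hDb : Bornology.IsBounded D)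
    (hE : MeasurableSet E) (hED : E ⊆ D) (hc : 0 < c) (hh : IsAdmissible k α D E c M h)
    (hnear : ∀ (η : E3 → ℂ) (B : ℝ), Measurable η → (∀ x, ‖η x‖ ≤ B) → (∀ x ∉ E, η x = 0) →
      ∃ s₀ : ℝ, 0 < s₀ ∧ ∀ s : ℝ, 0 < s → s < s₀ →
        IsAdmissible k α D E c M (fun x => h x + (s : ℂ) * η x) ∧
        Module.finrank ℂ (homSol k D (quot k α D E h)) ≤
          Module.finrank ℂ (homSol k D (quot k α D E fun x => h x + (s : ℂ) * η x)))
    {v w : E3 →ᵇ ℂ} (hv : v ∈ homSol k D (quot k α D E h))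
    (hw : w ∈ homSol k D (quot k α D E h)) :
    ∃ F ∈ homSol k D (quot k α D E h),
      ∀ᵐ x ∂volume.restrict E, F x * denom k α D h x = v x * w x := by
  have hD : volume D ≠ ⊤ := hDb.measure_lt_top.ne
  have hq := hh.measurable_quot hk hD hE
  have bq := hh.norm_quot_le hc
  have hκ := hh.measurable_recip hk hD hE
  have bκ := hh.norm_recip_le hc
  have hfd := finiteDimensional_homSol hk hDm hDb hq bq
  -- the limiting identity holds for every pair of solutions
  have key : ∀ (η : E3 → ℂ) (B : ℝ), Measurable η → (∀ x, ‖η x‖ ≤ B) → (∀ x ∉ E, η x = 0) →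
      ∫ x in D, (η x + quot k α D E h x * potential k D η x) *
        (v x * w x * recip k α D E h x) = 0 := by
    intro η B hη hηB hηE
    have hB0 : 0 ≤ B := (norm_nonneg _).trans (hηB 0)
    have hG : Continuous (potential k D η) :=
      continuous_potential_of_bounded hk hD hη.aestronglyMeasurable (Eventually.of_forall hηB) hB0
    have bG : ∀ x, ‖potential k D η x‖ ≤ potConst k D * B := fun x =>
      norm_potential_le' hk hD (Eventually.of_forall hηB) hB0 x
    have hp : IntegrableOn (fun x => (η x + quot k α D E h x * potential k D η x) *
        (v x * recip k α D E h x)) D :=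
      integrableOn_of_bounded hD ((hη.add (hq.mul hG.measurable)).mul
        (v.continuous.measurable.mul hκ)) fun x => norm_mul_bound
          ((norm_add_le _ _).trans (add_le_add (hηB x) (norm_mul_bound (bq x) (bG x))))
          (norm_mul_bound (v.norm_coe_le_norm x) (bκ x))
    have hpe : ∀ u : E3 →ᵇ ℂ, weightIntegral hp u =
        ∫ x in D, (η x + quot k α D E h x * potential k D η x) *
          (v x * u x * recip k α D E h x) := fun u => by
      rw [weightIntegral_apply]
      refine integral_congr_ae (Eventually.of_forall fun x => ?_)
      ring
    -- If the identity failed for `w`, its solutions would form a proper subspace `Y` of the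
    -- solution space. The nearby spaces are larger than `Y`, so some limit of their elements lies
    -- outside `Y`; yet the limiting identity holds for exactly such limits.
    by_contra hne
    rw [← hpe] at hne
    set Y : Submodule ℂ (E3 →ᵇ ℂ) :=
      homSol k D (quot k α D E h) ⊓ LinearMap.ker (weightIntegral hp) with hY
    have hlt : Y < homSol k D (quot k α D E h) := by
      refine lt_of_le_of_ne inf_le_left fun he => hne ?_
      have : w ∈ Y := he ▸ hw
      exact this.2
    have hYfd : FiniteDimensional ℂ Y :=
      Submodule.finiteDimensional_of_le hlt.le
    have hfr := Submodule.finrank_lt_finrank_of_lt hlt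
    obtain ⟨s₀, hs₀, hs⟩ := hnear η B hη hηB hηE
    set t : ℕ → ℝ := fun n => s₀ / 2 * (1 / ((n : ℝ) + 1)) with ht
    have ht0 : ∀ n, 0 < t n := fun n => by positivity
    have htl : ∀ n, t n < s₀ := fun n => by
      have : 1 / ((n : ℝ) + 1) ≤ 1 := by
        rw [div_le_one (by positivity)]; linarith [n.cast_nonneg (α := ℝ)]
      calc t n ≤ s₀ / 2 * 1 := mul_le_mul_of_nonneg_left this (by positivity)
        _ < s₀ := by linarith
    have htlim : Tendsto t atTop (𝓝 0) := by
      have := (tendsto_one_div_add_atTop_nhds_zero_nat (𝕜 := ℝ)).const_mul (s₀ / 2)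
      rwa [mul_zero] at this
    have hA : ∀ n, IsAdmissible k α D E c M fun x => h x + (t n : ℂ) * η x :=
      fun n => (hs _ (ht0 n) (htl n)).1
    obtain ⟨φ, ws, u, hφ, hws, hu, hlim, huY⟩ := exists_limit_notMem hk hDm hDb
      (fun n => (hA n).measurable_quot hk hD hE) hq (fun n => (hA n).norm_quot_le hc) bq
      (δ := fun n => c⁻¹ * (t n * B) + M * (c⁻¹ * c⁻¹ * (potConst k D * (t n * B))))
      (by
        have h1 : Tendsto (fun n => t n * B) atTop (𝓝 0) := by
          simpa using htlim.mul_const B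
        simpa using (h1.const_mul c⁻¹).add
          (((h1.const_mul (potConst k D)).const_mul (c⁻¹ * c⁻¹)).const_mul M))
      (fun n y => by
        refine hh.norm_quot_sub_le hc hk hD (hA n) (fun y => ?_) y
        rw [add_sub_cancel_left]
        refine norm_mul_bound ?_ (hηB y)
        rw [Complex.norm_real, Real.norm_of_nonneg (ht0 n).le])
      Y (fun n => hfr.trans_le (hs _ (ht0 n) (htl n)).2)
    refine huY ⟨hu, ?_⟩
    change weightIntegral hp u = 0
    rw [hpe]
    refine integral_variation_limit hk hD hE hc hh hη hηB hηE (s := fun n => (t (φ n) : ℂ))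
      (fun n => Complex.ofReal_ne_zero.2 (ht0 _).ne') ?_ (fun n => hA _) hv hws hlim
    have := (Complex.continuous_ofReal.tendsto 0).comp (htlim.comp hφ.tendsto_atTop)
    simpa [Function.comp_def] using this
  -- choose the test density to be the conjugate of the defect
  set p : E3 → ℂ := fun x => v x * w x * recip k α D E h x with hp
  have hpm : Measurable p := (v.continuous.measurable.mul w.continuous.measurable).mul hκ
  have bp : ∀ x, ‖p x‖ ≤ ‖v‖ * ‖w‖ * c⁻¹ := fun x =>
    norm_mul_bound (norm_mul_bound (v.norm_coe_le_norm x) (w.norm_coe_le_norm x)) (bκ x)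
  have hqp : Measurable fun x => quot k α D E h x * p x := hq.mul hpm
  have bqp : ∀ x, ‖quot k α D E h x * p x‖ ≤ M * c⁻¹ * (‖v‖ * ‖w‖ * c⁻¹) := fun x =>
    norm_mul_bound (bq x) (bp x)
  have hM0 := hh.nonneg
  have hP0 : 0 ≤ potConst k D := potConst_nonneg hk
  have hK0 : 0 ≤ M * c⁻¹ * (‖v‖ * ‖w‖ * c⁻¹) := by positivity
  have hGc : Continuous (potential k D fun y => quot k α D E h y * p y) :=
    continuous_potential_of_bounded hk hD hqp.aestronglyMeasurable (Eventually.of_forall bqp) hK0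
  have bG : ∀ x, ‖potential k D (fun y => quot k α D E h y * p y) x‖ ≤
      potConst k D * (M * c⁻¹ * (‖v‖ * ‖w‖ * c⁻¹)) := fun x =>
    norm_potential_le' hk hD (Eventually.of_forall bqp) hK0 x
  -- Moving `G` off `η` by symmetry turns the identity into `∫ η Φ = 0` for every bounded `η`
  -- carried by `E`, so `Φ` vanishes almost everywhere on `E`.
  set Φ : E3 → ℂ := fun x => p x + potential k D (fun y => quot k α D E h y * p y) x with hΦ
  have hΦm : Measurable Φ := hpm.add hGc.measurable
  have bΦ : ∀ x, ‖Φ x‖ ≤ ‖v‖ * ‖w‖ * c⁻¹ + potConst k D * (M * c⁻¹ * (‖v‖ * ‖w‖ * c⁻¹)) :=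
    fun x => (norm_add_le _ _).trans (add_le_add (bp x) (bG x))
  set η : E3 → ℂ := E.indicator fun x => (starRingEnd ℂ) (Φ x) with hηd
  have hηm : Measurable η := (Complex.continuous_conj.measurable.comp hΦm).indicator hE
  have bη : ∀ x, ‖η x‖ ≤ ‖v‖ * ‖w‖ * c⁻¹ + potConst k D * (M * c⁻¹ * (‖v‖ * ‖w‖ * c⁻¹)) :=
    fun x => (norm_indicator_le_norm_self _ _).trans (by rw [RCLike.norm_conj]; exact bΦ x)
  have hηE : ∀ x ∉ E, η x = 0 := fun x hx => indicator_of_notMem hx _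
  have hη0 : 0 ≤ ‖v‖ * ‖w‖ * c⁻¹ + potConst k D * (M * c⁻¹ * (‖v‖ * ‖w‖ * c⁻¹)) := by positivity
  have hGη : Continuous (potential k D η) :=
    continuous_potential_of_bounded hk hD hηm.aestronglyMeasurable (Eventually.of_forall bη) hη0
  have bGη : ∀ x, ‖potential k D η x‖ ≤ potConst k D *
      (‖v‖ * ‖w‖ * c⁻¹ + potConst k D * (M * c⁻¹ * (‖v‖ * ‖w‖ * c⁻¹))) := fun x =>
    norm_potential_le' hk hD (Eventually.of_forall bη) hη0 x
  have h0 := key η _ hηm bη hηE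
  have hsym := integral_potential_mul (k := k) hD hηm hqp bη bqp
  have h1 : ∫ x in D, η x * Φ x = 0 := by
    have j1 : IntegrableOn (fun x => η x * p x) D :=
      integrableOn_of_bounded hD (hηm.mul hpm) fun x => norm_mul_bound (bη x) (bp x)
    have j2 : IntegrableOn (fun x => potential k D η x * (quot k α D E h x * p x)) D :=
      integrableOn_of_bounded hD (hGη.measurable.mul hqp) fun x =>
        norm_mul_bound (bGη x) (bqp x)
    have j3 : IntegrableOn (fun x => η x * potential k D (fun y => quot k α D E h y * p y) x) D :=
      integrableOn_of_bounded hD (hηm.mul hGc.measurable) fun x => norm_mul_bound (bη x) (bG x)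
    calc ∫ x in D, η x * Φ x = ∫ x in D, (η x * p x +
          η x * potential k D (fun y => quot k α D E h y * p y) x) :=
          integral_congr_ae (Eventually.of_forall fun x => by simp only [hΦ]; ring)
      _ = ∫ x in D, (η x * p x + potential k D η x * (quot k α D E h x * p x)) := by
          rw [integral_add j1 j3, integral_add j1 j2, hsym]
      _ = _ := by
          rw [← h0]
          exact integral_congr_ae (Eventually.of_forall fun x => by simp only [hp]; ring)
  have h2 : ∫ x in D, ‖E.indicator Φ x‖ ^ 2 = 0 := by
    have e : ∀ x, η x * Φ x = ((‖E.indicator Φ x‖ ^ 2 : ℝ) : ℂ) := fun x => by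
      by_cases hx : x ∈ E
      · rw [hηd, indicator_of_mem hx, indicator_of_mem hx, RCLike.conj_mul]
        push_cast; rfl
      · rw [hηE x hx, indicator_of_notMem hx, zero_mul, norm_zero]; simp
    simp_rw [e] at h1
    have h1' := integral_ofReal (𝕜 := ℂ) (μ := volume.restrict D)
      (f := fun x => ‖E.indicator Φ x‖ ^ 2)
    exact Complex.ofReal_eq_zero.1 (h1'.symm.trans h1)
  have h3 : ∀ᵐ x ∂volume.restrict D, ‖E.indicator Φ x‖ ^ 2 = 0 := by
    refine (integral_eq_zero_iff_of_nonneg (fun x => by positivity) ?_).1 h2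
    have hfin : IsFiniteMeasure (volume.restrict D) := ⟨by
      rw [Measure.restrict_apply_univ]; exact hD.lt_top⟩
    refine Integrable.of_bound ((hΦm.indicator hE).norm.pow_const 2).aestronglyMeasurable
      ((‖v‖ * ‖w‖ * c⁻¹ + potConst k D * (M * c⁻¹ * (‖v‖ * ‖w‖ * c⁻¹))) ^ 2)
      (Eventually.of_forall fun x => ?_)
    rw [norm_pow, norm_norm]
    gcongr
    exact (norm_indicator_le_norm_self _ _).trans (bΦ x)
  have h4 : ∀ᵐ x ∂volume.restrict D, x ∈ E → Φ x = 0 := h3.mono fun x hx hxE => by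
    rw [indicator_of_mem hxE] at hx
    exact norm_eq_zero.1 (pow_eq_zero_iff two_ne_zero |>.1 hx)
  -- `F` is the continuous representative of `p` on `E`; since `q` is carried by `E`, replacing `p`
  -- by `F` inside the potential changes nothing, so `F` is a solution.
  set F : E3 →ᵇ ℂ := BoundedContinuousFunction.ofNormedAddCommGroup
    (fun x => -potential k D (fun y => quot k α D E h y * p y) x) hGc.neg _
    (fun x => by rw [norm_neg]; exact bG x) with hF
  have hFx : ∀ x, F x = -potential k D (fun y => quot k α D E h y * p y) x := fun x => rfl
  have hFp : ∀ x, Φ x = 0 → F x = p x := fun x hx => by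
    rw [hFx]; simp only [hΦ] at hx
    linear_combination -hx
  refine ⟨F, ?_, ?_⟩
  · rw [mem_homSol hD hq bq]
    intro x
    rw [hFx]
    congr 1
    refine potential_congr ?_ x
    filter_upwards [h4] with y hy
    by_cases hyE : y ∈ E
    · rw [hFp y (hy hyE)]
    · rw [hh.quot_eq_zero hyE, zero_mul, zero_mul]
  · have h5 := ae_mono (Measure.restrict_mono hED le_rfl) h4
    filter_upwards [h5, ae_restrict_mem hE] with x hx hxE
    rw [hFp x (hx hxE)]
    have e1 := hh.denom_mul_recip hc hxE
    simp only [hp]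
    linear_combination (v x * w x) * e1

end ProductStructure


/-! ### Idempotents, and the contradiction that gives uniqueness. -/

section GenericUniqueness

open scoped BoundedContinuousFunction

variable {k : ℝ} {α : S2} {D E : Set E3} {c M : ℝ} {h : E3 → ℂ}

/-- A solution vanishing almost everywhere on the carrier of the potential is zero. -/
lemma eq_zero_of_ae_eq_zero {q : E3 → ℂ} (hDm : MeasurableSet D) (hE : MeasurableSet E)
    (hqE : ∀ x ∉ E, q x = 0) {u : E3 →ᵇ ℂ}
    (hu : u ∈ homSol k D q) (h0 : ∀ᵐ x ∂volume.restrict E, u x = 0) : u = 0 := by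
  ext x
  rw [homSol_apply hu x, potential_congr (g := fun _ => 0)]
  · simp [potential]
  · rw [ae_restrict_iff' hE] at h0
    rw [EventuallyEq, ae_restrict_iff' hDm]
    filter_upwards [h0] with y hy _
    by_cases hyE : y ∈ E
    · rw [hy hyE, mul_zero]
    · rw [hqE y hyE, zero_mul]

/-- A nonzero finite-dimensional solution space closed under `(v, w) ↦ v w / ψ_h` contains a
nonzero function with values in `{0, ψ_h}` on `E`. -/
lemma exists_idempotent (hk : 0 ≤ k) (hDm : MeasurableSet D) (hDb : Bornology.IsBounded D)
    (hE : MeasurableSet E) (hc : 0 < c) (hh : IsAdmissible k α D E c M h)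
    (hne : homSol k D (quot k α D E h) ≠ ⊥)
    (hmul : ∀ v ∈ homSol k D (quot k α D E h), ∀ w ∈ homSol k D (quot k α D E h),
      ∃ F ∈ homSol k D (quot k α D E h),
        ∀ᵐ x ∂volume.restrict E, F x * denom k α D h x = v x * w x) :
    ∃ F ∈ homSol k D (quot k α D E h), F ≠ 0 ∧
      ∀ᵐ x ∂volume.restrict E, F x = 0 ∨ F x = denom k α D h x := by
  have hD : volume D ≠ ⊤ := hDb.measure_lt_top.ne
  set N := homSol k D (quot k α D E h) with hN
  have hfd : FiniteDimensional ℂ N := finiteDimensional_homSol hk hDm hDb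
    (hh.measurable_quot hk hD hE) (hh.norm_quot_le hc)
  have hzero : ∀ u ∈ N, (∀ᵐ x ∂volume.restrict E, u x = 0) → u = 0 := fun u hu h0 =>
    eq_zero_of_ae_eq_zero hDm hE (fun x hx => hh.quot_eq_zero hx) hu h0
  have hψ : ∀ᵐ x ∂volume.restrict E, denom k α D h x ≠ 0 :=
    (ae_restrict_mem hE).mono fun x hx => hh.denom_ne_zero hc hx
  obtain ⟨v, hv, hv0⟩ := Submodule.exists_mem_ne_zero_of_ne_bot hne
  -- Solutions that vanish where `v` does. On this finite-dimensional space multiplication by `v/ψ`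
  -- is injective, hence surjective; the preimage `u` of `v` satisfies `v u = v ψ`, so it equals `ψ`
  -- where `v ≠ 0` and `0` elsewhere.
  let Z : Submodule ℂ (E3 →ᵇ ℂ) :=
    { carrier := {u | u ∈ N ∧ ∀ᵐ x ∂volume.restrict E, v x = 0 → u x = 0}
      zero_mem' := ⟨N.zero_mem, Eventually.of_forall fun _ _ => rfl⟩
      add_mem' := fun {a b} ha hb => ⟨N.add_mem ha.1 hb.1, by
        filter_upwards [ha.2, hb.2] with x h1 h2 h3
        change a x + b x = 0
        rw [h1 h3, h2 h3, add_zero]⟩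
      smul_mem' := fun t a ha => ⟨N.smul_mem t ha.1, by
        filter_upwards [ha.2] with x h1 h3
        change t * a x = 0
        rw [h1 h3, mul_zero]⟩ }
  have hZN : Z ≤ N := fun u hu => hu.1
  have hZfd : FiniteDimensional ℂ Z := Submodule.finiteDimensional_of_le hZN
  choose! T hTN hT using hmul v hv
  have hTZ : ∀ u ∈ N, T u ∈ Z := fun u hu => ⟨hTN u hu, by
    filter_upwards [hT u hu, hψ] with x h1 h2 h3
    rw [h3, zero_mul] at h1
    exact (mul_eq_zero.1 h1).resolve_right h2⟩
  have huniq : ∀ a ∈ N, ∀ b ∈ N, (∀ᵐ x ∂volume.restrict E,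
      a x * denom k α D h x = b x * denom k α D h x) → a = b := fun a ha b hb hab =>
    sub_eq_zero.1 (hzero _ (N.sub_mem ha hb) (by
      filter_upwards [hab, hψ] with x h1 h2
      change a x - b x = 0
      rw [sub_eq_zero]
      exact mul_right_cancel₀ h2 h1))
  let L : Z →ₗ[ℂ] Z :=
    { toFun := fun u => ⟨T u, hTZ _ (hZN u.2)⟩
      map_add' := fun a b => Subtype.ext <| huniq _ (hTN _ (hZN (a + b).2)) _
          (N.add_mem (hTN _ (hZN a.2)) (hTN _ (hZN b.2))) <| by
        filter_upwards [hT _ (hZN a.2), hT _ (hZN b.2), hT _ (hZN (a + b).2)] with x h1 h2 h3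
        rw [h3]
        change v x * ((a : E3 →ᵇ ℂ) x + (b : E3 →ᵇ ℂ) x) = (T a x + T b x) * _
        linear_combination -h1 - h2
      map_smul' := fun t a => Subtype.ext <| huniq _ (hTN _ (hZN (t • a).2)) _
          (N.smul_mem t (hTN _ (hZN a.2))) <| by
        filter_upwards [hT _ (hZN a.2), hT _ (hZN (t • a).2)] with x h1 h3
        rw [h3]
        change v x * (t * (a : E3 →ᵇ ℂ) x) = t * T a x * _
        linear_combination -t * h1 }
  have hLT : ∀ u : Z, ((L u : Z) : E3 →ᵇ ℂ) = T u := fun u => rfl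
  have hinj : Function.Injective L := by
    rw [← LinearMap.ker_eq_bot, LinearMap.ker_eq_bot']
    intro u hu
    refine Subtype.ext (hzero _ (hZN u.2) ?_)
    have hTu : T u = 0 := by rw [← hLT, hu]; rfl
    filter_upwards [hT _ (hZN u.2), u.2.2] with x h1 h2
    rw [hTu] at h1
    have h3 : v x * (u : E3 →ᵇ ℂ) x = 0 := by rw [← h1]; exact zero_mul _
    exact (mul_eq_zero.1 h3).elim h2 id
  obtain ⟨u, hu⟩ := LinearMap.injective_iff_surjective.1 hinj
    ⟨v, hv, Eventually.of_forall fun _ hx => hx⟩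
  have hTu : T u = v := by rw [← hLT, hu]
  have hval : ∀ᵐ x ∂volume.restrict E, (v x = 0 → (u : E3 →ᵇ ℂ) x = 0) ∧
      (v x ≠ 0 → (u : E3 →ᵇ ℂ) x = denom k α D h x) := by
    filter_upwards [hT _ (hZN u.2), u.2.2] with x h1 h2
    rw [hTu] at h1
    exact ⟨h2, fun h3 => (mul_left_cancel₀ h3 h1).symm⟩
  refine ⟨u, hZN u.2, fun hu0 => hv0 (hzero v hv ?_), ?_⟩
  · filter_upwards [hval, hψ] with x h1 h2
    by_contra h3
    have h4 := h1.2 h3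
    rw [hu0] at h4
    exact h2 h4.symm
  · filter_upwards [hval] with x h1
    by_cases h3 : v x = 0
    · exact Or.inl (h1.1 h3)
    · exact Or.inr (h1.2 h3)

/-- Infinitely many distinct multiples of one density cannot all have nonzero solutions with
values in `{0, ψ}`. -/
lemma false_of_idempotents (hk : 0 ≤ k) (hDm : MeasurableSet D) (hDb : Bornology.IsBounded D)
    (hE : MeasurableSet E) (hED : E ⊆ D) (hc : 0 < c) {l : ℕ → ℂ} (hl : Function.Injective l)
    (hh : ∀ n, IsAdmissible k α D E c M fun x => l n * h x)
    (hF : ∀ n, ∃ F ∈ homSol k D (quot k α D E fun x => l n * h x), F ≠ 0 ∧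
      ∀ᵐ x ∂volume.restrict E, F x = 0 ∨ F x = denom k α D (fun x => l n * h x) x) : False := by
  have hD : volume D ≠ ⊤ := hDb.measure_lt_top.ne
  have hM0 : 0 ≤ M := (hh 0).nonneg
  choose F hFN hF0 hFv using hF
  -- the densities `q F`
  have hqF : ∀ n x, F n x = -potential k D (fun y => l n * (if F n y = 0 then 0 else h y)) x := by
    intro n x
    rw [homSol_apply (hFN n) x]
    congr 1
    refine potential_congr ?_ x
    have := hFv n
    rw [ae_restrict_iff' hE] at this
    rw [EventuallyEq, ae_restrict_iff' hDm]
    filter_upwards [this] with y hy _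
    by_cases hyE : y ∈ E
    · rcases hy hyE with h1 | h1
      · rw [h1, if_pos rfl, mul_zero, mul_zero]
      · have h2 : F n y ≠ 0 := by rw [h1]; exact (hh n).denom_ne_zero hc hyE
        rw [if_neg h2, h1, (hh n).quot_mul_denom hc]
    · rw [(hh n).quot_eq_zero hyE, zero_mul]
      split_ifs
      · rw [mul_zero]
      · exact ((hh n).eq_zero y hyE).symm
  have hqb : ∀ n y, ‖l n * (if F n y = 0 then 0 else h y)‖ ≤ M := fun n y => by
    split_ifs
    · rw [mul_zero, norm_zero]; exact hM0
    · exact (hh n).norm_le y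
  have hqm : ∀ n, Measurable fun y => l n * (if F n y = 0 then 0 else h y) := fun n => by
    have : (fun y => l n * (if F n y = 0 then 0 else h y)) =
        fun y => if F n y = 0 then 0 else l n * h y := by
      funext y; split_ifs <;> simp
    rw [this]
    exact Measurable.ite ((F n).continuous.measurable (measurableSet_singleton 0))
      measurable_const (hh n).measurable
  have hLip : ∀ n x x', ‖F n x - F n x'‖ ≤ potConst k D * M * ‖x - x'‖ := fun n x x' => by
    rw [hqF n x, hqF n x', neg_sub_neg, norm_sub_rev]
    exact norm_potential_sub_le hk hD (hqm n).aestronglyMeasurable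
      (Eventually.of_forall (hqb n)) hM0 _ _
  have hP0 : 0 ≤ potConst k D := potConst_nonneg hk
  -- All `F n` share the Lipschitz constant `potConst k D * M`, so across a ball of radius `ρ` they
  -- vary by at most `c/2`, while almost everywhere on `E` a nonzero value has modulus at least `c`.
  -- The `+ 1` keeps the denominator positive.
  set ρ : ℝ := c / (4 * (potConst k D * M + 1)) with hρ
  have hρ0 : 0 < ρ := by positivity
  have hEt : TotallyBounded E :=
    hDb.isCompact_closure.totallyBounded.subset (hED.trans subset_closure)
  obtain ⟨t, htf, ht⟩ := (Metric.totallyBounded_iff.1 hEt) ρ hρ0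
  have := htf.to_subtype
  have hGood : ∀ n, ∀ᵐ x ∂volume.restrict E, F n x = 0 ∨ c ≤ ‖F n x‖ := fun n => by
    filter_upwards [hFv n, ae_restrict_mem hE] with x h1 hx
    refine h1.imp_right fun h2 => ?_
    rw [h2]
    exact (hh n).le_denom x hx
  -- on each small ball, `F n` is either zero or nonzero
  have hball : ∀ n z x x', x ∈ ball z ρ → x' ∈ ball z ρ → (F n x = 0 ∨ c ≤ ‖F n x‖) →
      F n x' = 0 → F n x = 0 := by
    intro n z x x' hx hx' h1 h2
    refine h1.resolve_right fun h3 => ?_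
    have h4 := hLip n x x'
    rw [h2, sub_zero] at h4
    have h5 : ‖x - x'‖ < 2 * ρ := by
      rw [← dist_eq_norm]
      calc dist x x' ≤ dist x z + dist x' z := dist_triangle_right _ _ _
        _ < 2 * ρ := by linarith [mem_ball.1 hx, mem_ball.1 hx']
    have h6 : potConst k D * M * ‖x - x'‖ ≤ (potConst k D * M + 1) * (2 * ρ) := by
      gcongr
      linarith
    have h7 : (potConst k D * M + 1) * (2 * ρ) = c / 2 := by
      rw [hρ]; field_simp; norm_num
    linarith
  set S : ℕ → Set t := fun n => {z | ∃ x ∈ ball (z : E3) ρ, c ≤ ‖F n x‖} with hS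
  -- Finitely many balls cover `E`, so there are finitely many zero patterns for infinitely many
  -- indices.
  obtain ⟨i, j, hij, hSij⟩ := Finite.exists_ne_map_eq_of_infinite S
  have himp : ∀ i j, S i = S j → ∀ᵐ x ∂volume.restrict E, F i x ≠ 0 → F j x ≠ 0 := by
    intro i j hS'
    filter_upwards [hGood i, ae_restrict_mem hE] with x h1 hx h3 h4
    obtain ⟨z, hz, hxz⟩ := mem_iUnion₂.1 (ht hx)
    have hzS : (⟨z, hz⟩ : t) ∈ S j := hS' ▸ ⟨x, hxz, h1.resolve_left h3⟩
    obtain ⟨x', hx', h5⟩ := hzS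
    have h6 := hball j z x' x hx' hxz (Or.inr h5) h4
    rw [h6, norm_zero] at h5
    linarith
  have hsupp : ∀ᵐ x ∂volume.restrict E, F i x = 0 ↔ F j x = 0 := by
    filter_upwards [himp i j hSij, himp j i hSij.symm] with x h1 h2
    exact ⟨fun h => by_contra fun h' => h2 h' h, fun h => by_contra fun h' => h1 h' h⟩
  set g : E3 → ℂ := fun y => if F i y = 0 then 0 else h y with hg
  have hΦi : ∀ x, F i x = -(l i * potential k D g x) := fun x => by
    rw [hqF i x, potential_const_mul]
  have hΦj : ∀ x, F j x = -(l j * potential k D g x) := fun x => by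
    rw [hqF j x, potential_const_mul]
    congr 2
    refine potential_congr ?_ x
    rw [ae_restrict_iff' hE] at hsupp
    rw [EventuallyEq, ae_restrict_iff' hDm]
    filter_upwards [hsupp] with y hy _
    by_cases hyE : y ∈ E
    · simp only [hg, hy hyE]
    · have e : ∀ n, l n * h y = 0 := fun n => (hh n).eq_zero y hyE
      have e2 : h y = 0 := by
        by_contra hne
        exact hij (hl (((mul_eq_zero.1 (e i)).resolve_right hne).trans
          ((mul_eq_zero.1 (e j)).resolve_right hne).symm))
      simp only [hg, e2, ite_self]
  have hex : ∃ x, F i x ≠ 0 ∧ F i x = denom k α D (fun x => l i * h x) x ∧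
      F j x = denom k α D (fun x => l j * h x) x := by
    by_contra hne
    push Not at hne
    refine hF0 i (eq_zero_of_ae_eq_zero hDm hE (fun x hx => (hh i).quot_eq_zero hx)
      (hFN i) ?_)
    filter_upwards [hFv i, hFv j, hsupp] with x h1 h2 h3
    by_contra h4
    exact hne x h4 (h1.resolve_left h4) (h2.resolve_left fun h5 => h4 (h3.2 h5))
  obtain ⟨x, -, h2, h3⟩ := hex
  rw [hΦi, denom_eq, potential_const_mul] at h2
  rw [hΦj, denom_eq, potential_const_mul] at h3
  -- At `x` both equations read `-l G g = u₀ - l G h`, with the same `g`. Subtracting forces `G h =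
  -- G g` at `x`, and then `u₀` would vanish there.
  have h4 : (l i - l j) * (potential k D h x - potential k D g x) = 0 := by
    linear_combination h2 - h3
  have h5 := (mul_eq_zero.1 h4).resolve_left (sub_ne_zero.2 fun he => hij (hl he))
  have h6 : planeWave k α x = 0 := by linear_combination -h2 + l i * h5
  exact Complex.exp_ne_zero _ h6

/-- Every admissible density is a uniform limit of admissible densities whose potential has no
nonzero homogeneous solution. -/
lemma exists_homSol_eq_bot (hk : 0 ≤ k) (hDm : MeasurableSet D) (hDb : Bornology.IsBounded D)
    (hE : MeasurableSet E) (hED : E ⊆ D) (hc : 0 < c) (hh : IsAdmissible k α D E c M h)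
    {δ : ℝ} (hδ : 0 < δ) :
    ∃ h' : E3 → ℂ, (∀ x, ‖h' x - h x‖ ≤ δ) ∧ IsAdmissible k α D E (c / 2) (M + δ) h' ∧
      homSol k D (quot k α D E h') = ⊥ := by
  have hD : volume D ≠ ⊤ := hDb.measure_lt_top.ne
  have hP0 : 0 ≤ potConst k D := potConst_nonneg hk
  have hM0 := hh.nonneg
  -- shrink `δ`
  set d : ℝ := min δ (c / (2 * (potConst k D + 1))) with hd
  have hd0 : 0 < d := by positivity
  have hPd : potConst k D * d ≤ c / 2 := by
    calc potConst k D * d ≤ (potConst k D + 1) * (c / (2 * (potConst k D + 1))) := by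
          gcongr
          · linarith
          · exact min_le_right _ _
      _ = c / 2 := by field_simp
  by_contra hcon
  push Not at hcon
  -- The strict inequality `d' < d` makes `U` open under small multiples of any bounded direction;
  -- minimality of the nullity is needed at perturbed points too.
  set U : Set (E3 → ℂ) := {h' | Measurable h' ∧ (∀ x ∉ E, h' x = 0) ∧
    ∃ d' < d, ∀ x, ‖h' x - h x‖ ≤ d'} with hU
  have hUA : ∀ h' ∈ U, IsAdmissible k α D E (c / 2) (M + δ) h' := by
    rintro h' ⟨h1, h2, d', hd', h3⟩
    refine (hh.of_norm_sub_le hk hD h1 h2 fun x => (h3 x).trans hd'.le).mono (by linarith) ?_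
    linarith [min_le_left δ (c / (2 * (potConst k D + 1)))]
  have hUne : ∀ h' ∈ U, homSol k D (quot k α D E h') ≠ ⊥ := by
    intro h' hh'
    refine hcon h' (fun x => ?_) (hUA h' hh')
    obtain ⟨_, _, d', hd', h3⟩ := hh'
    exact (h3 x).trans (hd'.le.trans (min_le_left _ _))
  have hhU : h ∈ U := ⟨hh.measurable, hh.eq_zero, 0, hd0, fun x => by rw [sub_self, norm_zero]⟩
  have hpert : ∀ h₁ ∈ U, ∀ (η : E3 → ℂ) (B : ℝ), Measurable η → (∀ x, ‖η x‖ ≤ B) →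
      (∀ x ∉ E, η x = 0) → ∃ s₀ : ℝ, 0 < s₀ ∧ ∀ s : ℝ, 0 < s → s < s₀ →
        (fun x => h₁ x + (s : ℂ) * η x) ∈ U := by
    rintro h₁ ⟨h1, h2, d', hd', h3⟩ η B hη hηB hηE
    have hB0 : 0 ≤ B := (norm_nonneg _).trans (hηB 0)
    refine ⟨(d - d') / (2 * (B + 1)), div_pos (by linarith) (by positivity), fun s hs0 hs => ?_⟩
    refine ⟨h1.add (hη.const_mul _), fun x hx => ?_, d' + s * B, ?_, fun x => ?_⟩
    · change h₁ x + (s : ℂ) * η x = 0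
      rw [h2 x hx, hηE x hx, mul_zero, add_zero]
    · have : s * (B + 1) ≤ (d - d') / (2 * (B + 1)) * (B + 1) := by gcongr
      have e : (d - d') / (2 * (B + 1)) * (B + 1) = (d - d') / 2 := by field_simp
      rw [e] at this
      linarith
    · rw [add_sub_right_comm]
      refine (norm_add_le _ _).trans (add_le_add (h3 x) (norm_mul_bound ?_ (hηB x)))
      rw [Complex.norm_real, Real.norm_of_nonneg hs0.le]
  -- a density of minimal nullity
  obtain ⟨h₁, hh₁, hmin⟩ : ∃ h₁ ∈ U, ∀ h' ∈ U,
      Module.finrank ℂ (homSol k D (quot k α D E h₁)) ≤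
        Module.finrank ℂ (homSol k D (quot k α D E h')) := by
    obtain ⟨h₁, h1, h2⟩ := (InvImage.wf (fun h' : E3 → ℂ =>
      Module.finrank ℂ (homSol k D (quot k α D E h'))) Nat.lt_wfRel.wf).has_min U ⟨h, hhU⟩
    exact ⟨h₁, h1, fun h' hh' => not_lt.1 (h2 h' hh')⟩
  have hA₁ := hUA h₁ hh₁
  have hc2 : 0 < c / 2 := by positivity
  have hfd : ∀ h' ∈ U, FiniteDimensional ℂ (homSol k D (quot k α D E h')) := fun h' hh' =>
    finiteDimensional_homSol hk hDm hDb ((hUA h' hh').measurable_quot hk hD hE)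
      ((hUA h' hh').norm_quot_le hc2)
  -- multiples of `h₁`
  obtain ⟨s₀, hs₀, hs⟩ := hpert h₁ hh₁ h₁ (M + δ) hA₁.measurable hA₁.norm_le hA₁.eq_zero
  set t : ℕ → ℝ := fun n => s₀ / 2 * (1 / ((n : ℝ) + 1)) with ht
  have ht0 : ∀ n, 0 < t n := fun n => by positivity
  have htl : ∀ n, t n < s₀ := fun n => by
    have : 1 / ((n : ℝ) + 1) ≤ 1 := by
      rw [div_le_one (by positivity)]; linarith [n.cast_nonneg (α := ℝ)]
    calc t n ≤ s₀ / 2 * 1 := mul_le_mul_of_nonneg_left this (by positivity)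
      _ < s₀ := by linarith
  have htlim : Tendsto t atTop (𝓝 0) := by
    have := (tendsto_one_div_add_atTop_nhds_zero_nat (𝕜 := ℝ)).const_mul (s₀ / 2)
    rwa [mul_zero] at this
  have htinj : Function.Injective t := fun a b hab => by
    have h1 := mul_left_cancel₀ (by positivity) hab
    have h2 : ((a : ℝ) + 1) = (b : ℝ) + 1 := by
      have := congrArg (fun z : ℝ => z⁻¹) h1
      simpa using this
    exact_mod_cast add_right_cancel h2
  set l : ℕ → ℂ := fun n => 1 + (t n : ℂ) with hl
  have hlU : ∀ n, (fun x => l n * h₁ x) ∈ U := fun n => by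
    have := hs (t n) (ht0 n) (htl n)
    have e : (fun x => l n * h₁ x) = fun x => h₁ x + (t n : ℂ) * h₁ x := by
      funext x; simp only [hl]; ring
    rwa [e]
  -- along a subsequence of the multiples the nullity is minimal
  obtain ⟨n₀, hn₀⟩ : ∃ n₀, ∀ n ≥ n₀,
      Module.finrank ℂ (homSol k D (quot k α D E fun x => l n * h₁ x)) =
        Module.finrank ℂ (homSol k D (quot k α D E h₁)) := by
    -- Upper semicontinuity of the nullity: if it were larger infinitely often, a limit of solutions
    -- would be a solution for `h₁` outside the solution space of `h₁`.
    by_contra hno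
    push Not at hno
    have hfreq : ∃ᶠ n in atTop,
        Module.finrank ℂ (homSol k D (quot k α D E fun x => l n * h₁ x)) ≠
          Module.finrank ℂ (homSol k D (quot k α D E h₁)) :=
      frequently_atTop.2 hno
    obtain ⟨φ, hφ, hφn⟩ := extraction_of_frequently_atTop hfreq
    have := hfd h₁ hh₁
    obtain ⟨_, _, u, _, _, hu, _, huY⟩ := exists_limit_notMem hk hDm hDb
      (qs := fun n => quot k α D E fun x => l (φ n) * h₁ x)
      (fun n => (hUA _ (hlU (φ n))).measurable_quot hk hD hE) (hA₁.measurable_quot hk hD hE)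
      (fun n => (hUA _ (hlU (φ n))).norm_quot_le hc2) (hA₁.norm_quot_le hc2)
      (δ := fun n => (c / 2)⁻¹ * (t (φ n) * (M + δ)) + (M + δ) * ((c / 2)⁻¹ * (c / 2)⁻¹ *
        (potConst k D * (t (φ n) * (M + δ)))))
      (by
        have h1 : Tendsto (fun n => t (φ n) * (M + δ)) atTop (𝓝 0) := by
          have := (htlim.comp hφ.tendsto_atTop).mul_const (M + δ)
          rwa [zero_mul] at this
        simpa using (h1.const_mul (c / 2)⁻¹).add
          (((h1.const_mul (potConst k D)).const_mul ((c / 2)⁻¹ * (c / 2)⁻¹)).const_mul (M + δ)))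
      (fun n y => by
        refine hA₁.norm_quot_sub_le hc2 hk hD (hUA _ (hlU (φ n))) (fun y => ?_) y
        have e : l (φ n) * h₁ y - h₁ y = (t (φ n) : ℂ) * h₁ y := by simp only [hl]; ring
        rw [e]
        refine norm_mul_bound ?_ (hA₁.norm_le y)
        rw [Complex.norm_real, Real.norm_of_nonneg (ht0 _).le])
      (homSol k D (quot k α D E h₁))
      (fun n => lt_of_le_of_ne (hmin _ (hlU (φ n))) (hφn n).symm)
    exact huY hu
  refine false_of_idempotents hk hDm hDb hE hED hc2 (l := fun n => l (n + n₀)) (h := h₁)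
    (fun a b hab => ?_) (fun n => hUA _ (hlU _)) (fun n => ?_)
  · have h1 : (t (a + n₀) : ℂ) = t (b + n₀) := add_left_cancel hab
    exact Nat.add_right_cancel (htinj (Complex.ofReal_injective h1))
  · have hAn := hUA _ (hlU (n + n₀))
    refine exists_idempotent hk hDm hDb hE hc2 hAn (hUne _ (hlU _)) fun v hv w hw => ?_
    refine exists_mul_mem_homSol hk hDm hDb hE hED hc2 hAn (fun η B hη hηB hηE => ?_) hv hw
    obtain ⟨s₁, hs₁, hs1⟩ := hpert _ (hlU (n + n₀)) η B hη hηB hηE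
    refine ⟨s₁, hs₁, fun s hs0 hss => ⟨hUA _ (hs1 s hs0 hss), ?_⟩⟩
    rw [hn₀ _ (Nat.le_add_left _ _)]
    exact hmin _ (hs1 s hs0 hss)

end GenericUniqueness


/-! ### Keeping `ψ` away from zero by a multiplier and a small cut. -/

section LowerBound

variable {k : ℝ} {α : S2} {D : Set E3} {M : ℝ} {h : E3 → ℂ}

lemma norm_planeWave (k : ℝ) (α : S2) (x : E3) : ‖planeWave k α x‖ = 1 := by
  rw [planeWave, mul_comm, Complex.norm_exp_ofReal_mul_I]

/-- A bounded density can be multiplied by a constant near one and cut off on a small set so that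
the denominator is bounded away from zero on the remaining set. -/
lemma exists_isAdmissible_indicator (hk : 0 ≤ k) (α : S2) (hDm : MeasurableSet D)
    (hD : volume D ≠ ⊤)
    (hh : Measurable h) (hM : ∀ x, ‖h x‖ ≤ M) {ε : ℝ} (hε : 0 < ε) (hε1 : ε ≤ 1) :
    ∃ (l : ℂ) (B : Set E3) (c : ℝ), MeasurableSet B ∧ B ⊆ D ∧ ‖l - 1‖ ≤ ε ∧
      volume.real B ≤ ε ∧ 0 < c ∧
      IsAdmissible k α D (D \ B) c (2 * M) fun x => l * (D \ B).indicator h x := by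
  have hM0 : 0 ≤ M := (norm_nonneg _).trans (hM 0)
  have hfin : IsFiniteMeasure (volume.restrict D) := ⟨by
    rw [Measure.restrict_apply_univ]; exact hD.lt_top⟩
  set V := volume.real D with hV
  have hV0 : 0 ≤ V := measureReal_nonneg
  obtain ⟨m, hm⟩ := exists_nat_ge ((32 * M * (4 * Real.pi + V) + V) / ε + 1)
  have hq0 : 0 ≤ (32 * M * (4 * Real.pi + V) + V) / ε := by positivity
  have hm1 : (1 : ℝ) ≤ m := by linarith
  have hm0 : (0 : ℝ) < m := by linarith
  have hmε : 32 * M * (4 * Real.pi + V) + V ≤ ε * m := by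
    have : (32 * M * (4 * Real.pi + V) + V) / ε ≤ m := by linarith
    rw [div_le_iff₀ hε] at this
    linarith
  -- The grid has `n²` multipliers with spacing of order `1/n`, so one exceptional set has measure
  -- at most `V/n² = V/m⁶`. With radius `m⁻²` its potential is `O(m⁻⁴)`, below `c`, which is of
  -- order `m⁻³`. A real one-parameter family would give only measure `V/n`, too much for this
  -- estimate; the cube makes the best radius a power of `m`.
  set n := m ^ 3 with hn
  have hnm : (n : ℝ) = (m : ℝ) ^ 3 := by rw [hn]; push_cast; rfl
  have hn0 : (0 : ℝ) < n := by rw [hnm]; positivity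
  have hnpos : 0 < n := by exact_mod_cast hn0
  set s := ε / (2 * n) with hs
  have hs0 : 0 < s := by positivity
  set l : Fin n × Fin n → ℂ := fun p => ⟨1 + (p.1 : ℕ) * s, (p.2 : ℕ) * s⟩ with hl
  have hl1 : ∀ p, ‖l p - 1‖ ≤ ε := fun p => by
    refine (Complex.norm_le_abs_re_add_abs_im _).trans ?_
    have h1 : ((p.1 : ℕ) : ℝ) * s ≤ n * s := by
      have : ((p.1 : ℕ) : ℝ) ≤ n := by exact_mod_cast p.1.2.le
      gcongr
    have h2 : ((p.2 : ℕ) : ℝ) * s ≤ n * s := by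
      have : ((p.2 : ℕ) : ℝ) ≤ n := by exact_mod_cast p.2.2.le
      gcongr
    have h3 : n * s = ε / 2 := by rw [hs]; field_simp
    simp only [hl, Complex.sub_re, Complex.sub_im, Complex.one_re, Complex.one_im,
      add_sub_cancel_left, sub_zero]
    rw [abs_of_nonneg (by positivity), abs_of_nonneg (by positivity)]
    linarith
  have hl2 : ∀ p, ‖l p‖ ≤ 2 := fun p => by
    have := norm_le_norm_add_norm_sub' (l p) 1
    rw [norm_one] at this
    linarith [hl1 p]
  have hlsep : ∀ p p', p ≠ p' → s ≤ ‖l p - l p'‖ := fun p p' hpp => by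
    have hnat : ∀ a b : ℕ, a ≠ b → s ≤ |(a : ℝ) * s - b * s| := fun a b hab => by
      rw [← sub_mul, abs_mul, abs_of_pos hs0]
      have : (1 : ℝ) ≤ |(a : ℝ) - b| := by
        have h1 : (1 : ℤ) ≤ |(a : ℤ) - b| := Int.one_le_abs (sub_ne_zero.2 (by exact_mod_cast hab))
        exact_mod_cast h1
      nlinarith
    by_cases h1 : p.1 = p'.1
    · have h2 : p.2 ≠ p'.2 := fun h2 => hpp (Prod.ext h1 h2)
      refine le_trans ?_ (Complex.abs_im_le_norm _)
      rw [Complex.sub_im]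
      exact hnat _ _ fun h3 => h2 (Fin.ext h3)
    · refine le_trans ?_ (Complex.abs_re_le_norm _)
      rw [Complex.sub_re]
      simp only [hl, add_sub_add_left_eq_sub]
      exact hnat _ _ fun h3 => h1 (Fin.ext h3)
  -- At a common point of two exceptional sets, `|u₀| = 1` and `|l| ≤ 2` would give `|l - l'| < 2·2c
  -- + 2·2c = s`, against the separation.
  set c := s / 8 with hc
  have hc0 : 0 < c := by positivity
  have hGc : Continuous (potential k D h) :=
    continuous_potential_of_bounded hk hD hh.aestronglyMeasurable (Eventually.of_forall hM) hM0
  set B : Fin n × Fin n → Set E3 := fun p =>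
    D ∩ {x | ‖planeWave k α x - l p * potential k D h x‖ < 2 * c} with hB
  have hBm : ∀ p, MeasurableSet (B p) := fun p =>
    hDm.inter (measurableSet_lt ((contDiff_planeWave k α).continuous.sub
      (continuous_const.mul hGc)).norm.measurable measurable_const)
  have hBD : ∀ p, B p ⊆ D := fun p => inter_subset_left
  have hdisj : (↑(Finset.univ : Finset (Fin n × Fin n)) : Set (Fin n × Fin n)).PairwiseDisjoint
      B := by
    intro p _ p' _ hpp
    refine Set.disjoint_left.2 fun x hx hx' => ?_
    have h1 := hx.2
    have h2 := hx'.2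
    simp only [mem_ofPred_eq] at h1 h2
    have e : (l p - l p') * planeWave k α x =
        l p * (planeWave k α x - l p' * potential k D h x) -
          l p' * (planeWave k α x - l p * potential k D h x) := by ring
    have h3 : ‖(l p - l p') * planeWave k α x‖ = ‖l p - l p'‖ := by
      rw [norm_mul, norm_planeWave, mul_one]
    rw [e] at h3
    have h4 := norm_sub_le (l p * (planeWave k α x - l p' * potential k D h x))
      (l p' * (planeWave k α x - l p * potential k D h x))
    rw [norm_mul, norm_mul] at h4
    have h5 : ‖l p‖ * ‖planeWave k α x - l p' * potential k D h x‖ ≤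
        2 * ‖planeWave k α x - l p' * potential k D h x‖ := by
      have := hl2 p
      gcongr
    have h6 : ‖l p'‖ * ‖planeWave k α x - l p * potential k D h x‖ ≤
        2 * ‖planeWave k α x - l p * potential k D h x‖ := by
      have := hl2 p'
      gcongr
    have h7 := hlsep p p' hpp
    linarith
  have hsum : ∑ p, volume.real (B p) ≤ ∑ _p : Fin n × Fin n, V / (n : ℝ) ^ 2 := by
    have h1 := sum_measureReal_le_measureReal_univ (μ := volume.restrict D)
      (fun p _ => hBm p) hdisj
    have h2 : (volume.restrict D).real univ = V := by
      rw [measureReal_restrict_apply_univ]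
    have h3 : ∀ p, (volume.restrict D).real (B p) = volume.real (B p) := fun p => by
      rw [measureReal_restrict_apply (hBm p), inter_eq_left.2 (hBD p)]
    simp_rw [h3] at h1
    rw [h2] at h1
    refine h1.trans (le_of_eq ?_)
    rw [Finset.sum_const, Finset.card_univ, Fintype.card_prod, Fintype.card_fin, nsmul_eq_mul]
    push_cast
    field_simp
  have hne : (Finset.univ : Finset (Fin n × Fin n)).Nonempty :=
    ⟨(⟨0, hnpos⟩, ⟨0, hnpos⟩), Finset.mem_univ _⟩
  obtain ⟨p, -, hp⟩ := Finset.exists_le_of_sum_le hne hsum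
  have hBV : volume.real (B p) ≤ V / (m : ℝ) ^ 6 := by
    rw [hnm] at hp
    calc _ ≤ _ := hp
      _ = _ := by rw [← pow_mul]
  refine ⟨l p, B p, c, hBm p, hBD p, hl1 p, ?_, hc0, ?_⟩
  · refine hBV.trans ((div_le_div_of_nonneg_left hV0 hm0 (le_self_pow₀ hm1 (by norm_num))).trans ?_)
    rw [div_le_iff₀ hm0]
    have : 0 ≤ 32 * M * (4 * Real.pi + V) := by positivity
    linarith
  · have hb : ∀ x, ‖l p * (D \ B p).indicator h x‖ ≤ 2 * M := fun x =>
      norm_mul_bound (hl2 p) ((norm_indicator_le_norm_self _ _).trans (hM x))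
    refine ⟨(hh.indicator (hDm.diff (hBm p))).const_mul _, hb, fun x hx => ?_, fun x hx => ?_⟩
    · rw [indicator_of_notMem hx, mul_zero]
    · -- the part cut off contributes at most `c`
      have hcut : ‖potential k (B p) (fun y => l p * h y) x‖ ≤ c := by
        have hBfin : volume (B p) ≠ ⊤ := ((measure_mono (hBD p)).trans_lt hD.lt_top).ne
        refine (norm_potential_le k hBfin (M := 2 * M) (Eventually.of_forall fun y =>
          norm_mul_bound (hl2 p) (hM y)) x (r := 1 / (m : ℝ) ^ 2) (by positivity)
          (by positivity)).trans ?_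
        calc (4 * Real.pi * (1 / (m : ℝ) ^ 2) ^ 2 + volume.real (B p) / (1 / (m : ℝ) ^ 2)) * (2 * M)
            ≤ (4 * Real.pi * (1 / (m : ℝ) ^ 2) ^ 2 + V / (m : ℝ) ^ 6 / (1 / (m : ℝ) ^ 2)) *
              (2 * M) := by gcongr
          _ = (32 * M * (4 * Real.pi + V)) / (16 * (m : ℝ) ^ 4) := by field_simp; ring
          _ ≤ (ε * m) / (16 * (m : ℝ) ^ 4) :=
              div_le_div_of_nonneg_right (by linarith) (by positivity)
          _ = c := by rw [hc, hs, hnm]; field_simp; norm_num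
      have hsplit : potential k D (fun y => l p * (D \ B p).indicator h y) x =
          l p * potential k D h x - potential k (B p) (fun y => l p * h y) x := by
        have hint : IntegrableOn (fun y => green k x y * (l p * h y)) D :=
          integrable_green_mul k hD (hh.const_mul _).aestronglyMeasurable
            (Eventually.of_forall fun y => norm_mul_bound (hl2 p) (hM y)) x
        rw [← potential_const_mul]
        unfold potential
        rw [eq_sub_iff_add_eq, ← integral_indicator hDm, ← integral_indicator hDm,
          ← integral_indicator (hBm p), ← integral_add]
        · congr 1; ext y
          by_cases hy : y ∈ D
          · by_cases hyB : y ∈ B p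
            · have : y ∉ D \ B p := fun h => h.2 hyB
              simp [hy, hyB]
            · simp [hy, hyB]
          · have hyB : y ∉ B p := fun h => hy (hBD p h)
            simp [hy, hyB]
        · rw [integrable_indicator_iff hDm]
          exact integrable_green_mul k hD ((hh.indicator
            (hDm.diff (hBm p))).const_mul _).aestronglyMeasurable (Eventually.of_forall hb) x
        · rw [integrable_indicator_iff (hBm p)]
          exact hint.mono_set (hBD p)
      rw [denom_eq, hsplit]
      have hx2 : 2 * c ≤ ‖planeWave k α x - l p * potential k D h x‖ := by
        by_contra hlt
        exact hx.2 ⟨hx.1, not_le.1 hlt⟩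
      have e : planeWave k α x - (l p * potential k D h x -
          potential k (B p) (fun y => l p * h y) x) =
          (planeWave k α x - l p * potential k D h x) -
            (-potential k (B p) (fun y => l p * h y) x) := by ring
      rw [e]
      have h8 := norm_sub_norm_le (planeWave k α x - l p * potential k D h x)
        (-potential k (B p) (fun y => l p * h y) x)
      rw [norm_neg] at h8
      linarith

/-- A bounded density can be approximated in `L²(D)` by admissible densities whose potential has
no nonzero homogeneous solution. -/
lemma exists_isAdmissible_homSol_eq_bot (hk : 0 ≤ k) (α : S2) (hDm : MeasurableSet D)
    (hDb : Bornology.IsBounded D) (hh : Measurable h) (hM : ∀ x, ‖h x‖ ≤ M) {τ : ℝ≥0∞}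
    (hτ : 0 < τ) :
    ∃ (E : Set E3) (c M' : ℝ) (h' : E3 → ℂ), MeasurableSet E ∧ E ⊆ D ∧ 0 < c ∧
      IsAdmissible k α D E c M' h' ∧ homSol k D (quot k α D E h') = ⊥ ∧
      eLpNorm (h' - h) 2 (volume.restrict D) < τ := by
  have hD : volume D ≠ ⊤ := hDb.measure_lt_top.ne
  have hM0 : 0 ≤ M := (norm_nonneg _).trans (hM 0)
  have hfin : IsFiniteMeasure (volume.restrict D) := ⟨by
    rw [Measure.restrict_apply_univ]; exact hD.lt_top⟩
  set a : ℝ≥0∞ := (volume.restrict D) univ ^ (2 : ℝ≥0∞).toReal⁻¹ with ha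
  have ha_top : a ≠ ⊤ := ENNReal.rpow_ne_top_of_nonneg (by positivity) (measure_ne_top _ _)
  -- The three terms account for the final uniform perturbation, for the multiplier `l ≠ 1`, and for
  -- the density removed on `B`.
  have hlim : Tendsto (fun n : ℕ => a * ENNReal.ofReal (1 / ((n : ℝ) + 1)) +
      (a * ENNReal.ofReal (1 / ((n : ℝ) + 1) * M) +
      ‖(M : ℂ)‖ₑ * ENNReal.ofReal (1 / ((n : ℝ) + 1)) ^ (1 / (2 : ℝ≥0∞).toReal))) atTop (𝓝 0) := by
    have h0 := tendsto_one_div_add_atTop_nhds_zero_nat (𝕜 := ℝ)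
    have h1 : Tendsto (fun n : ℕ => ENNReal.ofReal (1 / ((n : ℝ) + 1))) atTop (𝓝 0) := by
      have := ENNReal.tendsto_ofReal h0
      rwa [ENNReal.ofReal_zero] at this
    have h2 : Tendsto (fun n : ℕ => ENNReal.ofReal (1 / ((n : ℝ) + 1) * M)) atTop (𝓝 0) := by
      have := ENNReal.tendsto_ofReal (h0.mul_const M)
      rwa [zero_mul, ENNReal.ofReal_zero] at this
    have h3 : Tendsto (fun n : ℕ => ENNReal.ofReal (1 / ((n : ℝ) + 1)) ^
        (1 / (2 : ℝ≥0∞).toReal)) atTop (𝓝 0) := by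
      have := h1.ennrpow_const (1 / (2 : ℝ≥0∞).toReal)
      rwa [ENNReal.zero_rpow_of_pos (by norm_num)] at this
    have := (ENNReal.Tendsto.const_mul h1 (Or.inr ha_top)).add
      ((ENNReal.Tendsto.const_mul h2 (Or.inr ha_top)).add
        (ENNReal.Tendsto.const_mul h3 (Or.inr (enorm_ne_top (x := (M : ℂ))))))
    simpa using this
  obtain ⟨n, hn⟩ := (hlim.eventually (gt_mem_nhds hτ)).exists
  set ε : ℝ := 1 / ((n : ℝ) + 1) with hε
  have hε0 : 0 < ε := by positivity
  have hε1 : ε ≤ 1 := by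
    rw [hε, div_le_one (by positivity)]; linarith [n.cast_nonneg (α := ℝ)]
  obtain ⟨l, B, c, hBm, hBD, hl, hBε, hc, hA⟩ :=
    exists_isAdmissible_indicator hk α hDm hD hh hM hε0 hε1
  have hE : MeasurableSet (D \ B) := hDm.diff hBm
  obtain ⟨h', hh', hA', hbot⟩ := exists_homSol_eq_bot hk hDm hDb hE sdiff_subset hc hA hε0
  refine ⟨D \ B, c / 2, _, h', hE, sdiff_subset, by positivity, hA', hbot, lt_of_le_of_lt ?_ hn⟩
  set h1 : E3 → ℂ := fun x => l * (D \ B).indicator h x with hh1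
  set g1 : E3 → ℂ := fun x => (l - 1) * (D \ B).indicator h x with hg1
  have hg1m : Measurable g1 := (hh.indicator hE).const_mul _
  have e1 : h' - h =ᵐ[volume.restrict D] (h' - h1) + (g1 - B.indicator h) := by
    filter_upwards [ae_restrict_mem hDm] with x hx
    simp only [Pi.sub_apply, Pi.add_apply, hh1, hg1]
    by_cases hxB : x ∈ B
    · simp [hxB, sub_eq_add_neg]
    · have : x ∈ D \ B := ⟨hx, hxB⟩
      rw [indicator_of_mem this, indicator_of_notMem hxB]
      ring
  rw [eLpNorm_congr_ae e1]
  refine (eLpNorm_add_le (hA'.measurable.sub hA.measurable).aestronglyMeasurable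
    (hg1m.sub (hh.indicator hBm)).aestronglyMeasurable (by norm_num)).trans ?_
  refine add_le_add (eLpNorm_le_of_ae_bound (Eventually.of_forall hh')) ?_
  refine (eLpNorm_sub_le hg1m.aestronglyMeasurable (hh.indicator hBm).aestronglyMeasurable
    (by norm_num)).trans (add_le_add ?_ ?_)
  · refine eLpNorm_le_of_ae_bound (Eventually.of_forall fun x => ?_)
    exact norm_mul_bound hl ((norm_indicator_le_norm_self _ _).trans (hM x))
  · calc eLpNorm (B.indicator h) 2 (volume.restrict D)
        ≤ eLpNorm (B.indicator fun _ => (M : ℂ)) 2 (volume.restrict D) := by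
          refine eLpNorm_mono fun x => ?_
          by_cases hx : x ∈ B
          · rw [indicator_of_mem hx, indicator_of_mem hx, Complex.norm_real,
              Real.norm_of_nonneg hM0]
            exact hM x
          · rw [indicator_of_notMem hx, indicator_of_notMem hx]
      _ ≤ ‖(M : ℂ)‖ₑ * (volume.restrict D) B ^ (1 / (2 : ℝ≥0∞).toReal) :=
          eLpNorm_indicator_const_le _ _
      _ ≤ _ := by
          gcongr
          refine (Measure.restrict_apply_le _ _).trans ?_
          have hBfin : volume B ≠ ⊤ := ((measure_mono hBD).trans_lt hD.lt_top).ne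
          rw [← ENNReal.ofReal_toReal hBfin]
          exact ENNReal.ofReal_le_ofReal hBε

end LowerBound


/-! ### Superpositions of plane waves and their injectivity. -/

section FarFieldDensity

variable {k : ℝ} {D : Set E3}

/-- The superposition of plane waves with density `F` on the sphere. -/
noncomputable def herglotz (k : ℝ) (F : S2 → ℂ) (x : E3) : ℂ :=
  ∫ β, Complex.exp (Complex.I * ((k * ⟪(β : E3), x⟫_ℝ : ℝ) : ℂ)) * F β ∂surf

lemma norm_exp_I_inner (k : ℝ) (β x : E3) :
    ‖Complex.exp (Complex.I * ((k * ⟪β, x⟫_ℝ : ℝ) : ℂ))‖ = 1 := by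
  rw [mul_comm, Complex.norm_exp_ofReal_mul_I]

lemma integrable_exp_inner_mul {F : S2 → ℂ} (hF : Integrable F surf) (x : E3) :
    Integrable (fun β : S2 =>
      Complex.exp (Complex.I * ((k * ⟪(β : E3), x⟫_ℝ : ℝ) : ℂ)) * F β) surf :=
  hF.bdd_mul (c := 1) (Continuous.aestronglyMeasurable (by fun_prop))
    (Eventually.of_forall fun β => (norm_exp_I_inner k β x).le)

lemma continuous_herglotz {F : S2 → ℂ} (hF : Integrable F surf) : Continuous (herglotz k F) := by
  unfold herglotz
  refine continuous_of_dominated (bound := fun β => ‖F β‖) ?_ ?_ hF.norm ?_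
  · exact fun x => (integrable_exp_inner_mul hF x).1
  · exact fun x => Eventually.of_forall fun β => by rw [norm_mul, norm_exp_I_inner, one_mul]
  · exact Eventually.of_forall fun β => by fun_prop

lemma norm_herglotz_le {F : S2 → ℂ} (x : E3) : ‖herglotz k F x‖ ≤ ∫ β, ‖F β‖ ∂surf := by
  refine (norm_integral_le_integral_norm _).trans (le_of_eq ?_)
  congr 1; ext β; rw [norm_mul, norm_exp_I_inner, one_mul]

/-- Along complex lines, the superposition is an entire function. -/
lemma differentiable_integral_exp (k : ℝ) {G : S2 → ℂ} (hG : Integrable G surf) (y : E3) :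
    Differentiable ℂ fun z : ℂ =>
      ∫ β, Complex.exp (z * (Complex.I * ((k * ⟪(β : E3), y⟫_ℝ : ℝ) : ℂ))) * G β ∂surf := by
  intro z₀
  set a : S2 → ℂ := fun β => Complex.I * ((k * ⟪(β : E3), y⟫_ℝ : ℝ) : ℂ) with ha
  have hac : Continuous a := by fun_prop
  have hab : ∀ β, ‖a β‖ ≤ |k| * ‖y‖ := fun β => by
    rw [ha]
    simp only [norm_mul, Complex.norm_I, one_mul, Complex.norm_real, Real.norm_eq_abs]
    gcongr
    have := abs_real_inner_le_norm (β : E3) y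
    rwa [norm_S2, one_mul] at this
  have hexp : ∀ β, ∀ z ∈ ball z₀ 1,
      ‖Complex.exp (z * a β)‖ ≤ Real.exp ((‖z₀‖ + 1) * (|k| * ‖y‖)) := fun β z hz => by
    refine (Complex.norm_exp_le_exp_norm _).trans (Real.exp_le_exp.2 ?_)
    rw [norm_mul]
    have h1 : ‖z‖ ≤ ‖z₀‖ + 1 := by
      have := norm_le_norm_add_norm_sub' z z₀
      rw [mem_ball, dist_eq_norm] at hz
      linarith
    have := hab β
    gcongr
  have hint : ∀ z : ℂ, AEStronglyMeasurable (fun β => Complex.exp (z * a β) * G β) surf :=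
    fun z => (Continuous.aestronglyMeasurable (by fun_prop)).mul hG.1
  have h := hasDerivAt_integral_of_dominated_loc_of_deriv_le (μ := surf) (𝕜 := ℂ)
    (F := fun z β => Complex.exp (z * a β) * G β)
    (F' := fun z β => a β * Complex.exp (z * a β) * G β) (x₀ := z₀) (s := ball z₀ 1)
    (bound := fun β => (|k| * ‖y‖) * Real.exp ((‖z₀‖ + 1) * (|k| * ‖y‖)) * ‖G β‖)
    (ball_mem_nhds _ one_pos) (Eventually.of_forall hint)
    (hG.bdd_mul (c := Real.exp ((‖z₀‖ + 1) * (|k| * ‖y‖)))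
      (Continuous.aestronglyMeasurable (by fun_prop))
      (Eventually.of_forall fun β => hexp β z₀ (mem_ball_self one_pos)))
    ((Continuous.aestronglyMeasurable (by fun_prop)).mul hG.1)
    (Eventually.of_forall fun β z hz => by
      rw [norm_mul, norm_mul]
      have h1 := hab β
      have h2 := hexp β z hz
      gcongr)
    (hG.norm.const_mul _)
    (Eventually.of_forall fun β z _ => by
      have h1 : HasDerivAt (fun z : ℂ => z * a β) (a β) z := by
        simpa using (hasDerivAt_id z).mul_const (a β)
      exact (h1.cexp.mul_const (G β)).congr_deriv (by ring))
  exact h.2.differentiableAt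

/-- A superposition vanishing on a nonempty open set vanishes everywhere. -/
lemma herglotz_eq_zero {F : S2 → ℂ} (hF : Integrable F surf) (hD : IsOpen D) (hne : D.Nonempty)
    (h0 : ∀ x ∈ D, herglotz k F x = 0) (x : E3) : herglotz k F x = 0 := by
  obtain ⟨x₀, hx₀⟩ := hne
  set G : S2 → ℂ := fun β => Complex.exp (Complex.I * ((k * ⟪(β : E3), x₀⟫_ℝ : ℝ) : ℂ)) * F β
  have hG : Integrable G surf := integrable_exp_inner_mul hF x₀
  set φ : ℂ → ℂ := fun z => ∫ β, Complex.exp (z * (Complex.I *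
    ((k * ⟪(β : E3), x - x₀⟫_ℝ : ℝ) : ℂ))) * G β ∂surf with hφ
  have hφt : ∀ t : ℝ, φ t = herglotz k F (x₀ + t • (x - x₀)) := fun t => by
    refine integral_congr_ae (Eventually.of_forall fun β => ?_)
    simp only [G, ← mul_assoc, ← Complex.exp_add]
    congr 2
    rw [inner_add_right, inner_smul_right]
    push_cast
    ring
  -- `φ` is the superposition along the complex line through `x₀` and `x`: it vanishes for small
  -- real parameters because `D` is open, and the parameter `1` is the point `x`.
  have han : AnalyticOnNhd ℂ φ univ := fun z _ =>
    (differentiable_integral_exp k hG (x - x₀)).analyticAt z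
  have hev : ∀ᶠ t : ℝ in 𝓝 0, φ t = 0 := by
    have hc : Tendsto (fun t : ℝ => x₀ + t • (x - x₀)) (𝓝 0) (𝓝 x₀) := by
      have : Continuous fun t : ℝ => x₀ + t • (x - x₀) := by fun_prop
      simpa using this.tendsto 0
    filter_upwards [hc.eventually (hD.mem_nhds hx₀)] with t ht
    rw [hφt, h0 _ ht]
  have hfreq : ∃ᶠ z : ℂ in 𝓝[≠] 0, φ z = 0 := by
    have ht : Tendsto (fun t : ℝ => (t : ℂ)) (𝓝[≠] 0) (𝓝[≠] 0) := by
      refine tendsto_nhdsWithin_iff.2 ⟨?_, ?_⟩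
      · exact (Complex.continuous_ofReal.tendsto' 0 0 Complex.ofReal_zero).mono_left
          nhdsWithin_le_nhds
      · filter_upwards [self_mem_nhdsWithin] with t ht using Complex.ofReal_ne_zero.2 ht
    exact ht.frequently (hev.filter_mono nhdsWithin_le_nhds).frequently
  have h1 := han.eqOn_zero_of_preconnected_of_frequently_eq_zero isPreconnected_univ
    (mem_univ 0) hfreq (mem_univ ((1 : ℝ) : ℂ))
  rw [hφt, one_smul, add_sub_cancel] at h1
  exact h1

/-- The restriction of a plane wave to the sphere of directions. -/
noncomputable def sphereWave (k : ℝ) (y : E3) : C(S2, ℂ) :=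
  ⟨fun β => Complex.exp (Complex.I * ((k * ⟪(β : E3), y⟫_ℝ : ℝ) : ℂ)), by fun_prop⟩

lemma sphereWave_apply (k : ℝ) (y : E3) (β : S2) :
    sphereWave k y β = Complex.exp (Complex.I * ((k * ⟪(β : E3), y⟫_ℝ : ℝ) : ℂ)) := rfl

/-- Stone–Weierstrass. Products and conjugates of plane waves are plane waves, with vectors `y + y'`
and `-y`, so the span is already the star algebra they generate. To separate `β` from `β'`, take `y`
along `β - β'`, scaled so that the two phases differ by `π`. -/
lemma dense_span_sphereWave (hk : 0 < k) :
    Dense (Submodule.span ℂ (range (sphereWave k)) : Set C(S2, ℂ)) := by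
  have hmul : ∀ y y', sphereWave k y * sphereWave k y' = sphereWave k (y + y') := fun y y' => by
    ext β
    rw [ContinuousMap.mul_apply, sphereWave_apply, sphereWave_apply, sphereWave_apply,
      ← Complex.exp_add, inner_add_right]
    congr 1; push_cast; ring
  have hone : sphereWave k 0 = 1 := by
    ext β
    rw [sphereWave_apply, inner_zero_right]
    simp
  have hstar : ∀ y, star (sphereWave k y) = sphereWave k (-y) := fun y => by
    ext β
    rw [ContinuousMap.star_apply, sphereWave_apply, sphereWave_apply, RCLike.star_def,
      ← Complex.exp_conj, map_mul, Complex.conj_I, Complex.conj_ofReal, inner_neg_right]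
    congr 1; push_cast; ring
  let S : Submonoid C(S2, ℂ) :=
    { carrier := range (sphereWave k)
      mul_mem' := by rintro _ _ ⟨y, rfl⟩ ⟨y', rfl⟩; exact ⟨y + y', (hmul y y').symm⟩
      one_mem' := ⟨0, hone⟩ }
  let A : StarSubalgebra ℂ C(S2, ℂ) :=
    { Algebra.adjoin ℂ (range (sphereWave k)) with
      star_mem' := fun {a} ha => by
        have h1 : star (range (sphereWave k)) = range (sphereWave k) := by
          ext f
          rw [Set.mem_star]
          constructor
          · rintro ⟨y, hy⟩
            exact ⟨-y, by rw [← hstar, hy, star_star]⟩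
          · rintro ⟨y, rfl⟩
            exact ⟨-y, (hstar y).symm⟩
        have h2 := Subalgebra.star_adjoin_comm ℂ (range (sphereWave k))
        rw [h1] at h2
        have h3 : star a ∈ star (Algebra.adjoin ℂ (range (sphereWave k))) :=
          Subalgebra.star_mem_star_iff _ a |>.2 ha
        rw [h2] at h3
        exact h3 }
  have hsep : A.SeparatesPoints := by
    intro β β' hne
    have hne' : (β : E3) ≠ β' := fun h => hne (Subtype.ext h)
    set v : E3 := (β : E3) - β' with hv
    have hv0 : 0 < ‖v‖ := norm_pos_iff.2 (sub_ne_zero.2 hne')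
    set y : E3 := (Real.pi / (k * ‖v‖ ^ 2)) • v with hy
    refine ⟨sphereWave k y, ⟨sphereWave k y, Algebra.subset_adjoin ⟨y, rfl⟩, rfl⟩, fun heq => ?_⟩
    rw [sphereWave_apply, sphereWave_apply] at heq
    have e : Complex.I * ((k * ⟪(β : E3), y⟫_ℝ : ℝ) : ℂ) =
        Complex.I * ((k * ⟪(β' : E3), y⟫_ℝ : ℝ) : ℂ) + Real.pi * Complex.I := by
      have h1 : ⟪(β : E3), y⟫_ℝ = ⟪(β' : E3), y⟫_ℝ + Real.pi / k := by
        have : ⟪v, y⟫_ℝ = Real.pi / k := by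
          rw [hy, inner_smul_right, real_inner_self_eq_norm_sq]
          field_simp
        rw [hv, inner_sub_left] at this
        linarith
      rw [h1, mul_add, mul_div_cancel₀ _ hk.ne']
      push_cast; ring
    rw [e, Complex.exp_add, Complex.exp_pi_mul_I] at heq
    have h2 : Complex.exp (Complex.I * ((k * ⟪(β' : E3), y⟫_ℝ : ℝ) : ℂ)) = 0 := by
      linear_combination (-1 / 2 : ℂ) * heq
    exact Complex.exp_ne_zero _ h2
  have htop := ContinuousMap.starSubalgebra_topologicalClosure_eq_top_of_separatesPoints A hsep
  have hspan : (A : Set C(S2, ℂ)) = (Submodule.span ℂ (range (sphereWave k)) : Set C(S2, ℂ)) := by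
    have h1 := Algebra.adjoin_eq_span (R := ℂ) (range (sphereWave k))
    have h2 : (Submonoid.closure (range (sphereWave k)) : Set C(S2, ℂ)) = range (sphereWave k) :=
      congrArg (fun T : Submonoid C(S2, ℂ) => (T : Set C(S2, ℂ))) (Submonoid.closure_eq S)
    rw [h2] at h1
    exact congrArg (fun T : Submodule ℂ C(S2, ℂ) => (T : Set C(S2, ℂ))) h1
  rw [← hspan, dense_iff_closure_eq, ← StarSubalgebra.topologicalClosure_coe, htop]
  rfl

/-- A square-integrable density is determined by its superposition of plane waves. -/
lemma eq_zero_of_herglotz_eq_zero (hk : 0 < k) {F : L2S} (h0 : ∀ x, herglotz k F x = 0) :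
    F = 0 := by
  have hd1 : DenseRange (ContinuousMap.toLp 2 surf ℂ : C(S2, ℂ) →L[ℂ] L2S) :=
    ContinuousMap.toLp_denseRange ℂ surf ℂ (by norm_num)
  set T : C(S2, ℂ) →L[ℂ] ℂ := (innerSL ℂ F).comp (ContinuousMap.toLp 2 surf ℂ) with hT
  have hTw : ∀ y, T (sphereWave k y) = 0 := fun y => by
    change inner ℂ F (ContinuousMap.toLp 2 surf ℂ (sphereWave k y)) = 0
    rw [← inner_conj_symm, L2.inner_def]
    have : ∫ β, inner ℂ ((ContinuousMap.toLp 2 surf ℂ (sphereWave k y) : L2S) β) (F β) ∂surf =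
        herglotz k F (-y) := by
      refine integral_congr_ae ?_
      filter_upwards [ContinuousMap.coeFn_toLp (p := 2) (𝕜 := ℂ) surf (sphereWave k y)] with β hβ
      rw [hβ, RCLike.inner_apply, sphereWave_apply, ← Complex.exp_conj, map_mul, Complex.conj_I,
        Complex.conj_ofReal, inner_neg_right, mul_comm]
      congr 2; push_cast; ring
    rw [this, h0, map_zero]
  have hT0 : ∀ g, T g = 0 := by
    have hcl : IsClosed {g | T g = 0} := isClosed_eq T.continuous continuous_const
    have hsub : (Submodule.span ℂ (range (sphereWave k)) : Set C(S2, ℂ)) ⊆ {g | T g = 0} := by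
      have : Submodule.span ℂ (range (sphereWave k)) ≤ LinearMap.ker (T : C(S2, ℂ) →ₗ[ℂ] ℂ) := by
        rw [Submodule.span_le]
        rintro _ ⟨y, rfl⟩
        exact hTw y
      exact this
    intro g
    have := (hcl.closure_subset_iff.2 hsub) (dense_span_sphereWave hk g)
    exact this
  have hcl : IsClosed {G : L2S | inner ℂ F G = 0} :=
    isClosed_eq (innerSL ℂ F).continuous continuous_const
  have hF : inner ℂ F F = 0 := by
    have := (hcl.closure_subset_iff.2 (by rintro _ ⟨g, rfl⟩; exact hT0 g)) (hd1 F)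
    exact this
  exact inner_self_eq_zero.1 hF

end FarFieldDensity


/-! ### Density of the far-field integrals. -/

section FarFieldTotal

variable {k : ℝ} {D : Set E3}

/-- Fubini identifies the plane-wave superposition as the adjoint of the far-field map. -/
lemma integral_mul_conj_farField {h : E3 → ℂ} (hh : IntegrableOn h D) {F : S2 → ℂ}
    (hF : Integrable F surf) :
    ∫ β, F β * (starRingEnd ℂ) (farField k D h β) ∂surf =
      ∫ x in D, (starRingEnd ℂ) (h x) * herglotz k F x := by
  have hint : Integrable (Function.uncurry fun (β : S2) (x : E3) =>
      Complex.exp (Complex.I * ((k * ⟪(β : E3), x⟫_ℝ : ℝ) : ℂ)) * (F β * (starRingEnd ℂ) (h x)))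
      (surf.prod (volume.restrict D)) := by
    have h1 : Integrable (fun p : S2 × E3 => F p.1 * (starRingEnd ℂ) (h p.2))
        (surf.prod (volume.restrict D)) :=
      hF.mul_prod (f := F) (g := fun x => (starRingEnd ℂ) (h x))
        (Complex.conjLIE.toContinuousLinearEquiv.toContinuousLinearMap.integrable_comp hh)
    refine h1.bdd_mul (c := 1) (f := fun p : S2 × E3 =>
      Complex.exp (Complex.I * ((k * ⟪(p.1 : E3), p.2⟫_ℝ : ℝ) : ℂ)))
      (Continuous.aestronglyMeasurable (by fun_prop))
      (Eventually.of_forall fun p => (norm_exp_I_inner k p.1 p.2).le)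
  have e1 : ∀ β, F β * (starRingEnd ℂ) (farField k D h β) = ∫ x in D,
      Complex.exp (Complex.I * ((k * ⟪(β : E3), x⟫_ℝ : ℝ) : ℂ)) *
        (F β * (starRingEnd ℂ) (h x)) := fun β => by
    unfold farField
    rw [← integral_conj, ← integral_const_mul]
    refine integral_congr_ae (Eventually.of_forall fun x => ?_)
    simp only [map_mul, ← Complex.exp_conj, map_neg, Complex.conj_I, Complex.conj_ofReal, neg_mul,
      neg_neg]
    ring
  have e2 : ∀ x, (starRingEnd ℂ) (h x) * herglotz k F x = ∫ β,
      Complex.exp (Complex.I * ((k * ⟪(β : E3), x⟫_ℝ : ℝ) : ℂ)) *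
        (F β * (starRingEnd ℂ) (h x)) ∂surf := fun x => by
    unfold herglotz
    rw [← integral_const_mul]
    refine integral_congr_ae (Eventually.of_forall fun β => ?_)
    ring
  simp_rw [e1, e2]
  exact integral_integral_swap hint

lemma integrableOn_of_memLp (hD : volume D ≠ ⊤) {h : E3 → ℂ} (hh : MemLp h 2 (volume.restrict D)) :
    IntegrableOn h D := by
  have hfin : IsFiniteMeasure (volume.restrict D) := ⟨by
    rw [Measure.restrict_apply_univ]; exact hD.lt_top⟩
  exact hh.integrable (by norm_num)

lemma farField_congr {h h' : E3 → ℂ} (he : h =ᵐ[volume.restrict D] h') :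
    farField k D h = farField k D h' := by
  funext β
  refine integral_congr_ae ?_
  filter_upwards [he] with x hx
  rw [hx]

lemma memLp_farField {h : E3 → ℂ} (hh : IntegrableOn h D) : MemLp (farField k D h) 2 surf :=
  MemLp.of_bound (continuous_farField hh).aestronglyMeasurable _
    (Eventually.of_forall fun β => norm_farField_le β)

/-- The far-field integrals of square-integrable densities are dense in `L²(S²)`. -/
theorem dense_farField (hk : 0 < k) (hDo : IsOpen D) (hne : D.Nonempty) (hD : volume D ≠ ⊤) :
    Dense {F : L2S | ∃ h : L2D D, F =ᵐ[surf] farField k D h} := by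
  have hfin : IsFiniteMeasure (volume.restrict D) := ⟨by
    rw [Measure.restrict_apply_univ]; exact hD.lt_top⟩
  have hi : ∀ h : L2D D, IntegrableOn h D := fun h => integrableOn_of_memLp hD (Lp.memLp h)
  let S : Submodule ℂ L2S :=
    { carrier := {F : L2S | ∃ h : L2D D, F =ᵐ[surf] farField k D h}
      zero_mem' := ⟨0, by
        have h1 : farField k D (0 : L2D D) = 0 := by
          rw [farField_congr (Lp.coeFn_zero ℂ 2 (volume.restrict D))]
          funext β
          simp [farField]
        rw [h1]
        exact Lp.coeFn_zero ℂ 2 surf⟩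
      add_mem' := by
        rintro F F' ⟨h, hF⟩ ⟨h', hF'⟩
        refine ⟨h + h', ?_⟩
        rw [farField_congr (Lp.coeFn_add h h')]
        filter_upwards [hF, hF', Lp.coeFn_add F F'] with β h1 h2 h3
        rw [h3, Pi.add_apply, h1, h2]
        unfold farField
        rw [← integral_add (integrable_exp_mul (hi h) _) (integrable_exp_mul (hi h') _)]
        refine integral_congr_ae (Eventually.of_forall fun x => ?_)
        simp only [Pi.add_apply]
        ring
      smul_mem' := by
        rintro c F ⟨h, hF⟩
        refine ⟨c • h, ?_⟩
        rw [farField_congr (Lp.coeFn_smul c h)]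
        filter_upwards [hF, Lp.coeFn_smul c F] with β h1 h3
        rw [h3, Pi.smul_apply, h1, smul_eq_mul]
        unfold farField
        rw [← integral_const_mul]
        refine integral_congr_ae (Eventually.of_forall fun x => ?_)
        simp only [Pi.smul_apply, smul_eq_mul]
        ring }
  change Dense (S : Set L2S)
  rw [Submodule.dense_iff_topologicalClosure_eq_top, Submodule.topologicalClosure_eq_top_iff,
    Submodule.eq_bot_iff]
  intro F hF
  refine eq_zero_of_herglotz_eq_zero hk fun x => ?_
  have hFi : Integrable F surf := (Lp.memLp F).integrable (by norm_num)
  refine herglotz_eq_zero hFi hDo hne ?_ x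
  have hc : Continuous (herglotz k F) := continuous_herglotz hFi
  -- Orthogonality is tested with the superposition of `F` itself as density, which gives `∫_D
  -- |herglotz k F|² = 0`.
  have hm : MemLp (herglotz k F) 2 (volume.restrict D) :=
    MemLp.of_bound hc.aestronglyMeasurable _ (Eventually.of_forall fun x => norm_herglotz_le x)
  have hΨ := hm.coeFn_toLp
  have hG := memLp_farField (k := k) (hi (hm.toLp _))
  have horth : inner ℂ (hG.toLp _) F = 0 := hF _ ⟨hm.toLp _, hG.coeFn_toLp⟩
  have h1 : ∫ β, F β * (starRingEnd ℂ) (farField k D (hm.toLp _) β) ∂surf = 0 := by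
    rw [L2.inner_def] at horth
    rw [← horth]
    refine integral_congr_ae ?_
    filter_upwards [hG.coeFn_toLp] with β hβ
    rw [hβ, RCLike.inner_apply]
  rw [integral_mul_conj_farField (hi _) hFi] at h1
  have h2 : ∫ x in D, ‖herglotz k F x‖ ^ 2 = 0 := by
    have h3 : ∫ x in D, ((‖herglotz k F x‖ ^ 2 : ℝ) : ℂ) = 0 := by
      rw [← h1]
      refine integral_congr_ae ?_
      filter_upwards [hΨ] with x hx
      rw [hx, RCLike.conj_mul]
      push_cast; rfl
    have h1' := integral_ofReal (𝕜 := ℂ) (μ := volume.restrict D)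
      (f := fun x => ‖herglotz k F x‖ ^ 2)
    exact Complex.ofReal_eq_zero.1 (h1'.symm.trans h3)
  have h3 : herglotz k F =ᵐ[volume.restrict D] fun _ => 0 := by
    have := (integral_eq_zero_iff_of_nonneg (fun x => by positivity)
      (hm.integrable_norm_pow (by norm_num))).1 h2
    filter_upwards [this] with x hx
    exact norm_eq_zero.1 ((pow_eq_zero_iff two_ne_zero).1 hx)
  exact Measure.eqOn_open_of_ae_eq h3 hDo hc.continuousOn continuousOn_const

end FarFieldTotal


/-! ### Uniqueness, approximation of amplitudes, infinitude. -/

section Conclusion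

variable {k : ℝ} {α : S2} {D E : Set E3} {c M : ℝ}

lemma denom_congr {h h' : E3 → ℂ} (he : h =ᵐ[volume.restrict D] h') :
    denom k α D h = denom k α D h' := by
  funext x
  rw [denom_eq, denom_eq, potential_congr he]

/-- The weak equation is a single Bochner integral; subtracting two such equations requires each
integrand to be integrable. -/
lemma integrable_solvesSchrodinger {q u φ : E3 → ℂ} (hq : Integrable q) (hu : Continuous u)
    (hφ : ContDiff ℝ ∞ φ) (hc : HasCompactSupport φ) :
    Integrable fun x =>
      u x * (Laplacian.laplacian φ x + (k : ℂ) ^ 2 * φ x) - q x * u x * φ x := by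
  have hφ2 : ContDiff ℝ 2 φ := hφ.of_le (by norm_cast)
  have i1 : Integrable fun x => u x * Laplacian.laplacian φ x :=
    (hu.mul (continuous_laplacian hφ2)).integrable_of_hasCompactSupport
      (hasCompactSupport_laplacian hc).mul_left
  have i2 : Integrable fun x => u x * ((k : ℂ) ^ 2 * φ x) :=
    (hu.mul (continuous_const.mul hφ.continuous)).integrable_of_hasCompactSupport
      hc.mul_left.mul_left
  have hs : HasCompactSupport fun x => u x * φ x := hc.mul_left
  obtain ⟨C, hC⟩ := hs.exists_bound_of_continuous (hu.mul hφ.continuous)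
  have i3 : Integrable fun x => q x * (u x * φ x) :=
    hq.mul_bdd (c := C) (hu.mul hφ.continuous).aestronglyMeasurable (Eventually.of_forall hC)
  refine ((i1.add i2).sub i3).congr (Eventually.of_forall fun x => ?_)
  simp only [Pi.sub_apply, Pi.add_apply]
  ring

lemma SolvesSchrodinger.sub {q u u' : E3 → ℂ} (hq : Integrable q) (hu : Continuous u)
    (hu' : Continuous u') (h : SolvesSchrodinger k q u) (h' : SolvesSchrodinger k q u') :
    SolvesSchrodinger k q fun x => u x - u' x := by
  intro φ hφ hc
  have e := integral_sub (integrable_solvesSchrodinger (k := k) hq hu hφ hc)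
    (integrable_solvesSchrodinger (k := k) hq hu' hφ hc)
  rw [h φ hφ hc, h' φ hφ hc, sub_zero] at e
  rw [← e]
  refine integral_congr_ae (Eventually.of_forall fun x => ?_)
  ring

/-- Without nonzero homogeneous solutions, a scattering solution is unique. -/
lemma eq_of_homSol_eq_bot (hk : 0 < k) (hDm : MeasurableSet D) (hDb : Bornology.IsBounded D)
    {q q₀ : E3 → ℂ} (hqm : Measurable q₀) (hqM : ∀ x, ‖q₀ x‖ ≤ M)
    (hq : q =ᵐ[volume.restrict D] q₀) (hbot : homSol k D q₀ = ⊥) {u u' : E3 → ℂ} {A A' : S2 → ℂ}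
    (hu : IsScatteringSolution k α (D.indicator q) u A)
    (hu' : IsScatteringSolution k α (D.indicator q) u' A') : u' = u := by
  have hD : volume D ≠ ⊤ := hDb.measure_lt_top.ne
  have hqi : Integrable (D.indicator q) := by
    rw [integrable_indicator_iff hDm]
    exact (integrableOn_of_bounded hD hqm hqM).congr hq.symm
  have hout := hu'.farField.sub hu.farField
  have hc : Continuous fun x => u' x - u x := hu'.continuous.sub hu.continuous
  obtain ⟨C, hC⟩ := hout.exists_bound hc
  have hb : ∀ x, ‖u' x - u x‖ ≤ C := fun x =>
    (le_mul_of_one_le_right (norm_nonneg _) (by linarith [norm_nonneg x])).trans (hC x)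
  have hbq : ∀ᵐ y ∂volume.restrict D, ‖q y‖ ≤ M := hq.mono fun y hy => by rw [hy]; exact hqM y
  have hrep := eq_neg_potential_of_isOutgoing hk hDm hDb
    (hqm.aestronglyMeasurable.congr hq.symm) hbq hc hout
    (hu'.solves.sub hqi hu'.continuous hu.continuous hu.solves)
  set w : BoundedContinuousFunction E3 ℂ :=
    BoundedContinuousFunction.ofNormedAddCommGroup (fun x => u' x - u x) hc C hb with hw
  have hmem : w ∈ homSol k D q₀ := by
    rw [mem_homSol hD hqm hqM]
    intro x
    change u' x - u x = _
    rw [hrep x]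
    congr 1
    refine potential_congr ?_ x
    filter_upwards [hq] with y hy
    rw [hy]; rfl
  rw [hbot, Submodule.mem_bot] at hmem
  funext x
  have : w x = 0 := by rw [hmem]; rfl
  exact sub_eq_zero.1 this

/-- Perturbing a density so that the quotient is a bounded potential with a unique scattering
solution. -/
theorem exists_near_isUniqueScatteringSolution (hk : 0 < k) (α : S2) (hDm : MeasurableSet D)
    (hDb : Bornology.IsBounded D) (h : L2D D) {δ : ℝ} (hδ : 0 < δ) :
    ∃ h' q : L2D D, ‖h' - h‖ < δ ∧ IsQuotientPotential k α D h' q ∧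
      DenomBoundedBelow k α D h' ∧ MemLp q ∞ (volume.restrict D) ∧
      IsUniqueScatteringSolution k α (D.indicator q) (denom k α D h')
        (fun β => -(1 / (4 * (Real.pi : ℂ))) * farField k D h' β) := by
  have hD : volume D ≠ ⊤ := hDb.measure_lt_top.ne
  have hfin : IsFiniteMeasure (volume.restrict D) := ⟨by
    rw [Measure.restrict_apply_univ]; exact hD.lt_top⟩
  have hδ2 : 0 < ENNReal.ofReal (δ / 2) := ENNReal.ofReal_pos.2 (by positivity)
  -- The construction of admissible densities starts from a bounded one, so half of `δ` is spent on
  -- this replacement.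
  obtain ⟨g, hg, hgm⟩ := (Lp.memLp h).exists_boundedContinuous_eLpNorm_sub_le (by norm_num) hδ2.ne'
  obtain ⟨E, c, M, h', hE, hED, hc, hA, hbot, hnear⟩ := exists_isAdmissible_homSol_eq_bot hk.le α
    hDm hDb g.continuous.measurable (fun x => g.norm_coe_le_norm x) hδ2
  have hm : MemLp h' 2 (volume.restrict D) :=
    MemLp.of_bound hA.measurable.aestronglyMeasurable _ (Eventually.of_forall hA.norm_le)
  have hqmeas := hA.measurable_quot hk.le hD hE
  have hqb := hA.norm_quot_le hc
  have hmq : ∀ p, MemLp (quot k α D E h') p (volume.restrict D) := fun p =>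
    MemLp.of_bound hqmeas.aestronglyMeasurable _ (Eventually.of_forall hqb)
  have eh := hm.coeFn_toLp
  have eq := (hmq 2).coeFn_toLp
  have ed : denom k α D (hm.toLp h') = denom k α D h' := denom_congr eh
  have hsupp : ∀ x, h' x ≠ 0 → x ∈ E := fun x hx => by_contra fun hxE => hx (hA.eq_zero x hxE)
  have hquot : IsQuotientPotential k α D (hm.toLp h') ((hmq 2).toLp _) := by
    rw [IsQuotientPotential, ed]
    refine ⟨?_, ?_⟩
    · filter_upwards [eh] with x hx h0
      rw [hx] at h0
      exact hA.denom_ne_zero hc (hsupp x h0)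
    · filter_upwards [eh, eq] with x hx hqx
      rw [hx, hqx]
      by_cases hxE : x ∈ E
      · rw [quot, recip, indicator_of_mem hxE, div_eq_mul_inv]
      · rw [hA.quot_eq_zero hxE, hA.eq_zero x hxE, zero_div]
  have hsol := isScatteringSolution_denom hk.le α hDm hDb (Lp.memLp (hm.toLp h')) hquot.mul_denom
  refine ⟨hm.toLp h', (hmq 2).toLp _, ?_, hquot, ⟨c, hc, ?_⟩, (hmq ∞).ae_eq eq.symm, hsol,
    fun u' A' hu' => eq_of_homSol_eq_bot hk hDm hDb hqmeas hqb eq hbot hsol hu'⟩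
  · rw [Lp.norm_def]
    refine ENNReal.toReal_lt_of_lt_ofReal ?_
    have e : ⇑(hm.toLp h' - h) =ᵐ[volume.restrict D] (h' - g) - (⇑h - g) := by
      filter_upwards [eh, Lp.coeFn_sub (hm.toLp h') h] with x h1 h2
      rw [h2]
      simp only [Pi.sub_apply, h1]
      ring
    rw [eLpNorm_congr_ae e]
    refine (eLpNorm_sub_le (hA.measurable.sub g.continuous.measurable).aestronglyMeasurable
      ((Lp.aestronglyMeasurable h).sub g.continuous.aestronglyMeasurable) (by norm_num)).trans_lt ?_
    calc _ < ENNReal.ofReal (δ / 2) + ENNReal.ofReal (δ / 2) :=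
          ENNReal.add_lt_add_of_lt_of_le (hg.trans_lt ENNReal.ofReal_lt_top).ne hnear hg
      _ = ENNReal.ofReal δ := by
          rw [← ENNReal.ofReal_add (by positivity) (by positivity), add_halves]
  · rw [ed]
    filter_upwards [eh] with x hx h0
    rw [hx] at h0
    exact hA.le_denom x (hsupp x h0)

/-- The amplitudes of nearby densities approximate any amplitude. -/
lemma exists_ball_eLpNorm_lt (hk : 0 < k) (hDo : IsOpen D) (hne : D.Nonempty) (hD : volume D ≠ ⊤)
    (f : L2S) {ε : ℝ} (hε : 0 < ε) :
    ∃ (h₀ : L2D D) (r : ℝ), 0 < r ∧ ∀ h : L2D D, ‖h - h₀‖ < r →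
      eLpNorm (fun β => f β - -(1 / (4 * (Real.pi : ℂ))) * farField k D h β) 2 surf <
        ENNReal.ofReal ε := by
  have hfin : IsFiniteMeasure (volume.restrict D) := ⟨by
    rw [Measure.restrict_apply_univ]; exact hD.lt_top⟩
  have hi : ∀ h : L2D D, IntegrableOn h D := fun h => integrableOn_of_memLp hD (Lp.memLp h)
  have hpi : (4 * (Real.pi : ℂ)) ≠ 0 := by
    simp [Real.pi_ne_zero]
  set a : ℂ := 1 / (4 * (Real.pi : ℂ)) with ha
  have ha0 : a ≠ 0 := one_div_ne_zero hpi
  -- The amplitude is `-a` times the far-field integral, so the target is `-a⁻¹ f` and the tolerance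
  -- is divided by `|a|`.
  obtain ⟨F, ⟨h₀, hF⟩, hFd⟩ := (dense_farField hk hDo hne hD).exists_dist_lt (-(a⁻¹ • f))
    (ε := ε / 2 / ‖a‖) (div_pos (by positivity) (norm_pos_iff.2 ha0))
  -- the amplitude of `h₀` is close to `f`
  have h1 : eLpNorm (fun β => f β - -a * farField k D h₀ β) 2 surf < ENNReal.ofReal (ε / 2) := by
    have e : (fun β => f β - -a * farField k D h₀ β) =ᵐ[surf] ⇑(f + a • F) := by
      filter_upwards [hF, Lp.coeFn_add f (a • F), Lp.coeFn_smul a F] with β b1 b2 b3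
      rw [b2, Pi.add_apply, b3, Pi.smul_apply, smul_eq_mul, b1]
      ring
    rw [eLpNorm_congr_ae e, ← Lp.enorm_def, ← ofReal_norm]
    refine (ENNReal.ofReal_lt_ofReal_iff (by positivity)).2 ?_
    have e2 : f + a • F = -(a • (-(a⁻¹ • f) - F)) := by
      rw [smul_sub, smul_neg, smul_inv_smul₀ ha0]
      abel
    rw [e2, norm_neg, norm_smul, ← dist_eq_norm]
    rw [lt_div_iff₀ (norm_pos_iff.2 ha0)] at hFd
    linarith
  -- continuity of the amplitude in the density
  set C : ℝ := ((volume.restrict D) univ ^ (1 / (1 : ℝ≥0∞).toReal - 1 / (2 : ℝ≥0∞).toReal)).toReal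
    with hC
  have hCtop : (volume.restrict D) univ ^ (1 / (1 : ℝ≥0∞).toReal - 1 / (2 : ℝ≥0∞).toReal) ≠ ⊤ :=
    ENNReal.rpow_ne_top_of_nonneg (by norm_num) (measure_ne_top _ _)
  have hL1 : ∀ g : L2D D, ∫ x in D, ‖g x‖ ≤ ‖g‖ * C := fun g => by
    have h2 := eLpNorm_le_eLpNorm_mul_rpow_measure_univ (p := 1) (q := 2) (by norm_num)
      (Lp.aestronglyMeasurable g)
    rw [integral_norm_eq_lintegral_enorm (Lp.aestronglyMeasurable g),
      ← eLpNorm_one_eq_lintegral_enorm, Lp.norm_def, hC, ← ENNReal.toReal_mul]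
    exact ENNReal.toReal_mono (ENNReal.mul_ne_top (Lp.eLpNorm_ne_top g) hCtop) h2
  set K : ℝ≥0∞ := surf univ ^ (2 : ℝ≥0∞).toReal⁻¹ with hK
  have hKtop : K ≠ ⊤ := ENNReal.rpow_ne_top_of_nonneg (by norm_num) (measure_ne_top _ _)
  have hlim : Tendsto (fun r : ℝ => K * ENNReal.ofReal (‖a‖ * (r * C))) (𝓝 0) (𝓝 0) := by
    have h3 : Tendsto (fun r : ℝ => ‖a‖ * (r * C)) (𝓝 0) (𝓝 0) := by
      have : Continuous fun r : ℝ => ‖a‖ * (r * C) := by fun_prop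
      simpa using this.tendsto 0
    have h4 := ENNReal.tendsto_ofReal h3
    rw [ENNReal.ofReal_zero] at h4
    simpa using ENNReal.Tendsto.const_mul h4 (Or.inr hKtop)
  have hev := hlim.eventually (gt_mem_nhds (ENNReal.ofReal_pos.2 (show 0 < ε / 2 by positivity)))
  obtain ⟨r, hr0, hr⟩ := Metric.eventually_nhds_iff.1 hev
  refine ⟨h₀, r, hr0, fun h hh => ?_⟩
  have e : (fun β => f β - -a * farField k D h β) =
      (fun β => f β - -a * farField k D h₀ β) + fun β => a * farField k D (⇑(h - h₀)) β := by
    funext β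
    have e3 : farField k D (⇑(h - h₀)) β = farField k D h β - farField k D h₀ β := by
      rw [farField_congr (Lp.coeFn_sub h h₀)]
      unfold farField
      rw [← integral_sub (integrable_exp_mul (hi h) _) (integrable_exp_mul (hi h₀) _)]
      refine integral_congr_ae (Eventually.of_forall fun x => ?_)
      simp only [Pi.sub_apply]
      ring
    rw [Pi.add_apply, e3]
    ring
  rw [e]
  refine (eLpNorm_add_le ((Lp.aestronglyMeasurable f).sub
    ((continuous_farField (hi h₀)).aestronglyMeasurable.const_mul _))
    ((continuous_farField (hi (h - h₀))).aestronglyMeasurable.const_mul _)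
    (by norm_num)).trans_lt ?_
  have h5 : eLpNorm (fun β => a * farField k D (⇑(h - h₀)) β) 2 surf <
      ENNReal.ofReal (ε / 2) := by
    refine (eLpNorm_le_of_ae_bound (C := ‖a‖ * (‖h - h₀‖ * C)) (Eventually.of_forall fun β =>
      norm_mul_bound le_rfl ((norm_farField_le β).trans (hL1 _)))).trans_lt ?_
    refine hr ?_
    rw [dist_zero_right, norm_norm]
    exact hh
  calc _ < ENNReal.ofReal (ε / 2) + ENNReal.ofReal (ε / 2) := ENNReal.add_lt_add h1 h5
    _ = ENNReal.ofReal ε := by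
        rw [← ENNReal.ofReal_add (by positivity) (by positivity), add_halves]

lemma nontrivial_L2D (hDo : IsOpen D) (hne : D.Nonempty) (hD : volume D ≠ ⊤) :
    Nontrivial (L2D D) := by
  have hfin : IsFiniteMeasure (volume.restrict D) := ⟨by
    rw [Measure.restrict_apply_univ]; exact hD.lt_top⟩
  have hm : MemLp (fun _ : E3 => (1 : ℂ)) 2 (volume.restrict D) := memLp_const 1
  refine ⟨hm.toLp _, 0, fun h0 => ?_⟩
  have h1 : (fun _ : E3 => (1 : ℂ)) =ᵐ[volume.restrict D] 0 := by
    have := hm.coeFn_toLp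
    rw [h0] at this
    exact this.symm.trans (Lp.coeFn_zero _ _ _)
  have h2 : ∀ᵐ _ ∂volume.restrict D, False := h1.mono fun x hx => one_ne_zero hx
  rw [eventually_false_iff_eq_bot, ae_eq_bot, Measure.restrict_eq_zero] at h2
  exact (hDo.measure_pos volume hne).ne' h2

/-- Infinitely many bounded quotient potentials realise a given amplitude up to an error. -/
theorem infinite_setOf_potential (hk : 0 < k) (α : S2) (hDo : IsOpen D) (hne : D.Nonempty)
    (hDb : Bornology.IsBounded D) (f : L2S) {ε : ℝ} (hε : 0 < ε) :
    {q : L2D D | MemLp q ∞ (volume.restrict D) ∧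
      (∃ h : L2D D, IsQuotientPotential k α D h q ∧ DenomBoundedBelow k α D h) ∧
      ∃ (u : E3 → ℂ) (A : S2 → ℂ), IsUniqueScatteringSolution k α (D.indicator q) u A ∧
        MemLp A 2 surf ∧
        eLpNorm (fun β => f β - A β) 2 surf < ENNReal.ofReal ε}.Infinite := by
  have hD : volume D ≠ ⊤ := hDb.measure_lt_top.ne
  have hDm := hDo.measurableSet
  obtain ⟨h₀, r, hr, hball⟩ := exists_ball_eLpNorm_lt hk hDo hne hD f hε
  set H : Set (L2D D) := {h | ‖h - h₀‖ < r ∧ ∃ q : L2D D, IsQuotientPotential k α D h q ∧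
    DenomBoundedBelow k α D h ∧ MemLp q ∞ (volume.restrict D) ∧
    IsUniqueScatteringSolution k α (D.indicator q) (denom k α D h)
      (fun β => -(1 / (4 * (Real.pi : ℂ))) * farField k D h β)} with hH
  have hHinf : H.Infinite := by
    -- A finite set is closed, and `H` is dense in the ball, so it would contain the ball, which is
    -- infinite because `L²(D)` is nontrivial.
    intro hfinite
    have hsub : ball h₀ r ⊆ H := by
      rw [← hfinite.isClosed.closure_eq]
      intro h hh
      rw [Metric.mem_closure_iff]
      intro δ hδ
      rw [mem_ball, dist_eq_norm] at hh
      obtain ⟨h', q, h1, h2⟩ := exists_near_isUniqueScatteringSolution hk α hDm hDb h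
        (δ := min δ (r - ‖h - h₀‖)) (lt_min hδ (by linarith))
      refine ⟨h', ⟨?_, q, h2⟩, ?_⟩
      · have := norm_sub_le_norm_sub_add_norm_sub h' h h₀
        have := h1.trans_le (min_le_right _ _)
        linarith
      · rw [dist_comm, dist_eq_norm]
        exact h1.trans_le (min_le_left _ _)
    have := nontrivial_L2D hDo hne hD
    have : (𝓝[≠] h₀).NeBot := Module.punctured_nhds_neBot ℂ (L2D D) h₀
    exact (infinite_of_mem_nhds h₀ (ball_mem_nhds h₀ hr)) (hfinite.subset hsub)
  choose! Q hQ using fun (h : L2D D) (hh : h ∈ H) => hh.2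
  refine infinite_of_injOn_mapsTo (f := Q) (s := H) ?_ ?_ hHinf
  · intro h hh h' hh' he
    have s1 := hQ h hh
    have s2 := hQ h' hh'
    -- Equal potentials have the same unique solution `ψ`, and then `h = q ψ` is recovered: distinct
    -- densities give distinct potentials.
    have hu : denom k α D h = denom k α D h' := by
      have h3 := s2.2.2.2.1
      rw [← he] at h3
      exact (s1.2.2.2.2 _ _ h3).symm
    refine Lp.ext ?_
    filter_upwards [s1.1.mul_denom, s2.1.mul_denom] with x h1 h2
    rw [← h1, ← h2, he, hu]
  · intro h hh
    have s1 := hQ h hh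
    refine ⟨s1.2.2.1, ⟨h, s1.1, s1.2.1⟩, _, _, s1.2.2.2, ?_, hball h hh.1⟩
    exact (memLp_farField (integrableOn_of_memLp hD (Lp.memLp h))).const_mul _

end Conclusion

end Scattering

theorem mainTheorem2 (k : ℝ) (hk : 0 < k) (α : Scattering.S2) (D : Set Scattering.E3)
    (hDo : IsOpen D) (hDc : IsConnected D) (hDb : Bornology.IsBounded D) :
    -- solution of the inverse scattering problem
    (∀ (f : Scattering.L2S) (ε : ℝ), 0 < ε →
      {q : Scattering.L2D D |
        MemLp q ∞ (volume.restrict D) ∧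
        (∃ h : Scattering.L2D D, Scattering.IsQuotientPotential k α D h q ∧
          Scattering.DenomBoundedBelow k α D h) ∧
        ∃ (u : Scattering.E3 → ℂ) (A : Scattering.S2 → ℂ),
          Scattering.IsUniqueScatteringSolution k α (D.indicator q) u A ∧
          MemLp A 2 Scattering.surf ∧
          eLpNorm (fun β => f β - A β) 2 Scattering.surf < ENNReal.ofReal ε}.Infinite) ∧
    -- the explicit formula
    (∀ h q : Scattering.L2D D, Scattering.IsQuotientPotential k α D h q →
      (∀ᵐ x ∂((volume : Measure Scattering.E3).restrict D),
        q x * Scattering.denom k α D h x = h x) ∧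
      Scattering.IsScatteringSolution k α (D.indicator q) (Scattering.denom k α D h)
        (fun β => -(1 / (4 * (Real.pi : ℂ))) * Scattering.farField k D h β)) ∧
    -- the perturbation that keeps the denominator away from zero
    (∀ (h : Scattering.L2D D) (δ : ℝ), 0 < δ →
      ∃ h' q : Scattering.L2D D, ‖h' - h‖ < δ ∧
        Scattering.IsQuotientPotential k α D h' q ∧
        Scattering.DenomBoundedBelow k α D h' ∧
        MemLp q ∞ (volume.restrict D) ∧
        Scattering.IsUniqueScatteringSolution k α (D.indicator q) (Scattering.denom k α D h')
          (fun β => -(1 / (4 * (Real.pi : ℂ))) * Scattering.farField k D h' β)) ∧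
    -- the far-field integrals are total in `L²(S²)`
    Dense {F : Scattering.L2S | ∃ h : Scattering.L2D D,
      F =ᵐ[Scattering.surf] Scattering.farField k D h} ∧
    -- the products `q u_q` are total in `L²(D)`
    Dense {p : Scattering.L2D D | ∃ (q : Scattering.L2D D) (u : Scattering.E3 → ℂ)
        (A : Scattering.S2 → ℂ),
      Scattering.IsUniqueScatteringSolution k α (D.indicator q) u A ∧
      ∀ᵐ x ∂((volume : Measure Scattering.E3).restrict D), p x = q x * u x} := by
  have hDm : MeasurableSet D := hDo.measurableSet
  have hD : volume D ≠ ⊤ := hDb.measure_lt_top.ne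
  refine ⟨fun f ε hε => Scattering.infinite_setOf_potential hk α hDo hDc.nonempty hDb f hε,
    fun h q hq => ⟨hq.mul_denom, Scattering.isScatteringSolution_denom hk.le α hDm hDb
      (Lp.memLp h) hq.mul_denom⟩,
    fun h δ hδ => Scattering.exists_near_isUniqueScatteringSolution hk α hDm hDb h hδ,
    Scattering.dense_farField hk hDo hDc.nonempty hD, ?_⟩
  -- The perturbed density `h'` is itself the product `q u_q`, so the perturbation statement already
  -- gives density.
  refine Metric.dense_iff.2 fun h δ hδ => ?_
  obtain ⟨h', q, h1, h2, -, -, h3⟩ :=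
    Scattering.exists_near_isUniqueScatteringSolution hk α hDm hDb h hδ
  refine ⟨h', ?_, q, _, _, h3, ?_⟩
  · rwa [mem_ball, dist_eq_norm]
  · filter_upwards [h2.mul_denom] with x hx
    exact hx.symm
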